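/- All graphs are finite and simple. A semi-plane tree is a finite rooted tree (possibly empty) in which the children of some internal nodes (the C-nodes) are linearly ordered by a relation $\vartriangleleft$; its height is the number of nodes on a longest root–leaf path, and its ground is its set of leaves. A cotree is such a tree without C-nodes, with internal nodes labeled U or J; it models the graph on its leaves in which two distinct leaves are adjacent iff their infimum has label J. A bicotree has leaves colored 1 or 2 and internal nodes labeled U, B or O, the O-nodes being exactly the C-nodes; it models the graph on its leaves in which $x$ of color 1 and $y$ of color 2 are adjacent iff their infimum $m$ has label B, or has label O and the child of $m$ above which $x$ lies is before the child of $m$ above which $y$ lies. A cograph (resp. sob, with given color classes) has height at most $h$ if it is modeled by a cotree (resp. a bicotree with these color classes) of height at most $h$. A cotree is clean if its internal nodes have at least two children and the labels U, J alternate along branches. A bicotree is clean if, for every internal node $u$: when $u$ has label U (resp. B), the leaf sets of the subtrees rooted at the children of $u$ are the connected components of the graph modeled by the subtree at $u$ (resp. of the bipartite complement of this graph); when $u$ has label O, the subtree rooted at each child of $u$ has leaves of both colors. A split of size $n$ of a graph $G$ is a map $\gamma:V(G)\to[n]$ such that all $G[\gamma^{-1}(i)]$ are cographs and all semi-induced bipartite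 graphs $G[\gamma^{-1}(i),\gamma^{-1}(j)]$ ($i<j$) are sobs; it has height $h$ if they all have height at most $h$. Given a finite set $V$ with a partition into (possibly empty) parts $V_1,\dots,V_n$, cotrees $\mathbf T_i$ with ground $V_i$, and bicotrees $\mathbf T_{i,j}$ ($i<j$) with ground $V_i\cup V_j$ and color classes $V_i,V_j$, the amalgam of these is the structure obtained from the disjoint union of $V$ and of all these trees (encoded by their roots, their edges $E$, the relation $\vartriangleleft$, and unary predicates for labels and colors) by joining by an $E$-edge every $v\in V$ to each copy of $v$ among the leaves of the trees, and marking $V$ by a predicate $\mathrm{ground}$ and each $V_i$ by a predicate $L_i$. Its height is the maximum height of its trees, and it is clean if all its trees are clean. For $X\subseteq V$, $\mathbf M\langle X\rangle$ is the amalgam with ground $X$ of the trees $\mathbf T_i\langle X\cap V_i\rangle$ and $\mathbf T_{i,j}\langle X\cap (V_i\cup V_j)\rangle$, where $\mathbf T\langle Y\rangle$ is induced by $Y$ and its ancestors. For integers $n,H$, let $\mathsf{SBuild}_{n,H}$ be the first-order interpretation of graphs whose vertex set is the ground, in which distinct $x,y$ are adjacent iff they have neighbors $x',y'$ outside of the ground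 in a common tree of the amalgam and adjacent in the graph that this tree models (using J-nodes if $x,y$ are in the same part, B- and O-nodes otherwise; the tree-order is recovered from simple paths with at most $H$ vertices starting at a root and avoiding the ground). Transductions are compositions of copyings, colorings by unary predicates, and first-order interpretations. A structure $\mathbf M$ is a model of $G$ if $\mathsf{SBuild}_{n,H}(\mathbf M)=G$. Given a transduction $\mathsf T$, it is accessible if $\mathbf M\in\mathsf T(G)$ and each vertex of $G$ is one of its own clones in $\mathbf M$. **Theorem.** For all integers $n,H\ge 0$ there is a transduction $\mathsf{Sparse}_{n,H}$ from graphs to structures in the signature of amalgams such that the following holds for every class $\mathscr C$ of graphs for which (a) there is an integer $h$ with $3h\le H$ such that every graph in $\mathscr C$ has a split of size $n$ and height $h$, or (b) every graph in $\mathscr C$ has a split of size $n$ all of whose cographs and sobs have clean models of height at most $H$. 1. The pair $(\mathsf{SBuild}_{n,H},\mathsf{Sparse}_{n,H})$ is a modelization of $\mathscr C$ in amalgams of height at most $H$: $\mathsf{SBuild}_{n,H}$ interprets a graph whose vertex set is the ground in every structure; every $G\in\mathscr C$ has an accessible model; and all structures in $\mathsf{Sparse}_{n,H}(G)$ (for $G\in\mathscr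 C$) that model $G$ are amalgams of height at most $H$. 2. Every clean amalgam of height at most $H$ that is a model of a graph $G\in\mathscr C$ is an accessible model of $G$. 3. $(\mathbf M,X)\mapsto \mathbf M\langle X\rangle$ is a model restriction: for every amalgam $\mathbf M$ of height at most $H$ that is a model of a graph in $\mathscr C$ and every subset $X$ of its ground, $\mathbf M\langle X\rangle$ is an induced substructure of $\mathbf M$, and $\mathsf{SBuild}_{n,H}(\mathbf M\langle X\rangle)=\mathsf{SBuild}_{n,H}(\mathbf M)[X]$. -/

import Mathlib

open FirstOrder FirstOrder.Language

/-! ### Finite structures, interpretations, transductions -/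

/-- A finite structure over the signature `L`. -/
structure FinStr (L : FirstOrder.Language.{0, 0}) where
  carrier : Type
  [fin : Finite carrier]
  [str : L.Structure carrier]

instance (L : FirstOrder.Language.{0, 0}) : CoeSort (FinStr L) Type := ⟨FinStr.carrier⟩

attribute [instance] FinStr.fin FinStr.str

/-- A finite simple undirected loopless graph. -/
structure FinGraph where
  V : Type
  [fin : Finite V]
  graph : SimpleGraph V

attribute [instance] FinGraph.fin

/-- A finite graph as a finite structure over the signature of graphs. -/
def FinGraph.str (G : FinGraph) : FinStr FirstOrder.Language.graph :=
  @FinStr.mk FirstOrder.Language.graph G.V G.fin G.graph.structure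

/-- A simple interpretation of `L'`-structures in `L`-structures: a formula for the domain and a
formula for each relation symbol of `L'`. -/
structure Interpretation (L L' : FirstOrder.Language.{0, 0}) where
  dom : L.Formula (Fin 1)
  rel : ∀ {k : ℕ}, L'.Relations k → L.Formula (Fin k)

/-- The elements of `M` that belong to the domain of the interpreted structure. -/
def Interpretation.domain {L L' : FirstOrder.Language.{0, 0}} (I : Interpretation L L') (M : FinStr L) :
    Set M := {a | I.dom.Realize fun _ => a}

/-- The structure interpreted in `M`. -/
def Interpretation.apply {L L' : FirstOrder.Language.{0, 0}} [L'.IsRelational] (I : Interpretation L L')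
    (M : FinStr L) : FinStr L' where
  carrier := I.domain M
  str :=
    { funMap := fun f => isEmptyElim f
      RelMap := fun R x => (I.rel R).Realize fun i => ((x i : I.domain M) : M) }

/-- The signature with just one `k`-ary relation symbol. -/
def oneRelLang (k : ℕ) : FirstOrder.Language.{0, 0} := ⟨fun _ => Empty, fun m => PLift (m = k)⟩

/-- The disjoint union of `k` copies of `M`, expanded by the binary relation that links every
element with its clones. -/
def FinStr.copies {L : FirstOrder.Language.{0, 0}} [L.IsRelational] (M : FinStr L) (k : ℕ) :
    FinStr (L.sum (oneRelLang 2)) where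
  carrier := M × Fin k
  str :=
    { funMap := fun f => f.elim (fun g => isEmptyElim g) (fun g => g.elim)
      RelMap := fun R x => R.elim
        (fun S => (∀ i j, (x i).2 = (x j).2) ∧ Structure.RelMap S fun i => (x i).1)
        (fun _ => ∀ i j, (x i).1 = (x j).1 ∧ (i ≠ j → (x i).2 ≠ (x j).2)) }

/-- The expansion of `M` by a new unary predicate, interpreted as `U`. -/
def FinStr.expand {L : FirstOrder.Language.{0, 0}} [L.IsRelational] (M : FinStr L) (U : Set M) :
    FinStr (L.sum (oneRelLang 1)) where
  carrier := M
  str :=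
    { funMap := fun f => f.elim (fun g => isEmptyElim g) (fun g => g.elim)
      RelMap := fun R x => R.elim (fun S => Structure.RelMap S x) (fun _ => ∀ i, x i ∈ U) }

/-- Transductions: compositions of copying, coloring and interpreting. -/
inductive Transduction : FirstOrder.Language.{0, 0} → FirstOrder.Language.{0, 0} → Type 1
  | copying (L : FirstOrder.Language.{0, 0}) [L.IsRelational] (k : ℕ) :
      Transduction L (L.sum (oneRelLang 2))
  | coloring (L : FirstOrder.Language.{0, 0}) [L.IsRelational] :
      Transduction L (L.sum (oneRelLang 1))
  | interpreting {L L' : FirstOrder.Language.{0, 0}} [L'.IsRelational] [Finite (Σ k, L'.Relations k)]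
      (I : Interpretation L L') : Transduction L L'
  | comp {L L' L'' : FirstOrder.Language.{0, 0}} (S : Transduction L' L'') (T : Transduction L L') :
      Transduction L L''

/-- `T.Out M N o` : up to isomorphism, `N` is one of the structures in `T(M)`, and `o` maps each
element of `N` to the element of `M` of which it is a clone. -/
def Transduction.Out : {L L' : FirstOrder.Language.{0, 0}} → Transduction L L' →
    (M : FinStr L) → (N : FinStr L') → (N → M) → Prop
  | _, _, @Transduction.copying L _ k, M, N, o =>
      ∃ e : N ≃[L.sum (oneRelLang 2)] M.copies k, ∀ a, o a = (e a : M × Fin k).1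
  | _, _, @Transduction.coloring L _, M, N, o =>
      ∃ (U : Set M) (e : N ≃[L.sum (oneRelLang 1)] M.expand U), ∀ a, o a = e a
  | _, _, @Transduction.interpreting _ L' _ _ I, M, N, o =>
      ∃ e : N ≃[L'] I.apply M, ∀ a, o a = (e a : I.domain M).1
  | _, _, @Transduction.comp _ L' _ S T, M, N, o =>
      ∃ (P : FinStr L') (f : P → M) (g : N → P), T.Out M P f ∧ S.Out P N g ∧ o = f ∘ g

/-! ### Modelizations -/

/-- `M` is a model of the graph `G` : the graph interpreted in `M` is `G`. An element of this type
identifies the vertices of `G` with elements of `M`. -/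
abbrev ModelIso {L : FirstOrder.Language.{0, 0}} (I : Interpretation L FirstOrder.Language.graph) (G : FinGraph)
    (M : FinStr L) : Type := G.str ≃[FirstOrder.Language.graph] I.apply M

/-- A model `M` of `G` is accessible if it is one of the outputs of `T` on `G`, in such a way that
each vertex of `G` is identified with one of its own clones. -/
def Accessible {L : FirstOrder.Language.{0, 0}} (T : Transduction FirstOrder.Language.graph L)
    {I : Interpretation L FirstOrder.Language.graph} {G : FinGraph} {M : FinStr L}
    (e : ModelIso I G M) : Prop :=
  ∃ o : M → G.str, T.Out G.str M o ∧ ∀ v, o (e v : I.domain M).1 = v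

/-- `(I, T)` is a modelization of the class `C` in structures of the class `D`; the unary symbol
`gr` is the ground predicate. -/
structure IsModelizationIn {L : FirstOrder.Language.{0, 0}} (C : Set FinGraph) (D : Set (FinStr L))
    (gr : L.Relations 1) (I : Interpretation L FirstOrder.Language.graph)
    (T : Transduction FirstOrder.Language.graph L) : Prop where
  graph : ∀ M : FinStr L, (I.apply M) ⊨ Theory.simpleGraph
  ground : ∀ (M : FinStr L), I.domain M = {a | Structure.RelMap gr ![a]}
  exists_accessible : ∀ G ∈ C, ∃ (M : FinStr L) (e : ModelIso I G M), Accessible T e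
  /-- All models of graphs in `C` that are obtained by `T` belong to `D`. -/
  mem : ∀ G ∈ C, ∀ (M : FinStr L) (o : M → G.str), T.Out G.str M o → ModelIso I G M → M ∈ D

/-- Let `ι` embed `N` as an induced substructure of `M`, and let `X` be a subset of the ground of
`M`. The substructure is a model restriction of `M` to `X` if the graph that it models is the
subgraph induced by `X` of the graph modeled by `M`. -/
def IsModelRestriction {L : FirstOrder.Language.{0, 0}} (I : Interpretation L FirstOrder.Language.graph)
    {M N : FinStr L} (X : Set M) (ι : N ↪[L] M) : Prop :=
  ι '' I.domain N = X ∩ I.domain M ∧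
    ∀ a ∈ I.domain N, ∀ b ∈ I.domain N,
      ((I.rel adj).Realize ![a, b] ↔ (I.rel adj).Realize ![ι a, ι b])

/-! ### Semi-plane trees, cotrees and bicotrees -/

/-- Types of the internal nodes: disjoint union, join, bijoin, ordered bijoin. -/
inductive NodeLabel
  | U | J | B | O

/-- The adjacency rule of the internal nodes. -/
def NodeLabel.kappa : NodeLabel → Fin 2 → Fin 2 → Prop
  | .U, _, _ => False
  | .J, _, _ => True
  | .B, i, j => i ≠ j
  | .O, i, j => i < j

/-- A semi-plane rooted tree whose leaves are identified with the elements of `S` (its ground),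
with internal nodes labeled by types and leaves colored by two colors. The tree is given by its
tree-order, with the root as its minimum. The empty tree (with empty ground) is allowed. -/
structure TModel (S : Type) where
  Node : Type
  finite : Finite Node
  order : PartialOrder Node
  /-- every downset is a chain -/
  chain : ∀ x y z : Node, x ≤ z → y ≤ z → x ≤ y ∨ y ≤ x
  /-- there is only one root -/
  connected : ∀ x y : Node, ∃ m, m ≤ x ∧ m ≤ y
  /-- the nodes whose children are ordered -/
  C : Set Node
  C_internal : ∀ x ∈ C, ¬ IsMax x
  /-- the strict order on the children of the nodes in `C` -/
  tri : Node → Node → Prop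
  tri_irrefl : ∀ x, ¬ tri x x
  tri_trans : ∀ x y z, tri x y → tri y z → tri x z
  tri_comparable : ∀ x y, x ≠ y → ((tri x y ∨ tri y x) ↔ ∃ p ∈ C, p ⋖ x ∧ p ⋖ y)
  leaf : S → Node
  leaf_injective : Function.Injective leaf
  leaf_range : Set.range leaf = {x | IsMax x}
  /-- only relevant at internal nodes -/
  label : Node → NodeLabel
  color : S → Fin 2

namespace TModel

attribute [instance] TModel.finite TModel.order

variable {S : Type} (T : TModel S)

/-- The height (number of nodes on a longest path from the root to a leaf) is at most `h`. -/
def HeightLE (h : ℕ) : Prop := ∀ x : T.Node, (Set.Iic x).ncard ≤ h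

/-- The infimum `m` of the leaves `s` and `t` witnesses the adjacency of `s` and `t`, where `s` is
before `t` in case the children of `m` are ordered. -/
def Joins (s t : S) : Prop :=
  ∃ m, IsGLB {T.leaf s, T.leaf t} m ∧
    (m ∈ T.C → ∃ a b, m ⋖ a ∧ a ≤ T.leaf s ∧ m ⋖ b ∧ b ≤ T.leaf t ∧ T.tri a b) ∧
    (T.label m).kappa (T.color s) (T.color t)

/-- The graph modeled by `T`. -/
def graph : SimpleGraph S where
  Adj s t := s ≠ t ∧ (T.Joins s t ∨ T.Joins t s)
  symm := ⟨fun _ _ h => ⟨h.1.symm, h.2.symm⟩⟩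
  loopless := ⟨fun _ h => h.1 rfl⟩

/-- Cotrees: no ordered nodes, one color, internal nodes labeled U or J. -/
def IsCotree : Prop :=
  T.C = ∅ ∧ (∀ s, T.color s = 0) ∧
    ∀ u : T.Node, ¬ IsMax u → T.label u = .U ∨ T.label u = .J

/-- Bicotrees: internal nodes labeled U, B (unordered children) or O (ordered children). -/
def IsBicotree : Prop :=
  ∀ u : T.Node, ¬ IsMax u →
    (u ∉ T.C ∧ T.label u = .U) ∨ (u ∉ T.C ∧ T.label u = .B) ∨ (u ∈ T.C ∧ T.label u = .O)

/-- A cotree is clean if each internal node has at least two children and the types alternate. -/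
def CleanCotree : Prop :=
  (∀ u : T.Node, ¬ IsMax u → ∃ a b, a ≠ b ∧ u ⋖ a ∧ u ⋖ b) ∧
    ∀ u v : T.Node, u ⋖ v → ¬ IsMax v → T.label u ≠ T.label v

/-- The set of (elements of the ground corresponding to) leaves in the subtree rooted at `u`. -/
def leaves (u : T.Node) : Set S := {s | u ≤ T.leaf s}

/-- The bipartite complement of the modeled graph, for the two color classes. -/
def bipCompl : SimpleGraph S where
  Adj s t := T.color s ≠ T.color t ∧ ¬ T.graph.Adj s t
  symm := ⟨fun _ _ h => ⟨h.1.symm, fun h' => h.2 h'.symm⟩⟩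
  loopless := ⟨fun _ h => h.1 rfl⟩

/-- The sets of leaves of the subtrees rooted at the children of `u` are the (vertex sets of the)
connected components of the subgraph of `H` induced by the leaves of the subtree rooted at `u`. -/
def ChildrenAreComponents (H : SimpleGraph S) (u : T.Node) : Prop :=
  ∀ s t : T.leaves u,
    (H.induce (T.leaves u)).Reachable s t ↔ ∃ v, u ⋖ v ∧ v ≤ T.leaf s ∧ v ≤ T.leaf t

/-- Clean bicotrees. -/
def CleanBicotree : Prop :=
  ∀ u : T.Node, ¬ IsMax u →
    (T.label u = .U → T.ChildrenAreComponents T.graph u) ∧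
    (T.label u = .B → T.ChildrenAreComponents T.bipCompl u) ∧
    (T.label u = .O → ∀ v, u ⋖ v → ∀ c, ∃ s ∈ T.leaves v, T.color s = c)

/-- The nodes of the submodel generated by (the range of) `f`. -/
def Below {S' : Type} (f : S' ↪ S) : Type := {x : T.Node // ∃ s, x ≤ T.leaf (f s)}

instance {S' : Type} (f : S' ↪ S) : PartialOrder (T.Below f) :=
  inferInstanceAs (PartialOrder {x : T.Node // ∃ s, x ≤ T.leaf (f s)})

theorem below_covBy {S' : Type} (f : S' ↪ S) (x y : T.Below f) : x ⋖ y ↔ x.1 ⋖ y.1 := by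
  constructor
  · intro h
    refine ⟨h.1, fun c hc hcy => ?_⟩
    obtain ⟨s, hs⟩ := y.2
    exact h.2 (c := ⟨c, s, hcy.le.trans hs⟩) hc hcy
  · intro h
    exact ⟨h.1, fun c hc hcy => h.2 (c := c.1) hc hcy⟩

theorem isMax_leaf (s : S) : IsMax (T.leaf s) := by
  have : T.leaf s ∈ {x | IsMax x} := T.leaf_range ▸ Set.mem_range_self s
  exact this

/-- The submodel of `T` generated by a subset of the ground, given by an embedding `f` : the
induced substructure on the downset generated by this set. -/
def restrict {S' : Type} (f : S' ↪ S) : TModel S' where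
  Node := T.Below f
  finite := inferInstanceAs (Finite {x : T.Node // ∃ s, x ≤ T.leaf (f s)})
  order := inferInstance
  chain x y z h h' := T.chain x.1 y.1 z.1 h h'
  connected x y := by
    obtain ⟨m, hx, hy⟩ := T.connected x.1 y.1
    obtain ⟨s, hs⟩ := x.2
    exact ⟨⟨m, s, hx.trans hs⟩, hx, hy⟩
  C := {x | x.1 ∈ T.C}
  C_internal x hx h := by
    obtain ⟨s, hs⟩ := x.2
    have h1 : T.leaf (f s) ≤ x.1 := h (b := ⟨T.leaf (f s), s, le_rfl⟩) hs
    have h2 : x.1 = T.leaf (f s) := le_antisymm hs h1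
    exact T.C_internal x.1 hx (h2 ▸ T.isMax_leaf (f s))
  tri x y := T.tri x.1 y.1
  tri_irrefl x := T.tri_irrefl x.1
  tri_trans x y z := T.tri_trans x.1 y.1 z.1
  tri_comparable x y hxy := by
    rw [T.tri_comparable x.1 y.1 (fun h => hxy (Subtype.ext h))]
    constructor
    · rintro ⟨p, hp, h1, h2⟩
      obtain ⟨s, hs⟩ := x.2
      refine ⟨⟨p, s, h1.le.trans hs⟩, hp, ?_, ?_⟩
      · exact (T.below_covBy f _ _).2 h1
      · exact (T.below_covBy f _ _).2 h2
    · rintro ⟨p, hp, h1, h2⟩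
      exact ⟨p.1, hp, (T.below_covBy f _ _).1 h1, (T.below_covBy f _ _).1 h2⟩
  leaf s := ⟨T.leaf (f s), s, le_rfl⟩
  leaf_injective s t h := f.injective (T.leaf_injective (congrArg Subtype.val h))
  leaf_range := by
    ext x
    constructor
    · rintro ⟨s, rfl⟩ y hy
      exact T.isMax_leaf (f s) hy
    · intro hx
      obtain ⟨s, hs⟩ := x.2
      refine ⟨s, ?_⟩
      have h1 : T.leaf (f s) ≤ x.1 := hx (b := ⟨T.leaf (f s), s, le_rfl⟩) hs
      exact Subtype.ext (le_antisymm h1 hs)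
  label x := T.label x.1
  color s := T.color (f s)

theorem restrict_internal {S' : Type} (f : S' ↪ S) (u : (T.restrict f).Node)
    (hu : ¬ IsMax u) : ¬ IsMax u.1 := by
  intro h
  exact hu fun y hy => h hy

theorem IsCotree.restrict {S' : Type} {T : TModel S} (hT : T.IsCotree) (f : S' ↪ S) :
    (T.restrict f).IsCotree :=
  ⟨by
    ext x
    change x.1 ∈ T.C ↔ False
    rw [hT.1]
    exact Iff.rfl, fun s => hT.2.1 (f s),
    fun u hu => hT.2.2 u.1 (T.restrict_internal f u hu)⟩

theorem IsBicotree.restrict {S' : Type} {T : TModel S} (hT : T.IsBicotree) (f : S' ↪ S) :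
    (T.restrict f).IsBicotree :=
  fun u hu => hT u.1 (T.restrict_internal f u hu)

end TModel

/-! ### Splits -/

/-- Indices of the pieces: one for each part, one for each pair of parts. -/
abbrev PieceIdx (n : ℕ) : Type := Fin n ⊕ {p : Fin n × Fin n // p.1 < p.2}

/-- The parts on which a piece lives. -/
def PieceIdx.Has {n : ℕ} : PieceIdx n → Fin n → Prop
  | .inl i, c => c = i
  | .inr p, c => c = p.1.1 ∨ c = p.1.2

/-- The ground of a piece. -/
def pieceGround {n : ℕ} {V : Type} (part : V → Fin n) (a : PieceIdx n) : Set V :=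
  {v | a.Has (part v)}

/-- The pieces are cotrees for single parts, and bicotrees colored according to the two parts
for pairs of parts. -/
def IsPiece {n : ℕ} {V : Type} (part : V → Fin n) :
    (a : PieceIdx n) → TModel (pieceGround part a) → Prop
  | .inl _, T => T.IsCotree
  | .inr p, T => T.IsBicotree ∧ ∀ v : pieceGround part (.inr p), T.color v = 0 ↔ part v = p.1.1

/-- Cleanness of pieces. -/
def IsCleanPiece {n : ℕ} {V : Type} (part : V → Fin n) :
    (a : PieceIdx n) → TModel (pieceGround part a) → Prop
  | .inl _, T => T.CleanCotree
  | .inr _, T => T.CleanBicotree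

/-- The graphs to be modeled by the pieces: the subgraph of `G` induced by a part, respectively
the bipartite subgraph semi-induced by two parts. -/
def pieceGraph {n : ℕ} {V : Type} (G : SimpleGraph V) (part : V → Fin n) :
    (a : PieceIdx n) → SimpleGraph (pieceGround part a)
  | .inl i => G.induce (pieceGround part (.inl i))
  | .inr _ =>
    { Adj := fun v w => G.Adj v.1 w.1 ∧ part v.1 ≠ part w.1
      symm := ⟨fun _ _ h => ⟨h.1.symm, h.2.symm⟩⟩
      loopless := ⟨fun _ h => h.2 rfl⟩ }

/-- `G` has a split of size `n` and height `h`. -/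
def HasSplit {V : Type} (G : SimpleGraph V) (n h : ℕ) : Prop :=
  ∃ part : V → Fin n, ∀ a, ∃ T : TModel (pieceGround part a),
    IsPiece part a T ∧ T.HeightLE h ∧ T.graph = pieceGraph G part a

/-- `G` has a split of size `n` all of whose cographs and sobs have clean models of height at
most `h`. -/
def HasCleanSplit {V : Type} (G : SimpleGraph V) (n h : ℕ) : Prop :=
  ∃ part : V → Fin n, ∀ a, ∃ T : TModel (pieceGround part a),
    IsPiece part a T ∧ IsCleanPiece part a T ∧ T.HeightLE h ∧ T.graph = pieceGraph G part a

/-! ### Amalgams -/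

/-- The relation symbols of amalgams. -/
inductive AmalgRel (n : ℕ) : ℕ → Type
  | edge : AmalgRel n 2
  | tri : AmalgRel n 2
  | root : AmalgRel n 1
  | ground : AmalgRel n 1
  | part (i : Fin n) : AmalgRel n 1
  | color (c : Fin 2) : AmalgRel n 1
  | label (l : NodeLabel) : AmalgRel n 1

/-- The signature of amalgams. -/
def amalgLang (n : ℕ) : FirstOrder.Language.{0, 0} := ⟨fun _ => Empty, AmalgRel n⟩

instance (n : ℕ) : (amalgLang n).IsRelational := fun _ => inferInstanceAs (IsEmpty Empty)

/-- A set `V` partitioned into `n` parts, with a cotree on each part and a bicotree on each pair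
of parts. -/
structure Amalgam (n : ℕ) (V : Type) where
  part : V → Fin n
  tree : (a : PieceIdx n) → TModel (pieceGround part a)
  isPiece : ∀ a, IsPiece part a (tree a)

namespace Amalgam

variable {n : ℕ} {V : Type} (D : Amalgam n V)

/-- The disjoint union of the ground and all trees. -/
abbrev Carrier : Type := V ⊕ Σ a, (D.tree a).Node

/-- Tree edges (from parent to child), and edges from the ground to the corresponding leaves. -/
inductive Link : D.Carrier → D.Carrier → Prop
  | tree (a : PieceIdx n) (x y : (D.tree a).Node) (h : x ⋖ y) : Link (.inr ⟨a, x⟩) (.inr ⟨a, y⟩)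
  | leaf (a : PieceIdx n) (v : pieceGround D.part a) :
      Link (.inl v.1) (.inr ⟨a, (D.tree a).leaf v⟩)

inductive Tri : D.Carrier → D.Carrier → Prop
  | mk (a : PieceIdx n) (x y : (D.tree a).Node) (h : (D.tree a).tri x y) :
      Tri (.inr ⟨a, x⟩) (.inr ⟨a, y⟩)

inductive Root : D.Carrier → Prop
  | mk (a : PieceIdx n) (x : (D.tree a).Node) (h : IsBot x) : Root (.inr ⟨a, x⟩)

inductive Color (c : Fin 2) : D.Carrier → Prop
  | mk (a : PieceIdx n) (v : pieceGround D.part a) (h : (D.tree a).color v = c) :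
      Color c (.inr ⟨a, (D.tree a).leaf v⟩)

inductive Label (l : NodeLabel) : D.Carrier → Prop
  | mk (a : PieceIdx n) (x : (D.tree a).Node) (hx : ¬ IsMax x) (h : (D.tree a).label x = l) :
      Label l (.inr ⟨a, x⟩)

/-- The amalgam as a structure. -/
def str [Finite V] : FinStr (amalgLang n) where
  carrier := D.Carrier
  str :=
    { funMap := fun f => f.elim
      RelMap := fun R => match R with
        | .edge => fun x => D.Link (x 0) (x 1) ∨ D.Link (x 1) (x 0)
        | .tri => fun x => D.Tri (x 0) (x 1)
        | .root => fun x => D.Root (x 0)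
        | .ground => fun x => ∃ v, x 0 = .inl v
        | .part i => fun x => ∃ v, x 0 = .inl v ∧ D.part v = i
        | .color c => fun x => D.Color c (x 0)
        | .label l => fun x => D.Label l (x 0) }

/-- The height of the amalgam is at most `h`. -/
def HeightLE (h : ℕ) : Prop := ∀ a, (D.tree a).HeightLE h

/-- All trees of the amalgam are clean. -/
def Clean : Prop := ∀ a, IsCleanPiece D.part a (D.tree a)

/-- The inclusion of the grounds of pieces, for a subset `X` of `V`. -/
def groundIncl (X : Set V) (a : PieceIdx n) :
    pieceGround (fun v : X => D.part v) a ↪ pieceGround D.part a where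
  toFun v := ⟨v.1.1, v.2⟩
  inj' _ _ h := Subtype.ext (Subtype.ext (congrArg (fun z => z.1) h))

/-- The amalgam generated by a subset `X` of the ground. -/
def restrict (X : Set V) : Amalgam n X where
  part v := D.part v
  tree a := (D.tree a).restrict (D.groundIncl X a)
  isPiece a := by
    cases a with
    | inl i => exact (D.isPiece (.inl i)).restrict _
    | inr p => exact ⟨(D.isPiece (.inr p)).1.restrict _, fun v => (D.isPiece (.inr p)).2 ⟨v.1.1, v.2⟩⟩

/-- The canonical map from the amalgam generated by a subset of the ground to the amalgam. -/
def restrictIncl (X : Set V) : (D.restrict X).Carrier → D.Carrier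
  | .inl v => .inl v.1
  | .inr ⟨a, x⟩ => .inr ⟨a, x.1⟩

end Amalgam

/-- The class of amalgams (of cotrees and bicotrees) of height at most `h`, up to isomorphism. -/
def amalgamsOfHeightLE (n h : ℕ) : Set (FinStr (amalgLang n)) :=
  {M | ∃ (V : Type) (_ : Finite V) (D : Amalgam n V),
    D.HeightLE h ∧ Nonempty (M ≃[amalgLang n] D.str)}

/-! ### The interpretation of graphs in amalgams -/

namespace SBuildFormula

variable {n : ℕ} {α : Type}

/-- `a = b` -/
def eq (a b : α) : (amalgLang n).Formula α := Term.equal (Term.var a) (Term.var b)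

/-- `R(a)` -/
def un (R : AmalgRel n 1) (a : α) : (amalgLang n).Formula α :=
  Relations.formula₁ (L := amalgLang n) R (Term.var a)

/-- `R(a, b)` -/
def bin (R : AmalgRel n 2) (a b : α) : (amalgLang n).Formula α :=
  Relations.formula₂ (L := amalgLang n) R (Term.var a) (Term.var b)

/-- Outside of the ground, there is a simple path with `k + 1` vertices from a root to `b`, and
`a` is on this path. -/
noncomputable def onRootPath (k : ℕ) (a b : α) : (amalgLang n).Formula α :=
  Formula.iExs (Fin (k + 1)) <|
    un .root (Sum.inr 0) ⊓ eq (Sum.inr (Fin.last k)) (Sum.inl b) ⊓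
    Formula.iInf (fun i : Fin (k + 1) => ∼(un .ground (Sum.inr i))) ⊓
    Formula.iInf (fun i : Fin k => bin .edge (Sum.inr i.castSucc) (Sum.inr i.succ)) ⊓
    Formula.iInf (fun p : {p : Fin (k + 1) × Fin (k + 1) // p.1 < p.2} =>
      ∼(eq (Sum.inr p.1.1) (Sum.inr p.1.2))) ⊓
    Formula.iSup (fun i : Fin (k + 1) => eq (Sum.inl a) (Sum.inr i))

/-- `a ≼ b` for the tree-order, recovered from the root, the edges and the bound `h` on the
height. -/
noncomputable def treeLE (h : ℕ) (a b : α) : (amalgLang n).Formula α :=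
  Formula.iSup fun k : Fin h => onRootPath k a b

/-- `m` is the infimum of `a` and `b` (which are then in the same connected component outside of
the ground). -/
noncomputable def isInf (h : ℕ) (m a b : α) : (amalgLang n).Formula α :=
  treeLE h m a ⊓ treeLE h m b ⊓
  Formula.iAlls (Fin 1) ((treeLE h (Sum.inr 0) (Sum.inl a) ⊓ treeLE h (Sum.inr 0) (Sum.inl b)).imp
    (treeLE h (Sum.inr 0) (Sum.inl m)))

/-- The infimum of the leaves `a` and `b` is a J-node. -/
noncomputable def cotreeAdj (h : ℕ) (a b : α) : (amalgLang n).Formula α :=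
  Formula.iExs (Fin 1) (isInf h (Sum.inr 0) (Sum.inl a) (Sum.inl b) ⊓ un (.label .J) (Sum.inr 0))

/-- The infimum of the leaves `a` and `b` is a B-node and they have distinct colors, or it is an
O-node, `a` has the first color, `b` has the second color and `a` is before `b`. -/
noncomputable def bicotreeAdj (h : ℕ) (a b : α) : (amalgLang n).Formula α :=
  un (.color 0) a ⊓ un (.color 1) b ⊓
  Formula.iExs (Fin 3) (isInf h (Sum.inr 0) (Sum.inl a) (Sum.inl b) ⊓
    (un (.label .B) (Sum.inr 0) ⊔
      (un (.label .O) (Sum.inr 0) ⊓ treeLE h (Sum.inr 1) (Sum.inl a) ⊓ treeLE h (Sum.inr 2) (Sum.inl b) ⊓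
        bin .tri (Sum.inr 1) (Sum.inr 2))))

/-- `x` and `y` are in the same part. -/
noncomputable def samePart (x y : α) : (amalgLang n).Formula α :=
  Formula.iSup fun i : Fin n => un (.part i) x ⊓ un (.part i) y

/-- The vertices `x` and `y` have neighbors outside of the ground that are adjacent in the graph
modeled by a common tree: by a cotree if `x` and `y` are in the same part, and by a bicotree
otherwise. -/
noncomputable def sbuildAdj (h : ℕ) (x y : α) : (amalgLang n).Formula α :=
  ∼(eq x y) ⊓
  Formula.iExs (Fin 2) (
    bin .edge (Sum.inl x) (Sum.inr 0) ⊓ bin .edge (Sum.inl y) (Sum.inr 1) ⊓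
    ∼(un .ground (Sum.inr 0)) ⊓ ∼(un .ground (Sum.inr 1)) ⊓
    ((samePart (Sum.inl x) (Sum.inl y) ⊓ (cotreeAdj h (Sum.inr 0) (Sum.inr 1) ⊔ cotreeAdj h (Sum.inr 1) (Sum.inr 0))) ⊔
     (∼(samePart (Sum.inl x) (Sum.inl y)) ⊓
      (bicotreeAdj h (Sum.inr 0) (Sum.inr 1) ⊔ bicotreeAdj h (Sum.inr 1) (Sum.inr 0)))))

end SBuildFormula

/-- The interpretation of graphs in amalgams of height at most `h`; vertices are the elements of
the ground. -/
noncomputable def SBuild (n h : ℕ) : Interpretation (amalgLang n) FirstOrder.Language.graph where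
  dom := SBuildFormula.un .ground 0
  rel := fun R => match R with
    | .adj => SBuildFormula.sbuildAdj h 0 1

/-! Decoding. In an amalgam of height at most `H`, a simple path that starts at a root and avoids
the ground stays in one tree and moves away from the root. Paths of bounded length therefore define
the tree-orders, hence the infima, and `SBuild n H` yields the union of the graphs modeled by the
trees (`Amalgam.realize_sbuildAdj`). A generated submodel is a downset in each tree, so infima,
covers and labels are the same as before; this gives model restrictions
(`Amalgam.isModelRestriction`).

Encoding. A node of a clean amalgam is coded by its tree, its depth and a chosen leaf above it. So
nodes are clones of vertices in a bounded number of copies, and everything reduces to defining, in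
the graph with finitely many marks on its vertices, when two leaves of a tree have a common ancestor
at depth `d` (`Amalgam.common_iff`). This goes by induction on `d`: the leaves above a node `u` are
known, a mark gives the label of `u`, and one has to define which leaves lie above the same child of
`u`.

At a U- or B-node of a clean bicotree, the children correspond to the components of the graph or of
its bipartite complement. Such a component has diameter at most 5 (`TModel.reach_of_cutConn`): at
the first branching node its vertex set splits in two so that the colors alone decide adjacency
across, and a connected graph with such a split has short paths (`reach_of_join`,
`reach_of_halfJoin`). Cotrees are handled likewise (`TModel.sameChild_iff_reach_of_isCotree`), with
alternation of labels as the reason. At an O-node the children are arranged like the classes of a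
half graph, each with both colors, and marking the positions of the children modulo 3 suffices to
define the classes (`sameMark_iff`).

Arbitrary colorings may produce nonsense. With the tree-order as a basic relation, being an amalgam
of height at most `H` is expressed by a first-order sentence; the last interpretation tests it and
outputs the empty amalgam if it fails (`exists_unflatten`). The resulting transduction depends only
on `n` and `H` (`exists_sparse`).

Existence of clean models. Trees of bounded height are rebuilt from the root. For cotrees the height
does not grow (`hasCleanCotree_of_within`). For bicotrees the height at most triples
(`hasCleanBicotree_of_within`): the children of an O-node may have leaves of one color only, so
consecutive children are merged until both colors occur, and the parts of a merged class are put
together by at most two additional levels. -/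

/-! ### Uniformly definable relations -/

/-- The relation `P` is defined by the same first-order formula in all finite structures. -/
class FODef {L : FirstOrder.Language.{0, 0}} {α : Type} (P : ∀ M : FinStr L, (α → M) → Prop) : Prop where
  out : ∃ φ : L.Formula α, ∀ M v, φ.Realize v ↔ P M v

namespace FODef

variable {L : FirstOrder.Language.{0, 0}} {α β : Type}

instance const (p : Prop) : FODef (L := L) (α := α) fun _ _ => p := by
  by_cases hp : p
  · exact ⟨⊤, fun M v => by simp [hp]⟩
  · exact ⟨⊥, fun M v => by simp [hp]⟩

instance eq (i j : α) : FODef (L := L) fun _ v => v i = v j :=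
  ⟨(Term.var i).equal (Term.var j), fun M v => by simp⟩

instance imp {P Q : ∀ M : FinStr L, (α → M) → Prop} [hP : FODef P] [hQ : FODef Q] :
    FODef fun M v => P M v → Q M v := by
  obtain ⟨φ, hφ⟩ := hP
  obtain ⟨ψ, hψ⟩ := hQ
  exact ⟨φ.imp ψ, fun M v => by simp [hφ, hψ]⟩

instance and {P Q : ∀ M : FinStr L, (α → M) → Prop} [hP : FODef P] [hQ : FODef Q] :
    FODef fun M v => P M v ∧ Q M v := by
  obtain ⟨φ, hφ⟩ := hP
  obtain ⟨ψ, hψ⟩ := hQ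
  exact ⟨φ ⊓ ψ, fun M v => by simp [hφ, hψ]⟩

instance or {P Q : ∀ M : FinStr L, (α → M) → Prop} [hP : FODef P] [hQ : FODef Q] :
    FODef fun M v => P M v ∨ Q M v := by
  obtain ⟨φ, hφ⟩ := hP
  obtain ⟨ψ, hψ⟩ := hQ
  exact ⟨φ ⊔ ψ, fun M v => by simp [hφ, hψ]⟩

instance iff {P Q : ∀ M : FinStr L, (α → M) → Prop} [hP : FODef P] [hQ : FODef Q] :
    FODef fun M v => (P M v ↔ Q M v) := by
  obtain ⟨φ, hφ⟩ := hP
  obtain ⟨ψ, hψ⟩ := hQ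
  exact ⟨φ.iff ψ, fun M v => by simp [hφ, hψ]⟩

theorem subst {P : ∀ M : FinStr L, (α → M) → Prop} (hP : FODef P) (g : α → β) :
    FODef fun M (v : β → M) => P M (fun a => v (g a)) := by
  obtain ⟨φ, hφ⟩ := hP
  exact ⟨φ.relabel g, fun M v => by simp [← hφ, Function.comp_def]⟩

instance exs [Finite β] {Q : ∀ M : FinStr L, (α → M) → (β → M) → Prop}
    [hQ : FODef (α := α ⊕ β) fun M w => Q M (fun i => w (.inl i)) (fun j => w (.inr j))] :
    FODef fun M v => ∃ f : β → M, Q M v f := by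
  obtain ⟨φ, hφ⟩ := hQ
  exact ⟨φ.iExs β, fun M v => by simp [hφ]⟩

/-- The bound variable becomes the new variable `none`. In this form instance search can take a
definition apart quantifier by quantifier. -/
instance ex {Q : ∀ M : FinStr L, (α → M) → M → Prop}
    [hQ : FODef (α := Option α) fun M w => Q M (fun i => w (some i)) (w none)] :
    FODef fun M v => ∃ x : M, Q M v x := by
  have : FODef (α := α ⊕ Unit) fun M w => Q M (fun i => w (.inl i)) (w (.inr ())) :=
    hQ.subst (fun o : Option α => o.elim (Sum.inr ()) Sum.inl)
  have h2 : FODef fun M v => ∃ f : Unit → M, Q M v (f ()) := inferInstance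
  obtain ⟨φ, hφ⟩ := h2
  refine ⟨φ, fun M v => (hφ M v).trans ⟨fun ⟨f, h⟩ => ⟨_, h⟩, fun ⟨x, h⟩ => ⟨fun _ => x, h⟩⟩⟩

instance all {Q : ∀ M : FinStr L, (α → M) → M → Prop}
    [hQ : FODef (α := Option α) fun M w => Q M (fun i => w (some i)) (w none)] :
    FODef fun M v => ∀ x : M, Q M v x := by
  obtain ⟨φ, hφ⟩ := FODef.ex (Q := fun M v x => ¬ Q M v x)
  exact ⟨∼φ, fun M v => by simp [hφ]⟩

/-- Quantifiers over a fixed finite index set amount to finite disjunctions, so they do not leave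
first-order logic. -/
instance finEx {I : Type} [Finite I] {Q : I → ∀ M : FinStr L, (α → M) → Prop}
    [hQ : ∀ i, FODef (Q i)] : FODef fun M v => ∃ i : I, Q i M v := by
  choose φ hφ using fun i => (hQ i).out
  exact ⟨Formula.iSup φ, fun M v => by simp [hφ]⟩

instance finAll {I : Type} [Finite I] {Q : I → ∀ M : FinStr L, (α → M) → Prop}
    [hQ : ∀ i, FODef (Q i)] : FODef fun M v => ∀ i : I, Q i M v := by
  choose φ hφ using fun i => (hQ i).out
  exact ⟨Formula.iInf φ, fun M v => by simp [hφ]⟩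

theorem rel {k : ℕ} (R : L.Relations k) (g : Fin k → α) :
    FODef fun (_ : FinStr L) v => Structure.RelMap R fun j => v (g j) :=
  ⟨Relations.formula R (fun j => Term.var (g j)), fun M v => by simp [Formula.realize_rel]⟩

end FODef

/-- Uniformly definable unary relations. -/
class FODef₁ {L : FirstOrder.Language.{0, 0}} (P : ∀ M : FinStr L, M → Prop) : Prop where
  out : FODef (α := Fin 1) fun M v => P M (v 0)

/-- Uniformly definable binary relations. -/
class FODef₂ {L : FirstOrder.Language.{0, 0}} (P : ∀ M : FinStr L, M → M → Prop) : Prop where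
  out : FODef (α := Fin 2) fun M v => P M (v 0) (v 1)

instance FODef₁.const {L : FirstOrder.Language.{0, 0}} (p : Prop) :
    FODef₁ fun (M : FinStr L) (_ : M) => p := ⟨inferInstance⟩

instance FODef.app₁ {L : FirstOrder.Language.{0, 0}} {α : Type} {P : ∀ M : FinStr L, M → Prop}
    [h : FODef₁ P] (i : α) : FODef fun M v => P M (v i) :=
  h.out.subst fun _ => i

instance FODef.app₂ {L : FirstOrder.Language.{0, 0}} {α : Type} {P : ∀ M : FinStr L, M → M → Prop}
    [h : FODef₂ P] (i j : α) : FODef fun M v => P M (v i) (v j) :=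
  h.out.subst ![i, j]

instance FODef₁.rel {L : FirstOrder.Language.{0, 0}} (R : L.Relations 1) :
    FODef₁ fun (_ : FinStr L) x => Structure.RelMap R ![x] := by
  obtain ⟨φ, hφ⟩ := FODef.rel R id
  refine ⟨φ, fun M v => (hφ M v).trans (iff_of_eq (congrArg _ (funext fun i => ?_)))⟩
  fin_cases i; rfl

instance FODef₂.rel {L : FirstOrder.Language.{0, 0}} (R : L.Relations 2) :
    FODef₂ fun (_ : FinStr L) x y => Structure.RelMap R ![x, y] := by
  obtain ⟨φ, hφ⟩ := FODef.rel R id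
  refine ⟨φ, fun M v => (hφ M v).trans (iff_of_eq (congrArg _ (funext fun i => ?_)))⟩
  fin_cases i <;> rfl

/-! ### Structures with unary and binary relations -/

/-- Relation symbols: the elements of `A` are unary, the elements of `B` are binary. -/
inductive BinRel (A B : Type) : ℕ → Type
  | un (a : A) : BinRel A B 1
  | bin (b : B) : BinRel A B 2

/-- The relational signature with unary symbols `A` and binary symbols `B`. -/
def binLang (A B : Type) : FirstOrder.Language.{0, 0} := ⟨fun _ => Empty, BinRel A B⟩

instance (A B : Type) : (binLang A B).IsRelational := fun _ => inferInstanceAs (IsEmpty Empty)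

instance (A B : Type) [Finite A] [Finite B] : Finite (Σ k, (binLang A B).Relations k) :=
  Finite.of_surjective
    (fun s : A ⊕ B => (s.elim (fun a => ⟨1, BinRel.un a⟩) (fun b => ⟨2, BinRel.bin b⟩) :
      Σ k, (binLang A B).Relations k))
    (by rintro ⟨_, (a | b)⟩
        exacts [⟨.inl a, rfl⟩, ⟨.inr b, rfl⟩])

section BinStr

variable {A B : Type}

/-- The structure with given unary and binary relations. -/
def binStr (X : Type) [Finite X] (u : A → X → Prop) (b : B → X → X → Prop) : FinStr (binLang A B) where
  carrier := X
  str :=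
    { funMap := fun f => f.elim
      RelMap := fun R => match R with
        | .un a => fun x => u a (x 0)
        | .bin r => fun x => b r (x 0) (x 1) }

/-- The unary relations of a structure. -/
def FinStr.un (M : FinStr (binLang A B)) (a : A) (x : M) : Prop :=
  Structure.RelMap (L := binLang A B) (n := 1) (BinRel.un a) ![x]

/-- The binary relations of a structure. -/
def FinStr.bin (M : FinStr (binLang A B)) (b : B) (x y : M) : Prop :=
  Structure.RelMap (L := binLang A B) (n := 2) (BinRel.bin b) ![x, y]

instance (a : A) : FODef₁ fun (M : FinStr (binLang A B)) => M.un a :=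
  FODef₁.rel (L := binLang A B) (BinRel.un a)

instance (b : B) : FODef₂ fun (M : FinStr (binLang A B)) => M.bin b :=
  FODef₂.rel (L := binLang A B) (BinRel.bin b)

instance FODef.un {α : Type} (a : A) (i : α) : FODef fun (M : FinStr (binLang A B)) v => M.un a (v i) :=
  FODef.app₁ (P := fun M => M.un a) i

instance FODef.bin {α : Type} (b : B) (i j : α) :
    FODef fun (M : FinStr (binLang A B)) v => M.bin b (v i) (v j) :=
  FODef.app₂ (P := fun M => M.bin b) i j

theorem FinStr.relMap_un (M : FinStr (binLang A B)) (a : A) (x : Fin 1 → M) :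
    Structure.RelMap (L := binLang A B) (n := 1) (BinRel.un a) x ↔ M.un a (x 0) := by
  unfold FinStr.un
  rw [show x = ![x 0] from funext fun i => by fin_cases i; rfl]
  rfl

theorem FinStr.relMap_bin (M : FinStr (binLang A B)) (b : B) (x : Fin 2 → M) :
    Structure.RelMap (L := binLang A B) (n := 2) (BinRel.bin b) x ↔ M.bin b (x 0) (x 1) := by
  unfold FinStr.bin
  rw [show x = ![x 0, x 1] from funext fun i => by fin_cases i <;> rfl]
  rfl

end BinStr

/-! ### Transductions from definable relations -/

/-- Definable relations replace formulas, and the isomorphism in `Transduction.Out` becomes an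
injective map onto the domain. Both directions matter: one produces outputs, the other controls all
outputs. -/
theorem Transduction.exists_interpreting {L L' : FirstOrder.Language.{0, 0}} [L'.IsRelational]
    [Finite (Σ k, L'.Relations k)] (dom : ∀ M : FinStr L, M → Prop) [hd : FODef₁ dom]
    (rel : ∀ k, L'.Relations k → ∀ M : FinStr L, (Fin k → M) → Prop)
    (hr : ∀ k R, FODef (rel k R)) :
    ∃ T : Transduction L L', ∀ (M : FinStr L) (N : FinStr L') (f : N → M),
      T.Out M N f ↔ Function.Injective f ∧ Set.range f = {x | dom M x} ∧
        ∀ k (R : L'.Relations k) (x : Fin k → N),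
          Structure.RelMap R x ↔ rel k R M fun i => f (x i) := by
  obtain ⟨δ, hδ⟩ := hd.out
  choose ρ hρ using fun k R => (hr k R).out
  let I : Interpretation L L' := ⟨δ, fun {k} R => ρ k R⟩
  have hI : ∀ M, I.domain M = {x | dom M x} := fun M => Set.ext fun x => hδ M _
  refine ⟨.interpreting I, fun M N f => ⟨?_, ?_⟩⟩
  · rintro ⟨e, he⟩
    refine ⟨fun x y h => ?_, ?_, fun k R x => ?_⟩
    · apply e.injective
      apply Subtype.ext
      rw [he, he] at h
      exact h
    · rw [← hI]
      ext y
      constructor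
      · rintro ⟨x, rfl⟩
        rw [he]
        exact (e x : I.domain M).2
      · intro hy
        obtain ⟨x, hx⟩ := e.surjective (⟨y, hy⟩ : I.domain M)
        exact ⟨x, by rw [he, hx]⟩
    · rw [← e.map_rel R x]
      refine (hρ k R M _).trans ?_
      simp only [he]
      exact Iff.rfl
  · rintro ⟨h1, h2, h3⟩
    have hf : ∀ x, f x ∈ I.domain M := fun x => by
      rw [hI, ← h2]
      exact ⟨x, rfl⟩
    let e : N ≃ I.domain M := Equiv.ofBijective (fun x => ⟨f x, hf x⟩)
      ⟨fun x y h => h1 (congrArg Subtype.val h), fun y => by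
        obtain ⟨x, hx⟩ : y.1 ∈ Set.range f := h2 ▸ hI M ▸ y.2
        exact ⟨x, Subtype.ext hx⟩⟩
    refine ⟨⟨e, fun {k} g => isEmptyElim g, fun {k} R x => ?_⟩, fun _ => rfl⟩
    rw [h3]
    exact hρ k R M _

/-- Interpretations in signatures of arity at most two. -/
theorem Transduction.exists_binLang {L : FirstOrder.Language.{0, 0}} {A B : Type} [Finite A]
    [Finite B] (dom : ∀ M : FinStr L, M → Prop) [hd : FODef₁ dom]
    (u : A → ∀ M : FinStr L, M → Prop) [hu : ∀ a, FODef₁ (u a)]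
    (b : B → ∀ M : FinStr L, M → M → Prop) [hb : ∀ r, FODef₂ (b r)] :
    ∃ T : Transduction L (binLang A B), ∀ (M : FinStr L) (N : FinStr (binLang A B)) (f : N → M),
      Function.Injective f → Set.range f = {x | dom M x} →
        (∀ a x, N.un a x ↔ u a M (f x)) → (∀ r x y, N.bin r x y ↔ b r M (f x) (f y)) →
          T.Out M N f := by
  obtain ⟨T, hT⟩ := Transduction.exists_interpreting (L' := binLang A B) dom
    (fun k R M x => match R with
      | .un a => u a M (x 0)
      | .bin r => b r M (x 0) (x 1)) (by
        rintro k (a | r)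
        · exact (hu a).out
        · exact (hb r).out)
  refine ⟨T, fun M N f h1 h2 h3 h4 => (hT M N f).2 ⟨h1, h2, ?_⟩⟩
  rintro k (a | r) x
  · exact (N.relMap_un a x).trans (h3 a _)
  · exact (N.relMap_bin r x).trans (h4 r _ _)

/-! ### Colorings and copyings in signatures of arity at most two -/

section Colors

variable {A B : Type}

/-- The new predicate has index `none`. It may be any set, so nothing is required of `N` at this
index. -/
theorem Transduction.exists_color [Finite A] [Finite B] :
    ∃ T : Transduction (binLang A B) (binLang (Option A) B),
      ∀ (M : FinStr (binLang A B)) (N : FinStr (binLang (Option A) B)) (f : N → M),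
        Function.Bijective f → (∀ a x, N.un (some a) x ↔ M.un a (f x)) →
          (∀ r x y, N.bin r x y ↔ M.bin r (f x) (f y)) → T.Out M N f := by
  let L := (binLang A B).sum (oneRelLang 1)
  let u : Option A → ∀ M : FinStr L, M → Prop := fun a M x => match a with
      | none => Structure.RelMap (L := L) (n := 1) (Sum.inr ⟨rfl⟩) ![x]
      | some a => Structure.RelMap (L := L) (n := 1) (Sum.inl (BinRel.un a)) ![x]
  have : ∀ a : Option A, FODef₁ (u a) := by
    rintro (_ | a) <;> exact FODef₁.rel (L := L) _
  obtain ⟨S, hS⟩ := Transduction.exists_binLang (L := L) (A := Option A) (B := B)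
    (fun _ _ => True) u
    (fun r M x y => Structure.RelMap (L := L) (n := 2) (Sum.inl (BinRel.bin r)) ![x, y])
    (hb := fun r => FODef₂.rel (L := L) _)
  refine ⟨.comp S (.coloring _), fun M N f hf h1 h2 => ?_⟩
  refine ⟨M.expand {y | ∃ x, f x = y ∧ N.un none x}, id, f, ⟨_, .refl _ _, fun _ => rfl⟩,
    hS _ _ _ hf.1 ?_ ?_ ?_, rfl⟩
  · exact Set.eq_univ_of_forall hf.2
  · rintro (_ | a) x
    · constructor
      · rintro h i
        exact ⟨x, by fin_cases i; rfl, h⟩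
      · intro h
        obtain ⟨z, hz, h⟩ := h 0
        exact hf.1 hz ▸ h
    · exact h1 a x
  · exact h2

theorem Transduction.exists_relabel [Finite B] {A A' : Type} [Finite A'] (g : A' → A) :
    ∃ T : Transduction (binLang A B) (binLang A' B),
      ∀ (M : FinStr (binLang A B)) (N : FinStr (binLang A' B)) (f : N → M),
        Function.Bijective f → (∀ a x, N.un a x ↔ M.un (g a) (f x)) →
          (∀ r x y, N.bin r x y ↔ M.bin r (f x) (f y)) → T.Out M N f := by
  obtain ⟨S, hS⟩ := Transduction.exists_binLang (L := binLang A B) (A := A') (B := B)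
    (fun _ _ => True) (fun a M => M.un (g a)) (fun r M => M.bin r)
  exact ⟨S, fun M N f hf h1 h2 => hS _ _ _ hf.1 (Set.eq_univ_of_forall hf.2) h1 h2⟩

/-- Colors are added one at a time, by induction on the finite type of colors. Finiteness of `I` is
part of the conclusion so that it is available for the types met in the induction. -/
theorem Transduction.exists_colored (I : Type) [Finite I] : Finite I ∧ ∀ (A : Type) [Finite A] [Finite B],
    ∃ T : Transduction (binLang A B) (binLang (A ⊕ I) B),
      ∀ (M : FinStr (binLang A B)) (N : FinStr (binLang (A ⊕ I) B)) (f : N → M),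
        Function.Bijective f → (∀ a x, N.un (.inl a) x ↔ M.un a (f x)) →
          (∀ r x y, N.bin r x y ↔ M.bin r (f x) (f y)) → T.Out M N f := by
  induction I using Finite.induction_empty_option with
  | @of_equiv I J e ih =>
    obtain ⟨_, ih⟩ := ih
    have := Finite.of_equiv I e
    refine ⟨this, fun A _ _ => ?_⟩
    obtain ⟨T, hT⟩ := ih A
    obtain ⟨S, hS⟩ := exists_relabel (B := B) (Sum.map id e.symm : A ⊕ J → A ⊕ I)
    refine ⟨.comp S T, fun M N f hf h1 h2 =>
      ⟨binStr N (fun a => N.un (a.map id e)) N.bin, f, id, hT _ _ _ hf ?_ h2,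
        hS _ _ _ Function.bijective_id ?_ fun _ _ _ => Iff.rfl, rfl⟩⟩
    · exact fun a x => h1 a x
    · rintro (a | a) x
      · rfl
      · change _ ↔ N.un (.inr (e (e.symm a))) x
        rw [e.apply_symm_apply]
  | h_empty =>
    refine ⟨inferInstance, fun A _ _ => ?_⟩
    obtain ⟨S, hS⟩ := exists_relabel (B := B) (fun s : A ⊕ PEmpty => s.elim id PEmpty.elim)
    refine ⟨S, fun M N f hf h1 h2 => hS _ _ _ hf ?_ h2⟩
    rintro (a | a) x
    · exact h1 a x
    · exact a.elim
  | @h_option I _ ih =>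
    refine ⟨inferInstance, fun A _ _ => ?_⟩
    obtain ⟨T, hT⟩ := ih.2 A
    obtain ⟨C, hC⟩ := exists_color (A := A ⊕ I) (B := B)
    obtain ⟨S, hS⟩ := exists_relabel (B := B) (fun s : A ⊕ Option I =>
      s.elim (fun a => some (Sum.inl a)) (fun o => o.elim none (fun i => some (Sum.inr i))))
    refine ⟨.comp S (.comp C T), fun M N f hf h1 h2 =>
      ⟨binStr N (fun o => o.elim (N.un (.inr none)) (fun a => N.un (a.map id some))) N.bin, f, id,
        ⟨binStr N (fun a => N.un (a.map id some)) N.bin, f, id, hT _ _ _ hf ?_ h2,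
          hC _ _ _ Function.bijective_id (fun _ _ => Iff.rfl) fun _ _ _ => Iff.rfl, rfl⟩,
        hS _ _ _ Function.bijective_id ?_ fun _ _ _ => Iff.rfl, rfl⟩⟩
    · exact fun a x => h1 a x
    · rintro (a | _ | a) x <;> rfl

/-- Copying, where the relation with index `none` links the elements that have the same origin. -/
theorem Transduction.exists_copies [Finite A] [Finite B] (k : ℕ) :
    ∃ T : Transduction (binLang A B) (binLang A (Option B)),
      ∀ (M : FinStr (binLang A B)) (N : FinStr (binLang A (Option B))) (f : N → M × Fin k),
        Function.Bijective f → (∀ a x, N.un a x ↔ M.un a (f x).1) →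
          (∀ r x y, N.bin (some r) x y ↔ (f x).2 = (f y).2 ∧ M.bin r (f x).1 (f y).1) →
          (∀ x y, N.bin none x y ↔ (f x).1 = (f y).1) → T.Out M N fun x => (f x).1 := by
  let L := (binLang A B).sum (oneRelLang 2)
  have h0 : FODef₂ fun (M : FinStr L) x y =>
      Structure.RelMap (L := L) (n := 2) (Sum.inr ⟨rfl⟩) ![x, y] := FODef₂.rel (L := L) _
  let b : Option B → ∀ M : FinStr L, M → M → Prop := fun b M x y => match b with
      | none => x = y ∨ Structure.RelMap (L := L) (n := 2) (Sum.inr ⟨rfl⟩) ![x, y]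
      | some b => Structure.RelMap (L := L) (n := 2) (Sum.inl (BinRel.bin b)) ![x, y]
  have : ∀ r : Option B, FODef₂ (b r) := by
    rintro (_ | r)
    · exact ⟨@FODef.or _ _ _ _ _ h0.out⟩
    · exact FODef₂.rel (L := L) _
  obtain ⟨S, hS⟩ := Transduction.exists_binLang (L := L) (A := A) (B := Option B)
    (fun _ _ => True) (fun a M x => Structure.RelMap (L := L) (n := 1) (Sum.inl (BinRel.un a)) ![x])
    b (hu := fun r => FODef₁.rel (L := L) _)
  refine ⟨.comp S (.copying _ k), fun M N f hf h1 h2 h3 => ?_⟩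
  refine ⟨M.copies k, Prod.fst, f, ⟨.refl _ _, fun _ => rfl⟩,
    hS _ _ _ hf.1 (Set.eq_univ_of_forall hf.2) ?_ ?_, rfl⟩
  · intro a x
    refine (h1 a x).trans (Iff.trans ?_ (and_iff_right ?_).symm)
    · refine (M.relMap_un a (fun i => ((![f x] : Fin 1 → M × Fin k) i).1)).symm
    · intro i j
      rw [Subsingleton.elim i j]
  · rintro (_ | r) x y
    · rw [h3]
      constructor
      · intro h
        by_cases h' : f x = f y
        · exact .inl h'
        · refine .inr fun i j => ?_
          have h'' : (f x).2 ≠ (f y).2 := fun h2 => h' (Prod.ext h h2)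
          fin_cases i <;> fin_cases j <;> simp [h, h'', h''.symm]
      · rintro (h | h)
        · rw [h]
        · exact (h 0 1).1
    · rw [h2]
      refine and_congr ?_ ((M.relMap_bin r fun i => ((![f x, f y] : Fin 2 → M × Fin k) i).1).symm)
      simp [Fin.forall_fin_two, eq_comm]

/-- A graph with a coloring of its vertices. -/
def FinGraph.colored {I : Type} (G : FinGraph) (c : I → G.V → Prop) : FinStr (binLang I Unit) :=
  binStr G.V c fun _ => G.graph.Adj

/-- Colorings, an interpretation, copyings, and the selection of some of the clones. -/
theorem Transduction.exists_clones (I K A B : Type) [Finite I] [Finite K] [Finite A] [Finite B]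
    (dom : K → ∀ M : FinStr (binLang I Unit), M → Prop)
    (u : A → K → ∀ M : FinStr (binLang I Unit), M → Prop)
    (b : B → K → K → ∀ M : FinStr (binLang I Unit), M → M → Prop)
    [∀ κ, FODef₁ (dom κ)] [∀ a κ, FODef₁ (u a κ)] [∀ r κ μ, FODef₂ (b r κ μ)] :
    ∃ T : Transduction FirstOrder.Language.graph (binLang A B),
      ∀ (G : FinGraph) (c : I → G.V → Prop) (N : FinStr (binLang A B)) (f : N → G.V × K),
        Function.Injective f → Set.range f = {p | dom p.2 (G.colored c) p.1} →
          (∀ a x, N.un a x ↔ u a (f x).2 (G.colored c) (f x).1) →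
          (∀ r x y, N.bin r x y ↔ b r (f x).2 (f y).2 (G.colored c) (f x).1 (f y).1) →
          T.Out G.str N fun x => (f x).1 := by
  obtain ⟨k, ⟨ε⟩⟩ := Finite.exists_equiv_fin K
  obtain ⟨T₁, h₁⟩ := Transduction.exists_binLang (L := FirstOrder.Language.graph) (A := Empty)
    (B := Unit) (fun _ _ => True) (fun _ _ _ => True)
    (fun _ M x y => Structure.RelMap (L := FirstOrder.Language.graph) adj ![x, y])
  obtain ⟨T₂, h₂⟩ := (Transduction.exists_colored (B := Unit) I).2 Empty
  obtain ⟨T₃, h₃⟩ := Transduction.exists_binLang (L := binLang (Empty ⊕ I) Unit) (A := I) (B := Unit)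
    (fun _ _ => True) (fun i M => M.un (.inr i)) (fun _ M => M.bin ())
  have : ∀ a : K ⊕ A × K, FODef₁ (a.elim dom fun p => u p.1 p.2) := by
    rintro (a | a) <;> dsimp <;> infer_instance
  -- Before copying, every relation wanted between clones is computed on the colored graph, with the
  -- indices of the copies as additional parameters. After copying, colors tell which copy an
  -- element belongs to.
  obtain ⟨T₄, h₄⟩ := Transduction.exists_binLang (L := binLang I Unit) (A := K ⊕ A × K)
    (B := B × K × K) (fun _ _ => True) (fun a => a.elim dom fun p => u p.1 p.2)
    (fun r => b r.1 r.2.1 r.2.2)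
  obtain ⟨T₅, h₅⟩ := Transduction.exists_copies (A := K ⊕ A × K) (B := B × K × K) k
  obtain ⟨T₆, h₆⟩ := (Transduction.exists_colored (B := Option (B × K × K)) K).2 (K ⊕ A × K)
  -- Copying preserves relations only inside each copy. A relation between an element `x` of copy
  -- `κ` and an element `y` of copy `μ` is therefore read off between `x` and the clone `z` of `y`
  -- in the copy of `x`.
  obtain ⟨T₇, h₇⟩ := Transduction.exists_binLang
    (L := binLang ((K ⊕ A × K) ⊕ K) (Option (B × K × K))) (A := A) (B := B)
    (fun M x => ∃ κ, M.un (.inr κ) x ∧ M.un (.inl (.inl κ)) x)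
    (fun a M x => ∃ κ, M.un (.inr κ) x ∧ M.un (.inl (.inr (a, κ))) x)
    (fun r M x y => ∃ κ μ, M.un (.inr κ) x ∧ M.un (.inr μ) y ∧
      ∃ z, M.bin none y z ∧ M.bin (some (r, κ, μ)) x z)
    (hd := ⟨inferInstance⟩) (hu := fun _ => ⟨inferInstance⟩) (hb := fun _ => ⟨inferInstance⟩)
  refine ⟨.comp T₇ <| .comp T₆ <| .comp T₅ <| .comp T₄ <| .comp T₃ <| .comp T₂ T₁,
    fun G c N f hf hr hu hb => ?_⟩
  let M := G.colored c
  let M₁ : FinStr (binLang Empty Unit) := binStr G.V (fun _ _ => True) (fun _ => G.graph.Adj)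
  let M₂ : FinStr (binLang (Empty ⊕ I) Unit) :=
    binStr G.V (fun s => s.elim (fun _ _ => True) c) (fun _ => G.graph.Adj)
  let M₄ : FinStr (binLang (K ⊕ A × K) (B × K × K)) :=
    binStr G.V (fun a => (a.elim dom fun p => u p.1 p.2) M) (fun r => b r.1 r.2.1 r.2.2 M)
  let M₆ : FinStr (binLang ((K ⊕ A × K) ⊕ K) (Option (B × K × K))) :=
    binStr (G.V × K) (fun a p => a.elim (fun a => M₄.un a p.1) (fun κ => κ = p.2))
      (fun r p q => r.elim (p.1 = q.1) fun r => p.2 = q.2 ∧ M₄.bin r p.1 q.1)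
  let M₅ : FinStr (binLang (K ⊕ A × K) (Option (B × K × K))) :=
    binStr (G.V × K) (fun a => M₆.un (.inl a)) M₆.bin
  have hid : ∀ {X : Type}, Set.range (id : X → X) = {_x | True} := by simp
  refine ⟨M₆, Prod.fst, f, ⟨M₅, Prod.fst, id, ⟨M₄, id, Prod.fst, ⟨M, id, id, ⟨M₂, id, id,
    ⟨M₁, id, id, ?_, ?_, rfl⟩, ?_, rfl⟩, ?_, rfl⟩, ?_, rfl⟩, ?_, rfl⟩, ?_, rfl⟩
  · exact h₁ _ _ _ Function.injective_id hid (fun a => a.elim) fun _ _ _ => Iff.rfl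
  · exact h₂ _ _ _ Function.bijective_id (fun a => a.elim) fun _ _ _ => Iff.rfl
  · exact h₃ _ _ _ Function.injective_id hid (fun _ _ => Iff.rfl) fun _ _ _ => Iff.rfl
  · exact h₄ _ _ _ Function.injective_id hid (fun _ _ => Iff.rfl) fun _ _ _ => Iff.rfl
  · refine h₅ M₄ M₅ (Prod.map id ε) (Function.bijective_id.prodMap ε.bijective)
      (fun _ _ => Iff.rfl) (fun r x y => ?_) fun _ _ => Iff.rfl
    exact and_congr_left' ε.injective.eq_iff.symm
  · exact h₆ _ _ _ Function.bijective_id (fun _ _ => Iff.rfl) fun _ _ _ => Iff.rfl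
  · refine h₇ M₆ N f hf ?_ (fun a x => ?_) fun r x y => ?_
    · refine hr.trans (Set.ext fun p => ⟨fun h => ⟨p.2, (rfl : p.2 = p.2), h⟩, ?_⟩)
      rintro ⟨κ, hκ, h⟩
      obtain rfl : κ = p.2 := hκ
      exact h
    · rw [hu]
      refine ⟨fun h => ⟨(f x).2, (rfl : (f x).2 = (f x).2), h⟩, ?_⟩
      rintro ⟨κ, hκ, h⟩
      obtain rfl : κ = (f x).2 := hκ
      exact h
    · rw [hb]
      refine ⟨fun h => ⟨(f x).2, (f y).2, (rfl : (f x).2 = (f x).2), (rfl : (f y).2 = (f y).2),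
        ((f y).1, (f x).2), (rfl : (f y).1 = (f y).1), (rfl : (f x).2 = (f x).2), h⟩, ?_⟩
      rintro ⟨κ, μ, hκ, hμ, z, hz, -, h⟩
      obtain rfl : κ = (f x).2 := hκ
      obtain rfl : μ = (f y).2 := hμ
      have hz : (f y).1 = z.1 := hz
      rw [hz]
      exact h

end Colors

/-! ### Trees -/

namespace TModel

variable {S : Type} (T : TModel S)

variable {T} in
theorem le_of_lt_of_covBy {c x y : T.Node} (h : c ⋖ y) (hx : x < y) : x ≤ c := by
  rcases T.chain x c y hx.le h.le with h' | h'
  · exact h'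
  · by_contra hc
    exact h.2 (lt_of_le_not_ge h' hc) hx

variable {T} in
theorem covBy_unique {c d y : T.Node} (h : c ⋖ y) (h' : d ⋖ y) : c = d :=
  le_antisymm (le_of_lt_of_covBy h' h.lt) (le_of_lt_of_covBy h h'.lt)

variable {T} in
theorem exists_lt_of_not_isBot {y : T.Node} (hy : ¬ IsBot y) : ∃ x, x < y := by
  obtain ⟨z, hz⟩ := not_forall.1 hy
  obtain ⟨m, hm, hm'⟩ := T.connected y z
  exact ⟨m, lt_of_le_of_ne hm fun h => hz (h ▸ hm')⟩

variable {T} in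
theorem exists_covBy_of_lt {x y : T.Node} (h : x < y) : ∃ c, c ⋖ y ∧ x ≤ c := by
  obtain ⟨c, hc, hm⟩ := (Set.toFinite (Set.Ico x y)).exists_maximal ⟨x, le_rfl, h⟩
  exact ⟨c, ⟨hc.2, fun d hd hdy => hd.not_ge (hm ⟨hc.1.trans hd.le, hdy⟩ hd.le)⟩, hc.1⟩

variable {T} in
theorem exists_child_of_lt {x y : T.Node} (h : x < y) : ∃ c, x ⋖ c ∧ c ≤ y := by
  obtain ⟨c, hc, hm⟩ := (Set.toFinite (Set.Ioc x y)).exists_minimal ⟨y, h, le_rfl⟩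
  exact ⟨c, ⟨hc.1, fun d hd hdc => hdc.not_ge (hm ⟨hd, hdc.le.trans hc.2⟩ hdc.le)⟩, hc.2⟩

variable {T} in
theorem child_unique {x a b y : T.Node} (ha : x ⋖ a) (hb : x ⋖ b) (hay : a ≤ y) (hby : b ≤ y) :
    a = b := by
  rcases T.chain a b y hay hby with h | h
  · exact h.lt_or_eq.elim (fun h => (hb.2 ha.lt h).elim) id
  · exact h.lt_or_eq.elim (fun h => (ha.2 hb.lt h).elim) Eq.symm

/-- The depth of a node; the root has depth `0`. -/
noncomputable def depth (x : T.Node) : ℕ := (Set.Iio x).ncard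

variable {T} in
theorem depth_lt {x y : T.Node} (h : x < y) : T.depth x < T.depth y :=
  Set.ncard_lt_ncard ⟨fun _ hz => lt_trans hz h, fun h' => lt_irrefl x (h' h)⟩ (Set.toFinite _)

variable {T} in
theorem depth_le {x y : T.Node} (h : x ≤ y) : T.depth x ≤ T.depth y :=
  Set.ncard_le_ncard (fun _ hz => lt_of_lt_of_le hz h) (Set.toFinite _)

theorem ncard_Iic (x : T.Node) : (Set.Iic x).ncard = T.depth x + 1 := by
  rw [← Set.Iio_insert, Set.ncard_insert_of_notMem (by simp) (Set.toFinite _), depth]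

variable {T} in
theorem depth_of_covBy {x y : T.Node} (h : x ⋖ y) : T.depth y = T.depth x + 1 := by
  rw [← ncard_Iic, depth]
  congr 1
  ext z
  exact ⟨fun hz => le_of_lt_of_covBy h hz, fun hz => lt_of_le_of_lt hz h.lt⟩

variable {T} in
-- Depth is strictly increasing on the chain below `z`. Applied to a leaf `z`, this is what makes it
-- possible to code a node by its depth and a leaf above it.
theorem eq_of_depth_eq {x y z : T.Node} (hx : x ≤ z) (hy : y ≤ z) (h : T.depth x = T.depth y) :
    x = y := by
  rcases T.chain x y z hx hy with h' | h'
  · exact h'.lt_or_eq.elim (fun h' => absurd h (depth_lt h').ne) id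
  · exact h'.lt_or_eq.elim (fun h' => absurd h (depth_lt h').ne') Eq.symm

variable {T} in
theorem le_of_depth_le {x y z : T.Node} (hx : x ≤ z) (hy : y ≤ z) (h : T.depth x ≤ T.depth y) :
    x ≤ y := by
  rcases T.chain x y z hx hy with h' | h'
  · exact h'
  · exact (eq_of_depth_eq hx hy (h.antisymm (depth_le h'))).le

variable {T} in
theorem exists_le_depth_eq (y : T.Node) : ∀ d ≤ T.depth y, ∃ x ≤ y, T.depth x = d := by
  induction hk : T.depth y generalizing y with
  | zero => exact fun d hd => ⟨y, le_rfl, by omega⟩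
  | succ k ih =>
    intro d hd
    rcases hd.lt_or_eq with hd | rfl
    · obtain ⟨x, hx⟩ : (Set.Iio y).Nonempty := by
        apply Set.nonempty_of_ncard_ne_zero
        rw [depth] at hk
        omega
      obtain ⟨c, hc, -⟩ := exists_covBy_of_lt hx
      obtain ⟨x, hx, hd⟩ := ih c (by have := depth_of_covBy hc; omega) d (by omega)
      exact ⟨x, hx.trans hc.le, hd⟩
    · exact ⟨y, le_rfl, hk⟩

theorem depth_eq_zero_iff {x : T.Node} : T.depth x = 0 ↔ IsBot x := by
  rw [depth, Set.ncard_eq_zero (Set.toFinite _)]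
  constructor
  · intro h
    by_contra hx
    obtain ⟨y, hy⟩ := exists_lt_of_not_isBot hx
    exact (h ▸ hy : y ∈ (∅ : Set T.Node))
  · exact fun h => Set.eq_empty_of_forall_notMem fun y hy => (h y).not_gt hy

theorem exists_leaf_ge (x : T.Node) : ∃ s, x ≤ T.leaf s := by
  obtain ⟨y, hxy, hy⟩ := (Set.toFinite (Set.univ : Set T.Node)).exists_le_maximal (Set.mem_univ x)
  have : y ∈ {x | IsMax x} := fun z hz => hy.2 (Set.mem_univ z) hz
  rw [← T.leaf_range] at this
  obtain ⟨s, rfl⟩ := this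
  exact ⟨s, hxy⟩

theorem exists_eq_leaf {x : T.Node} (hx : IsMax x) : ∃ s, T.leaf s = x := by
  have : x ∈ {x | IsMax x} := hx
  rwa [← T.leaf_range] at this

/-- The increasing enumeration of the nodes below `y`. -/
theorem exists_rootPath (y : T.Node) : ∃ p : Fin (T.depth y + 1) → T.Node,
    IsBot (p 0) ∧ p (Fin.last _) = y ∧ (∀ i : Fin (T.depth y), p i.castSucc ⋖ p i.succ) ∧
      Function.Injective p ∧ ∀ x, x ≤ y → ∃ i, x = p i := by
  choose f hf hd using fun d => exists_le_depth_eq y d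
  have hp : ∀ i : Fin (T.depth y + 1), i.1 ≤ T.depth y := fun i => Nat.lt_succ_iff.1 i.2
  have key : ∀ x, x ≤ y → ∀ i : Fin (T.depth y + 1), T.depth x = i → x = f i (hp i) :=
    fun x hx i hi => eq_of_depth_eq hx (hf _ _) (hi.trans (hd _ _).symm)
  refine ⟨fun i => f i (hp i), ?_, ?_, fun i => ?_, fun i j h => ?_, fun x hx => ?_⟩
  · rw [← depth_eq_zero_iff]
    exact hd _ _
  · exact (key y le_rfl (Fin.last _) rfl).symm
  · have hle := le_of_depth_le (hf _ (hp i.castSucc)) (hf _ (hp i.succ)) (by rw [hd, hd]; simp)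
    have hlt : f _ (hp i.castSucc) < f _ (hp i.succ) := by
      refine lt_of_le_of_ne hle fun h => ?_
      have := congrArg T.depth h
      rw [hd, hd] at this
      simp at this
    refine ⟨hlt, fun c hc hc' => ?_⟩
    have h1 := depth_lt hc
    have h2 := depth_lt hc'
    rw [hd] at h1 h2
    simp at h1 h2
    omega
  · have := congrArg T.depth h
    simp only [hd] at this
    exact Fin.ext this
  · exact ⟨⟨T.depth x, Nat.lt_succ_iff.2 (depth_le hx)⟩, key x hx _ rfl⟩

variable {T} in
/-- A simple path from the root is increasing. -/
theorem covBy_of_isPath {k : ℕ} {p : Fin (k + 1) → T.Node} (h0 : IsBot (p 0))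
    (hp : Function.Injective p)
    (he : ∀ i : Fin k, p i.castSucc ⋖ p i.succ ∨ p i.succ ⋖ p i.castSucc) (i : Fin k) :
    p i.castSucc ⋖ p i.succ := by
  obtain ⟨i, hi⟩ := i
  induction i with
  | zero =>
    refine (he ⟨0, hi⟩).resolve_right fun h => ?_
    exact h.lt.not_ge (h0 _)
  | succ i ih =>
    refine (he ⟨i + 1, hi⟩).resolve_right fun h => ?_
    -- A step back towards the root would lead to the unique parent, which is the vertex visited
    -- just before.
    have := covBy_unique (ih (by omega)) h
    have := congrArg Fin.val (hp this)
    simp at this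
    omega

theorem exists_isGLB [Nonempty T.Node] (x y : T.Node) : ∃ m, IsGLB {x, y} m := by
  obtain ⟨m, hm⟩ := T.connected x y
  obtain ⟨c, hc, hmax⟩ := (Set.toFinite {m | m ≤ x ∧ m ≤ y}).exists_maximal ⟨m, hm⟩
  refine ⟨c, by simpa [lowerBounds] using hc, fun z hz => ?_⟩
  have hz : z ≤ x ∧ z ≤ y := by simpa [lowerBounds] using hz
  rcases T.chain z c x hz.1 hc.1 with h | h
  · exact h
  · exact hmax hz h

end TModel

/-! ### The graph interpreted in an amalgam -/

namespace SBuildFormula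

variable {n : ℕ} {α : Type} {M : FinStr (amalgLang n)} {v : α → M}

@[simp] theorem realize_eq (a b : α) : (eq (n := n) a b).Realize v ↔ v a = v b := by
  simp [eq]

@[simp] theorem realize_un (R : AmalgRel n 1) (a : α) :
    (un R a).Realize v ↔ Structure.RelMap (L := amalgLang n) (n := 1) R ![v a] := by
  exact Formula.realize_rel₁.trans (by simp)

@[simp] theorem realize_bin (R : AmalgRel n 2) (a b : α) :
    (bin R a b).Realize v ↔ Structure.RelMap (L := amalgLang n) (n := 2) R ![v a, v b] := by
  exact Formula.realize_rel₂.trans (by simp)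

end SBuildFormula

namespace Amalgam

variable {n : ℕ} {V : Type} (D : Amalgam n V)

inductive LE : D.Carrier → D.Carrier → Prop
  | mk (a : PieceIdx n) (x y : (D.tree a).Node) (h : x ≤ y) : LE (.inr ⟨a, x⟩) (.inr ⟨a, y⟩)

variable {D}

theorem le_inr {a : PieceIdx n} {x y : (D.tree a).Node} :
    D.LE (.inr ⟨a, x⟩) (.inr ⟨a, y⟩) ↔ x ≤ y :=
  ⟨fun h => by cases h; assumption, LE.mk a x y⟩

theorem link_inr {a b : PieceIdx n} {x : (D.tree a).Node} {y : (D.tree b).Node} :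
    D.Link (.inr ⟨a, x⟩) (.inr ⟨b, y⟩) ↔ ∃ h : a = b, (h ▸ x) ⋖ y :=
  ⟨fun h => by cases h; exact ⟨rfl, by assumption⟩, by
    rintro ⟨rfl, h⟩
    exact .tree a x y h⟩

theorem label_inr {l : NodeLabel} {a : PieceIdx n} {x : (D.tree a).Node} :
    D.Label l (.inr ⟨a, x⟩) ↔ ¬ IsMax x ∧ (D.tree a).label x = l :=
  ⟨fun h => by cases h; exact ⟨‹_›, ‹_›⟩, fun h => .mk a x h.1 h.2⟩

theorem color_leaf {c : Fin 2} {a : PieceIdx n} {s : pieceGround D.part a} :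
    D.Color c (.inr ⟨a, (D.tree a).leaf s⟩) ↔ (D.tree a).color s = c := by
  constructor
  · intro h
    generalize hx : (D.tree a).leaf s = x at h
    obtain ⟨_, t, ht⟩ := h
    rwa [(D.tree a).leaf_injective hx]
  · exact fun h => .mk a s h

theorem tri_inr {a : PieceIdx n} {x y : (D.tree a).Node} :
    D.Tri (.inr ⟨a, x⟩) (.inr ⟨a, y⟩) ↔ (D.tree a).tri x y :=
  ⟨fun h => by cases h; assumption, .mk a x y⟩

open SBuildFormula

variable [Finite V]

/-- A simple path from a root that avoids the ground stays in one tree and is increasing, so all its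
vertices are below its end. Conversely, the chain below a node is such a path, and the bound on the
height bounds its length. -/
theorem realize_treeLE {H : ℕ} (hD : D.HeightLE H) {α : Type} {v : α → D.str} (a b : α) :
    (treeLE (n := n) H a b).Realize v ↔ D.LE (v a) (v b) := by
  have : (treeLE (n := n) H a b).Realize v ↔ ∃ k : Fin H, ∃ p : Fin (k + 1) → D.Carrier,
      D.Root (p 0) ∧ p (Fin.last _) = v b ∧ (∀ i, ¬ ∃ w, p i = .inl w) ∧
      (∀ i : Fin k, D.Link (p i.castSucc) (p i.succ) ∨ D.Link (p i.succ) (p i.castSucc)) ∧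
      (∀ q : {q : Fin (k + 1) × Fin (k + 1) // q.1 < q.2}, p q.1.1 ≠ p q.1.2) ∧
      ∃ i, v a = p i := by
    simp only [treeLE, onRootPath, Formula.realize_iSup, Formula.realize_iExs, Formula.realize_inf,
      Formula.realize_iInf, Formula.realize_not, realize_un, realize_bin, realize_eq, and_assoc]
    rfl
  rw [this]
  constructor
  · rintro ⟨k, p, h0, hl, hg, he, hp, i, hi⟩
    generalize v a = va at *
    generalize v b = vb at *
    have hinj : Function.Injective p := by
      intro i j h
      rcases lt_trichotomy i j with hij | hij | hij
      · exact (hp ⟨(i, j), hij⟩ h).elim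
      · exact hij
      · exact (hp ⟨(j, i), hij⟩ h.symm).elim
    obtain ⟨c, r, hr⟩ : ∃ c r, p 0 = .inr ⟨c, r⟩ := by
      revert h0
      generalize p 0 = z
      rintro ⟨c, r, -⟩
      exact ⟨c, r, rfl⟩
    -- The tree never changes along the path, because the only links that leave a tree go to the
    -- ground.
    have hc : ∀ i, ∃ x : (D.tree c).Node, p i = .inr ⟨c, x⟩ := by
      intro i
      induction i using Fin.induction with
      | zero => exact ⟨r, hr⟩
      | succ i ih =>
        obtain ⟨x, hx⟩ := ih
        have h1 := he i
        have h2 := hg i.succ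
        rw [hx] at h1
        revert h1 h2
        generalize p i.succ = z
        intro h1 h2
        rcases h1 with h1 | h1
        · cases h1
          exact ⟨_, rfl⟩
        · cases h1
          · exact ⟨_, rfl⟩
          · exact (h2 ⟨_, rfl⟩).elim
    choose q hq using hc
    have hqi : Function.Injective q := fun i j h => hinj (by rw [hq, hq, h])
    have hq0 : IsBot (q 0) := by
      rw [hq] at h0
      cases h0
      assumption
    have hcov := TModel.covBy_of_isPath hq0 hqi fun i => by
      have := he i
      simp only [hq, link_inr, exists_true_left] at this
      exact this
    have hmono : ∀ i, q i ≤ q (Fin.last _) := fun i =>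
      Fin.monotone_iff_le_succ.2 (fun i => (hcov i).le) (Fin.le_last i)
    rw [hi, ← hl, hq, hq]
    exact .mk c _ _ (hmono i)
  · intro h
    generalize v a = va at *
    generalize v b = vb at *
    obtain ⟨c, x, y, hxy⟩ := h
    obtain ⟨p, h0, hl, hcov, hinj, hp⟩ := (D.tree c).exists_rootPath y
    obtain ⟨i, rfl⟩ := hp x hxy
    refine ⟨⟨(D.tree c).depth y, ?_⟩, fun i => .inr ⟨c, p i⟩, .mk c _ h0, ?_, ?_, ?_, ?_, i, rfl⟩
    · have := hD c y
      rw [TModel.ncard_Iic] at this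
      omega
    · exact congrArg (fun z => Sum.inr (Sigma.mk c z)) hl
    · rintro i ⟨w, hw⟩
      cases hw
    · exact fun i => .inl (.tree c _ _ (hcov i))
    · rintro ⟨⟨i, j⟩, hij⟩ h
      have : p i = p j := by simpa using h
      exact hij.ne (hinj this)

theorem realize_isInf {H : ℕ} (hD : D.HeightLE H) {α : Type} {v : α → D.str} (m a b : α) :
    (isInf (n := n) H m a b).Realize v ↔ ∃ c x y z, v m = .inr ⟨c, x⟩ ∧ v a = .inr ⟨c, y⟩ ∧
      v b = .inr ⟨c, z⟩ ∧ IsGLB {y, z} x := by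
  have : (isInf (n := n) H m a b).Realize v ↔ D.LE (v m) (v a) ∧ D.LE (v m) (v b) ∧
      ∀ w, D.LE w (v a) → D.LE w (v b) → D.LE w (v m) := by
    simp only [isInf, Formula.realize_inf, Formula.realize_iAlls, Formula.realize_imp,
      realize_treeLE hD, and_assoc, and_imp, Sum.elim_inl, Sum.elim_inr]
    exact and_congr_right fun _ => and_congr_right fun _ =>
      ⟨fun h w => h fun _ => w, fun h w => h (w 0)⟩
  rw [this]
  generalize v m = vm
  generalize v a = va
  generalize v b = vb
  constructor
  · rintro ⟨h1, h2, h3⟩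
    obtain ⟨c, x, y, hxy⟩ := h1
    obtain ⟨_, _, z, hxz⟩ := h2
    refine ⟨c, x, y, z, rfl, rfl, rfl, by simp [lowerBounds, *], fun w hw => ?_⟩
    have hw : w ≤ y ∧ w ≤ z := by simpa [lowerBounds] using hw
    exact le_inr.1 (h3 _ (.mk c w y hw.1) (.mk c w z hw.2))
  · rintro ⟨c, x, y, z, rfl, rfl, rfl, h⟩
    refine ⟨le_inr.2 (h.1 (by simp)), le_inr.2 (h.1 (by simp)), ?_⟩
    rintro _ ⟨_, w, _, hw⟩ hw'
    exact le_inr.2 (h.2 (by simp [lowerBounds, hw, le_inr.1 hw']))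

end Amalgam

namespace TModel

variable {S : Type} {T : TModel S}

theorem not_isMax_of_isGLB {s t : S} (hst : s ≠ t) {m : T.Node}
    (hm : IsGLB {T.leaf s, T.leaf t} m) : ¬ IsMax m := by
  intro h
  have h1 : m ≤ T.leaf s := hm.1 (by simp)
  have h2 : m ≤ T.leaf t := hm.1 (by simp)
  exact hst (T.leaf_injective ((le_antisymm h1 (h h1)).symm.trans (le_antisymm h2 (h h2))))

/-- The formula for O-nodes only asks for related nodes below the two leaves. Such nodes are
siblings; if their parent were strictly below the infimum, both would lie on the chain below the
infimum and would coincide. -/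
theorem covBy_of_tri {m a b x y : T.Node} (hm : IsGLB {a, b} m) (hx : x ≤ a) (hy : y ≤ b)
    (h : T.tri x y) : m ∈ T.C ∧ m ⋖ x ∧ m ⋖ y := by
  have hne : x ≠ y := fun e => T.tri_irrefl y (e ▸ h)
  obtain ⟨p, hp, hpx, hpy⟩ := (T.tri_comparable x y hne).1 (.inl h)
  have hma : m ≤ a := hm.1 (by simp)
  have hmb : m ≤ b := hm.1 (by simp)
  have hpm : p ≤ m := hm.2 (by simp [lowerBounds, hpx.le.trans hx, hpy.le.trans hy])
  rcases hpm.lt_or_eq with hpm | rfl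
  · have h1 : x ≤ m := by
      rcases T.chain x m a hx hma with h' | h'
      · exact h'
      · exact h'.lt_or_eq.elim (fun h' => (hpx.2 hpm h').elim) fun h' => h'.ge
    have h2 : y ≤ m := by
      rcases T.chain y m b hy hmb with h' | h'
      · exact h'
      · exact h'.lt_or_eq.elim (fun h' => (hpy.2 hpm h').elim) fun h' => h'.ge
    exact (hne (child_unique hpx hpy h1 h2)).elim
  · exact ⟨hp, hpx, hpy⟩

theorem joins_iff_of_isCotree (hT : T.IsCotree) {s t : S} (hst : s ≠ t) :
    T.Joins s t ↔ ∃ m, IsGLB {T.leaf s, T.leaf t} m ∧ T.label m = .J := by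
  refine exists_congr fun m => and_congr_right fun hm => ?_
  simp only [hT.1, Set.mem_empty_iff_false, false_imp_iff, true_and]
  rcases hT.2.2 m (not_isMax_of_isGLB hst hm) with h | h <;> simp [h, NodeLabel.kappa]

theorem joins_iff_of_isBicotree (hT : T.IsBicotree) {s t : S} (hst : s ≠ t) :
    T.Joins s t ↔ ∃ m, IsGLB {T.leaf s, T.leaf t} m ∧
      (T.label m = .B ∧ T.color s ≠ T.color t ∨ T.label m = .O ∧ T.color s = 0 ∧ T.color t = 1 ∧
        ∃ x y, x ≤ T.leaf s ∧ y ≤ T.leaf t ∧ T.tri x y) := by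
  refine exists_congr fun m => and_congr_right fun hm => ?_
  rcases hT m (not_isMax_of_isGLB hst hm) with ⟨h, h'⟩ | ⟨h, h'⟩ | ⟨h, h'⟩
  · simp [h, h', NodeLabel.kappa]
  · simp [h, h', NodeLabel.kappa]
  · have hc : T.color s < T.color t ↔ T.color s = 0 ∧ T.color t = 1 := by
      generalize T.color s = i
      generalize T.color t = j
      revert i j
      decide
    simp only [h, h', NodeLabel.kappa, hc, true_imp_iff, reduceCtorEq, false_and, false_or,
      true_and]
    constructor
    · rintro ⟨⟨a, b, -, h1, -, h2, h3⟩, h4, h5⟩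
      exact ⟨h4, h5, a, b, h1, h2, h3⟩
    · rintro ⟨h4, h5, a, b, h1, h2, h3⟩
      have := covBy_of_tri hm h1 h2 h3
      exact ⟨⟨a, b, this.2.1, h1, this.2.2, h2, h3⟩, h4, h5⟩

theorem color_ne_of_adj (hT : T.IsBicotree) {s t : S} (h : T.graph.Adj s t) :
    T.color s ≠ T.color t := by
  obtain ⟨hst, h | h⟩ := h
  · obtain ⟨m, -, ⟨-, h⟩ | ⟨-, h, h', -⟩⟩ := (joins_iff_of_isBicotree hT hst).1 h
    · exact h
    · simp [h, h']
  · obtain ⟨m, -, ⟨-, h⟩ | ⟨-, h, h', -⟩⟩ := (joins_iff_of_isBicotree hT hst.symm).1 h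
    · exact h.symm
    · simp [h, h']

end TModel

namespace Amalgam

variable {n : ℕ} {V : Type} (D : Amalgam n V)

/-- The union of the graphs modeled by the trees of an amalgam. -/
def graph : SimpleGraph V where
  Adj v w := ∃ a hv hw, (D.tree a).graph.Adj ⟨v, hv⟩ ⟨w, hw⟩
  symm := ⟨fun _ _ ⟨a, hv, hw, h⟩ => ⟨a, hw, hv, h.symm⟩⟩
  loopless := ⟨fun _ ⟨_, _, _, h⟩ => h.ne rfl⟩

variable {D}

theorem part_ne_of_adj {p : {p : Fin n × Fin n // p.1 < p.2}} {s t : pieceGround D.part (.inr p)}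
    (h : (D.tree (.inr p)).graph.Adj s t) : D.part s ≠ D.part t := by
  obtain ⟨hb, hc⟩ := D.isPiece (.inr p)
  intro hp
  apply TModel.color_ne_of_adj hb h
  have h1 := hc s
  have h2 := hc t
  rw [hp] at h1
  have := h1.trans h2.symm
  revert this
  generalize (D.tree (.inr p)).color s = i
  generalize (D.tree (.inr p)).color t = j
  revert i j
  decide

theorem part_eq_of_mem {i : Fin n} (s t : pieceGround D.part (.inl i)) : D.part s = D.part t :=
  (s.2 : D.part s = i).trans (t.2 : D.part t = i).symm

theorem link_inl {s : V} {z : D.Carrier} : D.Link (.inl s) z ∨ D.Link z (.inl s) ↔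
    ∃ (c : PieceIdx n) (h : c.Has (D.part s)), z = .inr ⟨c, (D.tree c).leaf ⟨s, h⟩⟩ := by
  constructor
  · rintro (h | h)
    · obtain _ | ⟨c, v⟩ := h
      exact ⟨c, v.2, rfl⟩
    · cases h
  · rintro ⟨c, h, rfl⟩
    exact .inl (.leaf c ⟨s, h⟩)

theorem adj_iff_of_part_eq {s t : V} (h : D.part s = D.part t) : D.graph.Adj s t ↔
    ∃ i hs ht, (D.tree (.inl i)).graph.Adj ⟨s, hs⟩ ⟨t, ht⟩ := by
  constructor
  · rintro ⟨i | p, hs, ht, hst⟩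
    · exact ⟨i, hs, ht, hst⟩
    · exact (part_ne_of_adj hst h).elim
  · rintro ⟨i, hs, ht, hst⟩
    exact ⟨.inl i, hs, ht, hst⟩

theorem adj_iff_of_part_ne {s t : V} (h : D.part s ≠ D.part t) : D.graph.Adj s t ↔
    ∃ p hs ht, (D.tree (.inr p)).graph.Adj ⟨s, hs⟩ ⟨t, ht⟩ := by
  constructor
  · rintro ⟨i | p, hs, ht, hst⟩
    · exact (h (part_eq_of_mem ⟨s, hs⟩ ⟨t, ht⟩)).elim
    · exact ⟨p, hs, ht, hst⟩
  · rintro ⟨p, hs, ht, hst⟩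
    exact ⟨.inr p, hs, ht, hst⟩

theorem label_inl_ne_J (p) {x : (D.tree (.inr p)).Node} (hx : ¬ IsMax x) :
    (D.tree (.inr p)).label x ≠ .J := by
  rcases (D.isPiece (.inr p)).1 x hx with ⟨-, h⟩ | ⟨-, h⟩ | ⟨-, h⟩ <;> simp [h]

open SBuildFormula

variable [Finite V]

theorem realize_cotreeAdj {H : ℕ} (hD : D.HeightLE H) {α : Type} {v : α → D.str} (a b : α) :
    (cotreeAdj (n := n) H a b).Realize v ↔ ∃ c x y z, v a = .inr ⟨c, y⟩ ∧
      v b = .inr ⟨c, z⟩ ∧ IsGLB {y, z} x ∧ ¬ IsMax x ∧ (D.tree c).label x = .J := by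
  simp only [cotreeAdj, Formula.realize_iExs, Formula.realize_inf, realize_isInf hD, realize_un,
    Sum.elim_inr, Sum.elim_inl]
  constructor
  · rintro ⟨m, ⟨c, x, y, z, h1, h2, h3, h4⟩, h5⟩
    rw [h1] at h5
    exact ⟨c, x, y, z, h2, h3, h4, label_inr.1 h5⟩
  · rintro ⟨c, x, y, z, h2, h3, h4, h5⟩
    exact ⟨fun _ => .inr ⟨c, x⟩, ⟨c, x, y, z, rfl, h2, h3, h4⟩, label_inr.2 h5⟩

theorem realize_bicotreeAdj {H : ℕ} (hD : D.HeightLE H) {α : Type} {v : α → D.str} (a b : α) :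
    (bicotreeAdj (n := n) H a b).Realize v ↔ D.Color 0 (v a) ∧ D.Color 1 (v b) ∧
      ∃ c x y z, v a = .inr ⟨c, y⟩ ∧
      v b = .inr ⟨c, z⟩ ∧ IsGLB {y, z} x ∧ ¬ IsMax x ∧ ((D.tree c).label x = .B ∨
        (D.tree c).label x = .O ∧ ∃ y' z', y' ≤ y ∧ z' ≤ z ∧ (D.tree c).tri y' z') := by
  simp only [bicotreeAdj, Formula.realize_iExs, Formula.realize_inf, Formula.realize_sup,
    realize_isInf hD, realize_un, realize_bin, realize_treeLE hD, Sum.elim_inr, Sum.elim_inl,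
    and_assoc]
  refine and_congr Iff.rfl (and_congr Iff.rfl ?_)
  constructor
  · rintro ⟨m, ⟨c, x, y, z, h1, h2, h3, h4⟩, h5⟩
    rw [h1] at h5
    refine ⟨c, x, y, z, h2, h3, h4, ?_⟩
    rcases h5 with h5 | ⟨h5, h6, h7, h8⟩
    · obtain ⟨h5, h6⟩ := label_inr.1 h5
      exact ⟨h5, .inl h6⟩
    · obtain ⟨h5, h9⟩ := label_inr.1 h5
      rw [h2] at h6
      rw [h3] at h7
      refine ⟨h5, .inr ⟨h9, ?_⟩⟩
      have h8 : D.Tri (m 1) (m 2) := h8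
      generalize m 1 = m1 at *
      generalize m 2 = m2 at *
      obtain ⟨_, y', _, h6⟩ := h6
      obtain ⟨_, z', _, h7⟩ := h7
      exact ⟨y', z', h6, h7, tri_inr.1 h8⟩
  · rintro ⟨c, x, y, z, h2, h3, h4, h5, h6 | ⟨h6, y', z', h7, h8, h9⟩⟩
    · exact ⟨fun _ => .inr ⟨c, x⟩, ⟨c, x, y, z, rfl, h2, h3, h4⟩, .inl (label_inr.2 ⟨h5, h6⟩)⟩
    · refine ⟨![.inr ⟨c, x⟩, .inr ⟨c, y'⟩, .inr ⟨c, z'⟩], ⟨c, x, y, z, rfl, h2, h3, h4⟩,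
        .inr ⟨label_inr.2 ⟨h5, h6⟩, ?_, ?_, tri_inr.2 h9⟩⟩
      · rw [h2]
        exact le_inr.2 h7
      · rw [h3]
        exact le_inr.2 h8

/-- Vertices in the same part are adjacent only through a cotree, since the edges of bicotrees join
distinct colors, hence distinct parts; and vertices in distinct parts share no cotree. As J does not
occur in bicotrees, the formula needs no predicate for the kind of tree that it looks at. -/
theorem realize_sbuildAdj {H : ℕ} (hD : D.HeightLE H) {α : Type} {v : α → D.str} {x y : α}
    {s t : V} (hx : v x = .inl s) (hy : v y = .inl t) :
    (sbuildAdj (n := n) H x y).Realize v ↔ D.graph.Adj s t := by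
  have hp : (∃ i : Fin n, (∃ w, v x = .inl w ∧ D.part w = i) ∧ ∃ w, v y = .inl w ∧ D.part w = i) ↔
      D.part s = D.part t := by
    rw [hx, hy]
    constructor
    · rintro ⟨i, ⟨_, ⟨⟩, h⟩, ⟨_, ⟨⟩, h'⟩⟩
      exact h.trans h'.symm
    · exact fun h => ⟨_, ⟨s, rfl, h⟩, ⟨t, rfl, rfl⟩⟩
  have : (sbuildAdj (n := n) H x y).Realize v ↔ ¬ (s = t) ∧ ∃ a b : D.Carrier,
      (D.Link (.inl s) a ∨ D.Link a (.inl s)) ∧ (D.Link (.inl t) b ∨ D.Link b (.inl t)) ∧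
      ¬ (∃ w, a = .inl w) ∧ ¬ (∃ w, b = .inl w) ∧
      (D.part s = D.part t ∧ ((cotreeAdj (n := n) H (0 : Fin 2) 1).Realize (M := D.str) ![a, b] ∨
          (cotreeAdj (n := n) H (0 : Fin 2) 1).Realize (M := D.str) ![b, a]) ∨
        D.part s ≠ D.part t ∧ ((bicotreeAdj (n := n) H (0 : Fin 2) 1).Realize (M := D.str) ![a, b] ∨
          (bicotreeAdj (n := n) H (0 : Fin 2) 1).Realize (M := D.str) ![b, a])) := by
    simp only [sbuildAdj, samePart, Formula.realize_iExs, Formula.realize_inf, Formula.realize_sup,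
      Formula.realize_not, Formula.realize_iSup,
      realize_cotreeAdj hD, realize_bicotreeAdj hD, realize_un, realize_bin, realize_eq,
      Sum.elim_inr, Sum.elim_inl, and_assoc]
    refine and_congr (by rw [hx, hy]; exact not_congr Sum.inl_injective.eq_iff) ⟨?_, ?_⟩
    · rintro ⟨i, h1, h2, h3, h4, h5⟩
      refine ⟨i 0, i 1, hx ▸ h1, hy ▸ h2, h3, h4, h5.imp (And.imp hp.1 id) (And.imp ?_ id)⟩
      exact fun h h' => h (hp.2 h')
    · rintro ⟨a, b, h1, h2, h3, h4, h5⟩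
      refine ⟨![a, b], hx ▸ h1, hy ▸ h2, h3, h4, h5.imp (And.imp hp.2 id) (And.imp ?_ id)⟩
      exact fun h h' => h (hp.1 h')
  rw [this]
  simp only [link_inl, realize_cotreeAdj hD, realize_bicotreeAdj hD]
  constructor
  · rintro ⟨hst, _, _, ⟨c, hs, rfl⟩, ⟨d, ht, rfl⟩, -, -, h⟩
    rcases h with ⟨hp, h⟩ | ⟨hp, h⟩
    · rw [adj_iff_of_part_eq hp]
      rcases h with ⟨_, x, _, _, ⟨⟩, ⟨⟩, h1, h2, h3⟩ | ⟨_, x, _, _, ⟨⟩, ⟨⟩, h1, h2, h3⟩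
      all_goals
        rcases c with i | p
        · have hi := D.isPiece (.inl i)
          refine ⟨i, hs, ht, fun h => hst (congrArg Subtype.val h), ?_⟩
          first
          | exact .inl ((TModel.joins_iff_of_isCotree hi fun h =>
              hst (congrArg Subtype.val h)).2 ⟨x, h1, h3⟩)
          | exact .inr ((TModel.joins_iff_of_isCotree hi fun h =>
              hst (congrArg Subtype.val h).symm).2 ⟨x, h1, h3⟩)
        · exact (label_inl_ne_J p h2 h3).elim
    · rw [adj_iff_of_part_ne hp]
      rcases h with ⟨g1, g2, _, x, _, _, ⟨⟩, ⟨⟩, h1, h2, h3⟩ | ⟨g1, g2, _, x, _, _, ⟨⟩, ⟨⟩, h1, h2, h3⟩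
      all_goals
        rcases c with i | p
        · exact (hp (part_eq_of_mem ⟨s, hs⟩ ⟨t, ht⟩)).elim
        · have g1 := color_leaf.1 g1
          have g2 := color_leaf.1 g2
          have hi := (D.isPiece (.inr p)).1
          refine ⟨p, hs, ht, fun h => hst (congrArg Subtype.val h), ?_⟩
          first
          | exact .inl ((TModel.joins_iff_of_isBicotree hi fun h =>
              hst (congrArg Subtype.val h)).2 ⟨x, h1, h3.imp (fun h => ⟨h, by simp [g1, g2]⟩)
                fun h => ⟨h.1, g1, g2, h.2⟩⟩)
          | exact .inr ((TModel.joins_iff_of_isBicotree hi fun h =>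
              hst (congrArg Subtype.val h).symm).2 ⟨x, h1, h3.imp (fun h => ⟨h, by simp [g1, g2]⟩)
                fun h => ⟨h.1, g1, g2, h.2⟩⟩)
  · intro h
    have hst : s ≠ t := h.ne
    by_cases hp : D.part s = D.part t
    · obtain ⟨i, hs, ht, hne, h⟩ := (adj_iff_of_part_eq hp).1 h
      refine ⟨hst, _, _, ⟨.inl i, hs, rfl⟩, ⟨.inl i, ht, rfl⟩, by simp, by simp, .inl ⟨hp, ?_⟩⟩
      have hi := D.isPiece (.inl i)
      rw [TModel.joins_iff_of_isCotree hi hne, TModel.joins_iff_of_isCotree hi hne.symm] at h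
      refine h.imp ?_ ?_
      · rintro ⟨m, h1, h2⟩
        exact ⟨_, m, _, _, rfl, rfl, h1, TModel.not_isMax_of_isGLB hne h1, h2⟩
      · rintro ⟨m, h1, h2⟩
        exact ⟨_, m, _, _, rfl, rfl, h1, TModel.not_isMax_of_isGLB hne.symm h1, h2⟩
    · obtain ⟨p, hs, ht, hne, h⟩ := (adj_iff_of_part_ne hp).1 h
      refine ⟨hst, _, _, ⟨.inr p, hs, rfl⟩, ⟨.inr p, ht, rfl⟩, by simp, by simp, .inr ⟨hp, ?_⟩⟩
      have hi := (D.isPiece (.inr p)).1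
      -- The formula wants the leaf of color 0 first, whereas a B-node treats its two leaves alike.
      -- So `Joins s t` may only yield the disjunct with `s` and `t` exchanged.
      have key : ∀ {s t : pieceGround D.part (.inr p)}, s ≠ t → (D.tree (.inr p)).Joins s t →
          (D.Color 0 (.inr ⟨.inr p, (D.tree (.inr p)).leaf s⟩) ∧
            D.Color 1 (.inr ⟨.inr p, (D.tree (.inr p)).leaf t⟩) ∧ ∃ c x y z,
            (.inr ⟨.inr p, (D.tree (.inr p)).leaf s⟩ : D.Carrier) = .inr ⟨c, y⟩ ∧
            (.inr ⟨.inr p, (D.tree (.inr p)).leaf t⟩ : D.Carrier) = .inr ⟨c, z⟩ ∧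
            IsGLB {y, z} x ∧ ¬ IsMax x ∧ ((D.tree c).label x = .B ∨
              (D.tree c).label x = .O ∧ ∃ y' z', y' ≤ y ∧ z' ≤ z ∧ (D.tree c).tri y' z')) ∨
          (D.Color 0 (.inr ⟨.inr p, (D.tree (.inr p)).leaf t⟩) ∧
            D.Color 1 (.inr ⟨.inr p, (D.tree (.inr p)).leaf s⟩) ∧ ∃ c x y z,
            (.inr ⟨.inr p, (D.tree (.inr p)).leaf t⟩ : D.Carrier) = .inr ⟨c, y⟩ ∧
            (.inr ⟨.inr p, (D.tree (.inr p)).leaf s⟩ : D.Carrier) = .inr ⟨c, z⟩ ∧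
            IsGLB {y, z} x ∧ ¬ IsMax x ∧ ((D.tree c).label x = .B ∨
              (D.tree c).label x = .O ∧ ∃ y' z', y' ≤ y ∧ z' ≤ z ∧ (D.tree c).tri y' z')) := by
        intro s t hst h
        simp only [color_leaf]
        obtain ⟨m, h1, ⟨h2, h3⟩ | ⟨h2, h3, h4, h5⟩⟩ := (TModel.joins_iff_of_isBicotree hi hst).1 h
        · have : ((D.tree (.inr p)).color s = 0 ∧ (D.tree (.inr p)).color t = 1) ∨
              ((D.tree (.inr p)).color t = 0 ∧ (D.tree (.inr p)).color s = 1) := by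
            revert h3
            generalize (D.tree (.inr p)).color s = i
            generalize (D.tree (.inr p)).color t = j
            revert i j
            decide
          refine this.imp (fun h => ⟨h.1, h.2, ?_⟩) fun h => ⟨h.1, h.2, ?_⟩
          · exact ⟨_, m, _, _, rfl, rfl, h1, TModel.not_isMax_of_isGLB hst h1, .inl h2⟩
          · exact ⟨_, m, _, _, rfl, rfl, Set.pair_comm _ _ ▸ h1, TModel.not_isMax_of_isGLB hst h1,
              .inl h2⟩
        · exact .inl ⟨h3, h4, _, m, _, _, rfl, rfl, h1, TModel.not_isMax_of_isGLB hst h1,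
            .inr ⟨h2, h5⟩⟩
      rcases h with h | h
      · exact key hne h
      · exact (key hne.symm h).symm

end Amalgam

/-! ### Symmetry of the interpreted adjacency in arbitrary structures -/

namespace SBuildFormula

variable {n : ℕ} (M : FinStr (amalgLang n)) (H : ℕ)

/-- The truth of the formula depends on the values of its two variables only, whatever the type of
variables. This allows variables to be exchanged in structures that are not amalgams, where no
description by trees is at hand. -/
theorem exists_treeLE : ∃ P : M → M → Prop, ∀ {α : Type} (v : α → M) (a b : α),
    (treeLE (n := n) H a b).Realize v ↔ P (v a) (v b) := by
  refine ⟨fun x y => (treeLE (n := n) H (0 : Fin 2) 1).Realize ![x, y], fun v a b => ?_⟩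
  simp [treeLE, onRootPath]

theorem exists_isInf : ∃ P : M → M → M → Prop, ∀ {α : Type} (v : α → M) (m a b : α),
    (isInf (n := n) H m a b).Realize v ↔ P (v m) (v a) (v b) := by
  obtain ⟨P, hP⟩ := exists_treeLE M H
  refine ⟨fun x y z => (isInf (n := n) H (0 : Fin 3) 1 2).Realize ![x, y, z], fun v m a b => ?_⟩
  simp [isInf, hP]

theorem exists_cotreeAdj : ∃ P : M → M → Prop, ∀ {α : Type} (v : α → M) (a b : α),
    (cotreeAdj (n := n) H a b).Realize v ↔ P (v a) (v b) := by
  obtain ⟨P, hP⟩ := exists_isInf M H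
  refine ⟨fun x y => (cotreeAdj (n := n) H (0 : Fin 2) 1).Realize ![x, y], fun v a b => ?_⟩
  simp [cotreeAdj, hP]

theorem exists_bicotreeAdj : ∃ P : M → M → Prop, ∀ {α : Type} (v : α → M) (a b : α),
    (bicotreeAdj (n := n) H a b).Realize v ↔ P (v a) (v b) := by
  obtain ⟨P, hP⟩ := exists_isInf M H
  obtain ⟨Q, hQ⟩ := exists_treeLE M H
  refine ⟨fun x y => (bicotreeAdj (n := n) H (0 : Fin 2) 1).Realize ![x, y], fun v a b => ?_⟩
  simp [bicotreeAdj, hP, hQ]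

theorem realize_sbuildAdj_symm (x y : M)
    (h : (sbuildAdj (n := n) H (0 : Fin 2) 1).Realize ![x, y]) :
    (sbuildAdj (n := n) H (0 : Fin 2) 1).Realize ![y, x] := by
  obtain ⟨P, hP⟩ := exists_cotreeAdj M H
  obtain ⟨Q, hQ⟩ := exists_bicotreeAdj M H
  simp only [sbuildAdj, samePart, Formula.realize_inf, Formula.realize_not, realize_eq,
    Formula.realize_iExs, Formula.realize_sup, Formula.realize_iSup, hP, hQ, realize_un,
    realize_bin, Sum.elim_inl, Sum.elim_inr, Matrix.cons_val_zero, Matrix.cons_val_one] at h ⊢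
  obtain ⟨h0, i, ⟨⟨⟨h1, h2⟩, h3⟩, h4⟩, h5⟩ := h
  refine ⟨fun h => h0 h.symm, ![i 1, i 0], ⟨⟨⟨h2, h1⟩, h4⟩, h3⟩, ?_⟩
  have hs : ∀ {x y : M}, (∃ c : Fin n, Structure.RelMap (L := amalgLang n) (n := 1)
      (AmalgRel.part c) ![x] ∧ Structure.RelMap (L := amalgLang n) (n := 1) (AmalgRel.part c) ![y]) →
      ∃ c : Fin n, Structure.RelMap (L := amalgLang n) (n := 1)
      (AmalgRel.part c) ![y] ∧ Structure.RelMap (L := amalgLang n) (n := 1) (AmalgRel.part c) ![x] :=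
    fun ⟨c, h⟩ => ⟨c, h.symm⟩
  exact h5.imp (And.imp hs Or.symm) (And.imp (fun h h' => h (hs h')) Or.symm)

end SBuildFormula

theorem SBuild_simpleGraph (n H : ℕ) (M : FinStr (amalgLang n)) :
    ((SBuild n H).apply M) ⊨ Theory.simpleGraph := by
  have key : ∀ x y : (SBuild n H).apply M,
      Structure.RelMap (L := FirstOrder.Language.graph) adj ![x, y] ↔
        (SBuildFormula.sbuildAdj (n := n) H (0 : Fin 2) 1).Realize ![x.1, y.1] := fun x y => by
    refine iff_of_eq ?_
    change (SBuildFormula.sbuildAdj (n := n) H (0 : Fin 2) 1).Realize _ = _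
    congr 1
    funext i
    fin_cases i <;> rfl
  rw [Theory.simpleGraph_model_iff]
  refine ⟨⟨fun x h => ?_⟩, ⟨fun x y h => ?_⟩⟩
  · have h := (key x x).1 h
    simp [SBuildFormula.sbuildAdj] at h
  · exact (key y x).2 (SBuildFormula.realize_sbuildAdj_symm M H x.1 y.1 ((key x y).1 h))

theorem SBuild_domain (n H : ℕ) (M : FinStr (amalgLang n)) :
    (SBuild n H).domain M =
      {a | Structure.RelMap (L := amalgLang n) (n := 1) AmalgRel.ground ![a]} :=
  Set.ext fun _ => SBuildFormula.realize_un _ _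

namespace Amalgam

variable {n : ℕ} {V : Type} [Finite V] {D : Amalgam n V}

theorem mem_domain (H : ℕ) {x : D.Carrier} :
    (x : D.str) ∈ (SBuild n H).domain D.str ↔ ∃ v, x = .inl v := by
  rw [SBuild_domain]
  rfl

theorem realize_rel_adj {H : ℕ} (hD : D.HeightLE H) (s t : V) :
    ((SBuild n H).rel adj).Realize (M := D.str) ![.inl s, .inl t] ↔ D.graph.Adj s t :=
  realize_sbuildAdj hD rfl rfl

theorem relMap_adj {H : ℕ} (hD : D.HeightLE H) {x y : (SBuild n H).apply D.str} {s t : V}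
    (hx : x.1 = .inl s) (hy : y.1 = .inl t) :
    Structure.RelMap (L := FirstOrder.Language.graph) adj ![x, y] ↔ D.graph.Adj s t :=
  realize_sbuildAdj hD hx hy

/-- Models of `G` among the amalgams are given by isomorphisms. -/
theorem exists_equiv_of_modelIso {H : ℕ} (hD : D.HeightLE H) {G : FinGraph}
    (e : ModelIso (SBuild n H) G D.str) : ∃ ε : G.V ≃ V,
      (∀ v, (e v : (SBuild n H).domain D.str).1 = .inl (ε v)) ∧
      ∀ v w, D.graph.Adj (ε v) (ε w) ↔ G.graph.Adj v w := by
  choose f hf using fun v => (mem_domain H).1 (e v : (SBuild n H).domain D.str).2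
  have hf : ∀ v, (e v : (SBuild n H).domain D.str).1 = .inl (f v) := hf
  refine ⟨.ofBijective f ⟨fun v w h => ?_, fun w => ?_⟩, hf, fun v w => ?_⟩
  · apply e.injective
    apply Subtype.ext
    exact (hf v).trans ((congrArg Sum.inl h).trans (hf w).symm)
  · obtain ⟨v, hv⟩ := e.surjective (⟨.inl w, (mem_domain H).2 ⟨w, rfl⟩⟩ : (SBuild n H).domain D.str)
    refine ⟨v, Sum.inl_injective (β := Σ a, (D.tree a).Node) ?_⟩
    refine (hf v).symm.trans ?_
    rw [hv]
  · have h1 := e.map_rel adj ![v, w]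
    have h2 : Structure.RelMap (L := FirstOrder.Language.graph) (M := G.str) adj ![v, w] ↔
      G.graph.Adj v w := Iff.rfl
    rw [h2] at h1
    refine (relMap_adj (x := e v) (y := e w) hD (hf v) (hf w)).symm.trans (Iff.trans ?_ h1)
    refine iff_of_eq (congrArg _ (funext fun i => ?_))
    fin_cases i <;> rfl

theorem exists_modelIso {H : ℕ} {V : Type} [Finite V] {D : Amalgam n V} (hD : D.HeightLE H) :
    Nonempty (ModelIso (SBuild n H) ⟨V, D.graph⟩ D.str) := by
  let f : V → (SBuild n H).apply D.str := fun v => ⟨.inl v, (mem_domain H).2 ⟨v, rfl⟩⟩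
  have hf : Function.Bijective f := by
    refine ⟨fun v w h => Sum.inl_injective (congrArg Subtype.val h), fun ⟨x, hx⟩ => ?_⟩
    obtain ⟨v, rfl⟩ := (mem_domain H).1 hx
    exact ⟨v, rfl⟩
  refine ⟨⟨.ofBijective f hf, fun {k} g => isEmptyElim g, ?_⟩⟩
  rintro _ ⟨⟩ x
  refine Iff.trans ?_ (relMap_adj (x := f (x 0)) (y := f (x 1)) hD rfl rfl)
  refine iff_of_eq (congrArg _ (funext fun i => ?_))
  fin_cases i <;> rfl

end Amalgam

/-! ### Restrictions -/

namespace TModel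

variable {S S' : Type} {T : TModel S} (f : S' ↪ S)

/-- The restriction keeps a downset of the tree, which contains all lower bounds of its elements. -/
theorem isGLB_restrict {x y m : (T.restrict f).Node} : IsGLB {x, y} m ↔ IsGLB {x.1, y.1} m.1 := by
  obtain ⟨s, hs⟩ := x.2
  constructor
  · intro h
    refine ⟨by
      have h1 : m ≤ x := h.1 (by simp)
      have h2 : m ≤ y := h.1 (by simp)
      have h1 : m.1 ≤ x.1 := h1
      have h2 : m.1 ≤ y.1 := h2
      simp [lowerBounds, h1, h2], fun z hz => ?_⟩
    have hz : z ≤ x.1 ∧ z ≤ y.1 := by simpa [lowerBounds] using hz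
    let z' : (T.restrict f).Node := ⟨z, s, hz.1.trans hs⟩
    have h1 : z' ≤ x := hz.1
    have h2 : z' ≤ y := hz.2
    exact h.2 (by simp [lowerBounds, h1, h2] : z' ∈ lowerBounds {x, y})
  · intro h
    have h1 : m.1 ≤ x.1 := h.1 (by simp)
    have h2 : m.1 ≤ y.1 := h.1 (by simp)
    have h1 : m ≤ x := h1
    have h2 : m ≤ y := h2
    refine ⟨by simp [lowerBounds, h1, h2], fun z hz => ?_⟩
    have hz : z ≤ x ∧ z ≤ y := by simpa [lowerBounds] using hz
    have h3 : z.1 ≤ x.1 := hz.1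
    have h4 : z.1 ≤ y.1 := hz.2
    exact h.2 (by simp [lowerBounds, h3, h4] : z.1 ∈ lowerBounds {x.1, y.1})

theorem joins_restrict (s t : S') : (T.restrict f).Joins s t ↔ T.Joins (f s) (f t) := by
  constructor
  · rintro ⟨m, h1, h2, h3⟩
    refine ⟨m.1, (isGLB_restrict f).1 h1, fun h => ?_, h3⟩
    obtain ⟨a, b, h4, h5, h6, h7, h8⟩ := h2 h
    exact ⟨a.1, b.1, (T.below_covBy f _ _).1 h4, h5, (T.below_covBy f _ _).1 h6, h7, h8⟩
  · rintro ⟨m, h1, h2, h3⟩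
    have hm : m ≤ T.leaf (f s) := h1.1 (by simp)
    let m' : (T.restrict f).Node := ⟨m, s, hm⟩
    refine ⟨m', (isGLB_restrict f).2 h1, fun h => ?_, h3⟩
    obtain ⟨a, b, h4, h5, h6, h7, h8⟩ := h2 h
    let a' : (T.restrict f).Node := ⟨a, s, h5⟩
    let b' : (T.restrict f).Node := ⟨b, t, h7⟩
    exact ⟨a', b', (T.below_covBy f m' a').2 h4, h5, (T.below_covBy f m' b').2 h6, h7, h8⟩

theorem graph_restrict : (T.restrict f).graph = T.graph.comap f := by
  ext s t
  simp only [graph, SimpleGraph.comap_adj, joins_restrict, f.injective.ne_iff]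

theorem HeightLE.restrict {h : ℕ} (hT : T.HeightLE h) : (T.restrict f).HeightLE h := by
  intro x
  refine le_trans ?_ (hT x.1)
  exact Set.ncard_le_ncard_of_injOn (fun y : T.Below f => y.1) (fun y hy => hy)
    (fun _ _ _ _ h => Subtype.ext h) (Set.toFinite _)

/-- Every node of the restriction lies below a kept leaf, so an internal node of the tree cannot
become a leaf. -/
theorem isMax_restrict {x : (T.restrict f).Node} : IsMax x ↔ IsMax x.1 := by
  refine ⟨fun h => ?_, fun h y hy => h hy⟩
  obtain ⟨s, hs⟩ := (T.restrict f).exists_eq_leaf h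
  rw [← hs]
  exact T.isMax_leaf _

end TModel

namespace Amalgam

variable {n : ℕ} {V : Type} {D : Amalgam n V}

theorem HeightLE.restrict {H : ℕ} (hD : D.HeightLE H) (X : Set V) : (D.restrict X).HeightLE H :=
  fun a => (hD a).restrict _

theorem graph_restrict (X : Set V) (s t : X) : (D.restrict X).graph.Adj s t ↔ D.graph.Adj s t := by
  refine exists_congr fun a => exists_congr fun hs => exists_congr fun ht => ?_
  have : ((D.restrict X).tree a).graph = _ := TModel.graph_restrict (D.groundIncl X a)
  rw [this]
  rfl

theorem restrictIncl_injective (X : Set V) : Function.Injective (D.restrictIncl X) := by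
  rintro (v | ⟨a, x⟩) (w | ⟨b, y⟩) h
  · exact congrArg Sum.inl (Subtype.ext (Sum.inl_injective h))
  · cases h
  · cases h
  · have h : (Sum.inr ⟨a, x.1⟩ : D.Carrier) = .inr ⟨b, y.1⟩ := h
    obtain ⟨rfl, h⟩ := Sigma.mk.inj (Sum.inr_injective h)
    rw [Subtype.ext (eq_of_heq h)]

theorem link_restrict (X : Set V) (x y : (D.restrict X).Carrier) :
    D.Link (D.restrictIncl X x) (D.restrictIncl X y) ↔ (D.restrict X).Link x y := by
  constructor
  · intro h
    rcases x with v | ⟨a, x⟩ <;> rcases y with w | ⟨b, y⟩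
    · have h : D.Link (.inl v.1) (.inl w.1) := h
      generalize v.1 = v', w.1 = w' at h
      cases h
    · have h : D.Link (.inl v.1) (.inr ⟨b, y.1⟩) := h
      obtain ⟨c, hc, h⟩ := link_inl.1 (.inl h)
      obtain ⟨rfl, h⟩ := Sigma.mk.inj (Sum.inr_injective h)
      have hv : v ∈ pieceGround (D.restrict X).part b := hc
      have : y = ((D.restrict X).tree b).leaf ⟨v, hv⟩ := Subtype.ext (eq_of_heq h)
      rw [this]
      exact .leaf b ⟨v, hv⟩
    · cases h
    · have h : D.Link (.inr ⟨a, x.1⟩) (.inr ⟨b, y.1⟩) := h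
      obtain ⟨rfl, h⟩ := link_inr.1 h
      exact .tree a x y ((TModel.below_covBy _ _ x y).2 h)
  · rintro (⟨a, x, y, h⟩ | ⟨a, v⟩)
    · exact .tree a _ _ ((TModel.below_covBy _ _ x y).1 h)
    · exact .leaf a ⟨v.1.1, v.2⟩

theorem tri_restrict (X : Set V) (x y : (D.restrict X).Carrier) :
    D.Tri (D.restrictIncl X x) (D.restrictIncl X y) ↔ (D.restrict X).Tri x y := by
  constructor
  · intro h
    rcases x with v | ⟨a, x⟩ <;> rcases y with w | ⟨b, y⟩
    · cases h
    · cases h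
    · cases h
    · have h : D.Tri (.inr ⟨a, x.1⟩) (.inr ⟨b, y.1⟩) := h
      have : a = b := by
        generalize y.1 = y' at h
        cases h
        rfl
      subst this
      exact .mk a x y ((tri_inr (D := D) (x := x.1) (y := y.1)).1 h)
  · rintro ⟨a, x, y, h⟩
    exact .mk a _ _ h

/-- The root of a tree lies below every kept leaf, so the least node of a nonempty restriction is
the old root. -/
theorem root_restrict (X : Set V) (x : (D.restrict X).Carrier) :
    D.Root (D.restrictIncl X x) ↔ (D.restrict X).Root x := by
  constructor
  · intro h
    rcases x with v | ⟨a, x⟩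
    · cases h
    · refine .mk a x fun y => ?_
      have h : D.Root (.inr ⟨a, x.1⟩) := h
      cases h with
      | mk a _ h => exact h y.1
  · rintro ⟨a, x, h⟩
    refine .mk a x.1 fun y => ?_
    obtain ⟨m, h1, h2⟩ := (D.tree a).connected x.1 y
    obtain ⟨s, hs⟩ := x.2
    have : x ≤ (⟨m, s, h1.trans hs⟩ : ((D.restrict X).tree a).Node) := h _
    exact le_trans (b := m) this h2

theorem color_restrict (X : Set V) (c : Fin 2) (x : (D.restrict X).Carrier) :
    D.Color c (D.restrictIncl X x) ↔ (D.restrict X).Color c x := by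
  constructor
  · intro h
    rcases x with v | ⟨a, x⟩
    · cases h
    · have h : D.Color c (.inr ⟨a, x.1⟩) := h
      have hx : IsMax x.1 := by
        generalize x.1 = z at h
        cases h
        exact TModel.isMax_leaf _ _
      obtain ⟨s, rfl⟩ := ((D.restrict X).tree a).exists_eq_leaf
        ((TModel.isMax_restrict (D.groundIncl X a)).2 hx)
      exact color_leaf.2 ((color_leaf (D := D) (s := D.groundIncl X a s)).1 h)
  · rintro ⟨a, v, h⟩
    exact .mk a (D.groundIncl X a v) h

theorem label_restrict (X : Set V) (l : NodeLabel) (x : (D.restrict X).Carrier) :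
    D.Label l (D.restrictIncl X x) ↔ (D.restrict X).Label l x := by
  rcases x with v | ⟨a, x⟩
  · exact ⟨fun h => (nomatch h), fun h => (nomatch h)⟩
  · refine Iff.trans (label_inr (D := D) (x := x.1)) (Iff.trans ?_ label_inr.symm)
    exact and_congr_left' (not_congr (TModel.isMax_restrict (D.groundIncl X a)).symm)

/-- The parameter `p` serves to treat the ground predicate and the predicates of the parts at the
same time. -/
theorem ground_restrict (X : Set V) (x : (D.restrict X).Carrier) (p : Fin n → Prop) :
    (∃ v, D.restrictIncl X x = .inl v ∧ p (D.part v)) ↔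
      ∃ v, x = .inl v ∧ p ((D.restrict X).part v) := by
  constructor
  · rintro ⟨v, h, hp⟩
    rcases x with w | ⟨a, x⟩
    · obtain rfl : w.1 = v := Sum.inl_injective h
      exact ⟨w, rfl, hp⟩
    · cases h
  · rintro ⟨v, rfl, hp⟩
    exact ⟨v.1, rfl, hp⟩

variable [Finite V]

theorem exists_restrictEmbedding (X : Set V) : ∃ ι : (D.restrict X).str ↪[amalgLang n] D.str,
    ⇑ι = D.restrictIncl X := by
  refine ⟨⟨⟨D.restrictIncl X, restrictIncl_injective X⟩, fun {k} g => isEmptyElim g, ?_⟩, rfl⟩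
  rintro _ (_ | _ | _ | _ | i | c | l) x
  · exact or_congr (link_restrict X _ _) (link_restrict X _ _)
  · exact tri_restrict X _ _
  · exact root_restrict X _
  · have := ground_restrict (D := D) X (x 0) fun _ => True
    simp only [and_true] at this
    exact this
  · exact ground_restrict X _ fun j => j = i
  · exact color_restrict X c _
  · exact label_restrict X l _

theorem isModelRestriction {H : ℕ} (hD : D.HeightLE H) (X : Set V)
    (ι : (D.restrict X).str ↪[amalgLang n] D.str) (hι : ⇑ι = D.restrictIncl X) :
    IsModelRestriction (SBuild n H) (M := D.str) (Sum.inl '' X) ι := by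
  rw [IsModelRestriction, hι]
  constructor
  · ext x
    constructor
    · rintro ⟨y, hy, rfl⟩
      obtain ⟨v, rfl⟩ := (mem_domain H).1 hy
      exact ⟨⟨v.1, v.2, rfl⟩, (mem_domain H).2 ⟨v.1, rfl⟩⟩
    · rintro ⟨⟨v, hv, rfl⟩, -⟩
      exact ⟨.inl ⟨v, hv⟩, (mem_domain H).2 ⟨_, rfl⟩, rfl⟩
  · intro a ha b hb
    obtain ⟨v, rfl⟩ := (mem_domain H).1 ha
    obtain ⟨w, rfl⟩ := (mem_domain H).1 hb
    exact (realize_rel_adj (hD.restrict X) v w).trans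
      ((graph_restrict X v w).trans (realize_rel_adj hD v.1 w.1).symm)

end Amalgam

/-! ### Amalgams with their tree-orders -/

instance : Finite NodeLabel :=
  Finite.of_surjective (![.U, .J, .B, .O] : Fin 4 → NodeLabel) fun l =>
    match l with
    | .U => ⟨0, rfl⟩
    | .J => ⟨1, rfl⟩
    | .B => ⟨2, rfl⟩
    | .O => ⟨3, rfl⟩

/-- Unary symbols for amalgams in which the pieces are marked. -/
inductive FlatUn (n : ℕ)
  | ground
  | part (i : Fin n)
  | piece (a : PieceIdx n)
  | label (l : NodeLabel)

instance (n : ℕ) : Finite (FlatUn n) :=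
  Finite.of_surjective (α := Unit ⊕ Fin n ⊕ PieceIdx n ⊕ NodeLabel)
    (Sum.elim (fun _ => .ground) (Sum.elim .part (Sum.elim .piece .label))) fun r =>
    match r with
    | .ground => ⟨.inl (), rfl⟩
    | .part i => ⟨.inr (.inl i), rfl⟩
    | .piece a => ⟨.inr (.inr (.inl a)), rfl⟩
    | .label l => ⟨.inr (.inr (.inr l)), rfl⟩

/-- Binary symbols for amalgams with tree-orders: the order, the relation between the elements of
the ground and their leaves, the order of the children. -/
inductive FlatBin
  | le
  | leaf
  | tri

instance : Finite FlatBin :=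
  Finite.of_surjective (![.le, .leaf, .tri] : Fin 3 → FlatBin) fun r =>
    match r with
    | .le => ⟨0, rfl⟩
    | .leaf => ⟨1, rfl⟩
    | .tri => ⟨2, rfl⟩

abbrev flatLang (n : ℕ) : FirstOrder.Language.{0, 0} := binLang (FlatUn n) FlatBin

instance (n : ℕ) : Finite (Σ k, (amalgLang n).Relations k) :=
  Finite.of_surjective (α := (Bool ⊕ Bool) ⊕ Fin n ⊕ Fin 2 ⊕ NodeLabel)
    (Sum.elim (Sum.elim (fun b => ⟨2, cond b AmalgRel.edge AmalgRel.tri⟩)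
        fun b => ⟨1, cond b AmalgRel.root AmalgRel.ground⟩)
      (Sum.elim (fun i => ⟨1, AmalgRel.part i⟩)
        (Sum.elim (fun c => ⟨1, AmalgRel.color c⟩) fun l => ⟨1, AmalgRel.label l⟩))) fun r =>
    match r with
    | ⟨_, .edge⟩ => ⟨.inl (.inl true), rfl⟩
    | ⟨_, .tri⟩ => ⟨.inl (.inl false), rfl⟩
    | ⟨_, .root⟩ => ⟨.inl (.inr true), rfl⟩
    | ⟨_, .ground⟩ => ⟨.inl (.inr false), rfl⟩
    | ⟨_, .part i⟩ => ⟨.inr (.inl i), rfl⟩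
    | ⟨_, .color c⟩ => ⟨.inr (.inr (.inl c)), rfl⟩
    | ⟨_, .label l⟩ => ⟨.inr (.inr (.inr l)), rfl⟩

/-! ### First-order axioms for amalgams with tree-orders -/

namespace Flat

variable {n : ℕ} (M : FinStr (flatLang n))

def Internal (x : M) : Prop := ∃ y, M.bin .le x y ∧ x ≠ y

def Cov (x y : M) : Prop :=
  M.bin .le x y ∧ x ≠ y ∧ ∀ z, M.bin .le x z → M.bin .le z y → z = x ∨ z = y

def Edge (x y : M) : Prop := Cov M x y ∨ Cov M y x ∨ M.bin .leaf x y ∨ M.bin .leaf y x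

def Root (x : M) : Prop :=
  (∃ a, M.un (.piece a) x) ∧ ∀ y, ∀ a, M.un (.piece a) x → M.un (.piece a) y → M.bin .le x y

def ColorOf (c : Fin 2) : PieceIdx n → M → Prop
  | .inl _, _ => c = 0
  | .inr p, v => c = 0 ↔ M.un (.part p.1.1) v

def Color (c : Fin 2) (x : M) : Prop :=
  ∃ v, M.bin .leaf v x ∧ ∃ a, M.un (.piece a) x ∧ ColorOf M c a v

instance : FODef₁ (Internal (n := n)) := ⟨by unfold Internal; infer_instance⟩

instance : FODef₂ (Cov (n := n)) := ⟨by unfold Cov; infer_instance⟩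

instance : FODef₂ (Edge (n := n)) := ⟨by unfold Edge; infer_instance⟩

instance : FODef₁ (Root (n := n)) := ⟨by unfold Root; infer_instance⟩

instance (c : Fin 2) (a : PieceIdx n) : FODef₁ fun M => ColorOf M c a := by
  cases a <;> exact ⟨by unfold ColorOf; infer_instance⟩

instance (c : Fin 2) : FODef₁ fun (M : FinStr (flatLang n)) => Color M c := ⟨by
  unfold Color
  have : ∀ a, FODef fun (M : FinStr (flatLang n)) (w : Option (Fin 1) → M) =>
      ColorOf M c a (w none) := fun a => FODef.app₁ (P := fun M => ColorOf M c a) none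
  infer_instance⟩

/-- The labels of the internal nodes of cotrees and bicotrees. -/
def LabelOK (x : M) : PieceIdx n → Prop
  | .inl _ => M.un (.label .U) x ∨ M.un (.label .J) x
  | .inr _ => M.un (.label .U) x ∨ M.un (.label .B) x ∨ M.un (.label .O) x

instance (a : PieceIdx n) : FODef₁ fun (M : FinStr (flatLang n)) x => LabelOK M x a := by
  cases a <;> exact ⟨by unfold LabelOK; infer_instance⟩

/-- This axiom and the following ones are first-order, so that an interpretation can test them on
the outcome of an arbitrary coloring. Here the structure is split into a partitioned ground and
disjoint pieces. -/
def GroundOK : Prop :=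
  (∀ x, M.un .ground x ∨ ∃ a, M.un (.piece a) x) ∧
  (∀ x a, M.un (.piece a) x → ¬ M.un .ground x) ∧
  (∀ x a b, M.un (.piece a) x → M.un (.piece b) x → a = b) ∧
  (∀ x, M.un .ground x → ∃ i, M.un (.part i) x) ∧
  (∀ x i, M.un (.part i) x → M.un .ground x) ∧
  (∀ x i j, M.un (.part i) x → M.un (.part j) x → i = j)

/-- Each piece is a tree for the relation `le`. The last clause bounds the height, by forbidding `H
+ 1` distinct nodes below a node. -/
def OrderOK (H : ℕ) : Prop :=
  (∀ x y, M.bin .le x y → ∃ a, M.un (.piece a) x ∧ M.un (.piece a) y) ∧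
  (∀ x a, M.un (.piece a) x → M.bin .le x x) ∧
  (∀ x y, M.bin .le x y → M.bin .le y x → x = y) ∧
  (∀ x y z, M.bin .le x y → M.bin .le y z → M.bin .le x z) ∧
  (∀ x y z, M.bin .le x z → M.bin .le y z → M.bin .le x y ∨ M.bin .le y x) ∧
  (∀ x y a, M.un (.piece a) x → M.un (.piece a) y → ∃ z, M.bin .le z x ∧ M.bin .le z y) ∧
  (∀ x, ¬ ∃ f : Fin (H + 1) → M, (∀ i, M.bin .le (f i) x) ∧ ∀ i j, i ≠ j → f i ≠ f j)

/-- The O-nodes take the place of the set `C` of ordered nodes, for which the signature has no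
symbol. -/
def TriOK : Prop :=
  (∀ x, ¬ M.bin .tri x x) ∧
  (∀ x y z, M.bin .tri x y → M.bin .tri y z → M.bin .tri x z) ∧
  (∀ x y, x ≠ y → ((M.bin .tri x y ∨ M.bin .tri y x) ↔
    ∃ p, M.un (.label .O) p ∧ Cov M p x ∧ Cov M p y))

/-- For each piece, `leaf` has to be a bijection from the vertices in the parts of this piece onto
its nodes that are not internal. -/
def LeafOK : Prop :=
  (∀ v x, M.bin .leaf v x → ∃ a i, a.Has i ∧ M.un (.part i) v ∧ M.un (.piece a) x) ∧
  (∀ v i a, M.un (.part i) v → a.Has i → ∃ x, M.un (.piece a) x ∧ M.bin .leaf v x) ∧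
  (∀ v x y a, M.bin .leaf v x → M.bin .leaf v y → M.un (.piece a) x → M.un (.piece a) y → x = y) ∧
  (∀ v w x, M.bin .leaf v x → M.bin .leaf w x → v = w) ∧
  (∀ v x, M.bin .leaf v x → ¬ Internal M x) ∧
  (∀ x a, M.un (.piece a) x → ¬ Internal M x → ∃ v, M.bin .leaf v x)

def LabelsOK : Prop :=
  (∀ x l, M.un (.label l) x → Internal M x) ∧
  (∀ x l l', M.un (.label l) x → M.un (.label l') x → l = l') ∧
  (∀ x a, Internal M x → M.un (.piece a) x → LabelOK M x a)

/-- The structure is obtained from an amalgam of height at most `H`. -/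
def Good (H : ℕ) : Prop := GroundOK M ∧ OrderOK M H ∧ TriOK M ∧ LeafOK M ∧ LabelsOK M

theorem foDef_groundOK {α : Type} :
    FODef (α := α) fun (M : FinStr (flatLang n)) _ => GroundOK M := by
  unfold GroundOK; infer_instance

theorem foDef_orderOK {α : Type} (H : ℕ) :
    FODef (α := α) fun (M : FinStr (flatLang n)) _ => OrderOK M H := by
  unfold OrderOK
  infer_instance

theorem foDef_triOK {α : Type} :
    FODef (α := α) fun (M : FinStr (flatLang n)) _ => TriOK M := by
  unfold TriOK
  infer_instance

theorem foDef_leafOK {α : Type} :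
    FODef (α := α) fun (M : FinStr (flatLang n)) _ => LeafOK M := by
  unfold LeafOK
  infer_instance

theorem foDef_labelsOK {α : Type} :
    FODef (α := α) fun (M : FinStr (flatLang n)) _ => LabelsOK M := by
  unfold LabelsOK
  have : ∀ a, FODef fun (M : FinStr (flatLang n)) (w : Option α → M) => LabelOK M (w none) a :=
    fun a => FODef.app₁ (P := fun M x => LabelOK M x a) none
  infer_instance

instance (H : ℕ) : FODef₁ fun (M : FinStr (flatLang n)) _ => Good M H := ⟨by
  unfold Good
  have h1 := foDef_groundOK (n := n) (α := Fin 1)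
  have h2 := foDef_orderOK (n := n) (α := Fin 1) H
  have h3 := foDef_triOK (n := n) (α := Fin 1)
  have h4 := foDef_leafOK (n := n) (α := Fin 1)
  have h5 := foDef_labelsOK (n := n) (α := Fin 1)
  infer_instance⟩

/-- The relations of an amalgam, defined in the structure with tree-orders. -/
def Rel : ∀ k, (amalgLang n).Relations k → ∀ M : FinStr (flatLang n), (Fin k → M) → Prop
  | _, .edge, M, x => Edge M (x 0) (x 1)
  | _, .tri, M, x => M.bin .tri (x 0) (x 1)
  | _, .root, M, x => Root M (x 0)
  | _, .ground, M, x => M.un .ground (x 0)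
  | _, .part i, M, x => M.un (.part i) (x 0)
  | _, .color c, M, x => Color M c (x 0)
  | _, .label l, M, x => M.un (.label l) (x 0)

theorem foDef_rel : ∀ k (R : (amalgLang n).Relations k), FODef (Rel k R)
  | _, .edge => FODef.app₂ (P := Edge) 0 1
  | _, .tri => FODef.bin FlatBin.tri 0 1
  | _, .root => FODef.app₁ (P := Root) 0
  | _, .ground => FODef.un FlatUn.ground 0
  | _, .part i => FODef.un (FlatUn.part i) 0
  | _, .color c => FODef.app₁ (P := fun M => Color M c) 0
  | _, .label l => FODef.un (FlatUn.label l) 0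

end Flat

/-! ### Amalgams satisfy the axioms -/

namespace Amalgam

variable {n : ℕ} {V : Type} [Finite V] (D : Amalgam n V)

inductive LeafOf : D.Carrier → D.Carrier → Prop
  | mk (a : PieceIdx n) (v : pieceGround D.part a) :
      LeafOf (.inl v.1) (.inr ⟨a, (D.tree a).leaf v⟩)

/-- An amalgam as a structure with tree-orders. -/
def flat : FinStr (flatLang n) :=
  binStr D.Carrier
    (fun r x => match r with
      | .ground => ∃ v, x = .inl v
      | .part i => ∃ v, x = .inl v ∧ D.part v = i
      | .piece a => ∃ y, x = .inr ⟨a, y⟩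
      | .label l => D.Label l x)
    (fun r => match r with
      | .le => D.LE
      | .leaf => D.LeafOf
      | .tri => D.Tri)

variable {D}

theorem flat_le {x y : D.Carrier} : D.flat.bin .le x y ↔ D.LE x y := Iff.rfl
theorem flat_leaf {x y : D.Carrier} : D.flat.bin .leaf x y ↔ D.LeafOf x y := Iff.rfl
theorem flat_tri {x y : D.Carrier} : D.flat.bin .tri x y ↔ D.Tri x y := Iff.rfl
theorem flat_ground {x : D.Carrier} : D.flat.un .ground x ↔ ∃ v, x = .inl v := Iff.rfl
theorem flat_part {i : Fin n} {x : D.Carrier} :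
    D.flat.un (.part i) x ↔ ∃ v, x = .inl v ∧ D.part v = i := Iff.rfl
theorem flat_piece {a : PieceIdx n} {x : D.Carrier} :
    D.flat.un (.piece a) x ↔ ∃ y, x = .inr ⟨a, y⟩ := Iff.rfl
theorem flat_label {l : NodeLabel} {x : D.Carrier} :
    D.flat.un (.label l) x ↔ D.Label l x := Iff.rfl

theorem flat_le_iff {x y : D.Carrier} : D.flat.bin .le x y ↔
    ∃ a x' y', x = .inr ⟨a, x'⟩ ∧ y = .inr ⟨a, y'⟩ ∧ x' ≤ y' :=
  ⟨fun h => by cases flat_le.1 h; exact ⟨_, _, _, rfl, rfl, ‹_›⟩,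
    fun ⟨a, x, y, hx, hy, h⟩ => by subst hx hy; exact .mk a x y h⟩

theorem flat_tri_iff {x y : D.Carrier} : D.flat.bin .tri x y ↔
    ∃ a x' y', x = .inr ⟨a, x'⟩ ∧ y = .inr ⟨a, y'⟩ ∧ (D.tree a).tri x' y' :=
  ⟨fun h => by cases flat_tri.1 h; exact ⟨_, _, _, rfl, rfl, ‹_›⟩,
    fun ⟨a, x, y, hx, hy, h⟩ => by subst hx hy; exact .mk a x y h⟩

theorem flat_leaf_iff {x y : D.Carrier} : D.flat.bin .leaf x y ↔
    ∃ a, ∃ v : pieceGround D.part a, x = .inl v.1 ∧ y = .inr ⟨a, (D.tree a).leaf v⟩ :=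
  ⟨fun h => by cases flat_leaf.1 h; exact ⟨_, _, rfl, rfl⟩,
    fun ⟨a, v, hx, hy⟩ => by subst hx hy; exact .mk a v⟩

theorem flat_le_inr {a : PieceIdx n} {x y : (D.tree a).Node} :
    D.flat.bin .le (.inr ⟨a, x⟩ : D.Carrier) (.inr ⟨a, y⟩ : D.Carrier) ↔ x ≤ y := le_inr

theorem flat_tri_inr {a : PieceIdx n} {x y : (D.tree a).Node} :
    D.flat.bin .tri (.inr ⟨a, x⟩ : D.Carrier) (.inr ⟨a, y⟩ : D.Carrier) ↔ (D.tree a).tri x y :=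
  tri_inr

theorem flat_label_inr {l : NodeLabel} {a : PieceIdx n} {x : (D.tree a).Node} :
    D.flat.un (.label l) (.inr ⟨a, x⟩ : D.Carrier) ↔ ¬ IsMax x ∧ (D.tree a).label x = l :=
  label_inr

omit [Finite V] in
theorem inr_injective {a : PieceIdx n} {x y : (D.tree a).Node}
    (h : (.inr ⟨a, x⟩ : D.Carrier) = .inr ⟨a, y⟩) : x = y := by
  cases h
  rfl

theorem flat_internal {a : PieceIdx n} {x : (D.tree a).Node} :
    Flat.Internal D.flat (.inr ⟨a, x⟩ : D.Carrier) ↔ ¬ IsMax x := by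
  constructor
  · rintro ⟨y, h, hne⟩ hx
    replace h := flat_le_iff.1 h
    obtain ⟨_, _, y, ⟨⟩, rfl, h⟩ := h
    obtain rfl := le_antisymm h (hx h)
    exact hne rfl
  · intro h
    obtain ⟨y, hy⟩ := not_isMax_iff.1 h
    exact ⟨.inr ⟨a, y⟩, .mk a x y hy.le, fun h => hy.ne (inr_injective h)⟩

theorem flat_cov {x y : D.Carrier} : Flat.Cov D.flat x y ↔
    ∃ a x' y', x = .inr ⟨a, x'⟩ ∧ y = .inr ⟨a, y'⟩ ∧ x' ⋖ y' := by
  constructor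
  · rintro ⟨h1, h2, h3⟩
    replace h1 := flat_le_iff.1 h1
    obtain ⟨a, x, y, rfl, rfl, h1⟩ := h1
    refine ⟨a, x, y, rfl, rfl, lt_of_le_of_ne h1 fun h => h2 (by rw [h]), fun z hz hz' => ?_⟩
    rcases h3 (.inr ⟨a, z⟩ : D.Carrier) (.mk _ _ _ hz.le) (.mk _ _ _ hz'.le) with h | h
    · exact hz.ne' (inr_injective h)
    · exact hz'.ne (inr_injective h)
  · rintro ⟨a, x, y, rfl, rfl, h⟩
    refine ⟨.mk a x y h.le, fun h' => h.ne (inr_injective h'), fun z hz hz' => ?_⟩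
    replace hz := flat_le_iff.1 hz
    obtain ⟨_, _, z, ⟨⟩, rfl, hz⟩ := hz
    have hz' := flat_le_inr.1 hz'
    rcases hz.lt_or_eq with h1 | rfl
    · rcases hz'.lt_or_eq with h2 | rfl
      · exact (h.2 h1 h2).elim
      · exact .inr rfl
    · exact .inl rfl

omit [Finite V] in
-- Cotrees have no ordered nodes, and in bicotrees these are exactly the O-nodes; thus labels alone
-- determine `C`.
theorem mem_C_iff (a : PieceIdx n) (x : (D.tree a).Node) :
    x ∈ (D.tree a).C ↔ D.Label .O (.inr ⟨a, x⟩) := by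
  rw [label_inr]
  have h := D.isPiece a
  cases a with
  | inl i =>
    rw [h.1]
    refine iff_of_false id fun ⟨hx, h'⟩ => ?_
    rcases h.2.2 x hx with h | h <;> simp [h'] at h
  | inr p =>
    constructor
    · intro hx
      have hm := (D.tree _).C_internal x hx
      rcases h.1 x hm with ⟨h, -⟩ | ⟨h, -⟩ | ⟨-, h⟩
      exacts [(h hx).elim, (h hx).elim, ⟨hm, h⟩]
    · rintro ⟨hm, hx⟩
      rcases h.1 x hm with ⟨-, h⟩ | ⟨-, h⟩ | ⟨h, -⟩
      · simp [hx] at h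
      · simp [hx] at h
      · exact h

theorem colorOf_iff (c : Fin 2) (a : PieceIdx n) (v : pieceGround D.part a) :
    Flat.ColorOf D.flat c a (.inl v.1 : D.Carrier) ↔ (D.tree a).color v = c := by
  have h := D.isPiece a
  cases a with
  | inl i => rw [h.2.1 v]; exact eq_comm
  | inr p =>
    have h1 : D.flat.un (.part p.1.1) (.inl v.1 : D.Carrier) ↔ (D.tree (.inr p)).color v = 0 := by
      rw [h.2 v, flat_part]
      constructor
      · rintro ⟨_, ⟨⟩, h⟩
        exact h
      · exact fun h => ⟨_, rfl, h⟩
    change (c = 0 ↔ _) ↔ _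
    rw [h1]
    generalize (D.tree (.inr p)).color v = d
    revert c d
    decide

theorem flat_rel : ∀ k (R : (amalgLang n).Relations k) (x : Fin k → D.Carrier),
    Structure.RelMap (M := D.str) R x ↔ Flat.Rel k R D.flat x
  | _, .edge, x => by
    change D.Link (x 0) (x 1) ∨ D.Link (x 1) (x 0) ↔ Flat.Edge D.flat (x 0) (x 1)
    generalize x 0 = x, x 1 = y
    have : ∀ x y : D.Carrier, D.Link x y ↔ Flat.Cov D.flat x y ∨ D.flat.bin .leaf x y := by
      intro x y
      rw [flat_cov]
      constructor
      · rintro (⟨a, x, y, h⟩ | ⟨a, v⟩)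
        · exact .inl ⟨a, x, y, rfl, rfl, h⟩
        · exact .inr (.mk a v)
      · rintro (⟨a, x, y, rfl, rfl, h⟩ | h)
        · exact .tree a x y h
        · replace h := flat_leaf_iff.1 h
          obtain ⟨a, v, rfl, rfl⟩ := h
          exact .leaf a v
    rw [this, this]
    unfold Flat.Edge
    tauto
  | _, .tri, x => Iff.rfl
  | _, .root, x => by
    change D.Root (x 0) ↔ Flat.Root D.flat (x 0)
    generalize x 0 = x
    constructor
    · rintro ⟨a, x, h⟩
      refine ⟨⟨a, x, rfl⟩, fun y b hb hy => ?_⟩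
      obtain ⟨_, ⟨⟩⟩ := hb
      replace hy := flat_piece.1 hy
      obtain ⟨y, rfl⟩ := hy
      exact .mk a x y (h y)
    · rintro ⟨⟨a, x, rfl⟩, h⟩
      exact .mk a x fun y => le_inr.1 (h (.inr ⟨a, y⟩ : D.Carrier) a ⟨x, rfl⟩ ⟨y, rfl⟩)
  | _, .ground, x => Iff.rfl
  | _, .part i, x => Iff.rfl
  | _, .color c, x => by
    change D.Color c (x 0) ↔ Flat.Color D.flat c (x 0)
    generalize x 0 = x
    constructor
    · rintro ⟨a, v, h⟩
      exact ⟨(.inl v.1 : D.Carrier), .mk a v, a, ⟨_, rfl⟩, (colorOf_iff c a v).2 h⟩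
    · rintro ⟨v, hv, b, hb, h⟩
      replace hv := flat_leaf_iff.1 hv
      obtain ⟨a, v, rfl, rfl⟩ := hv
      obtain ⟨_, hb⟩ := hb
      cases hb
      exact .mk b v ((colorOf_iff c b v).1 h)
  | _, .label l, x => Iff.rfl

theorem good_flat {H : ℕ} (hD : D.HeightLE H) : Flat.Good D.flat H := by
  refine ⟨⟨?_, ?_, ?_, ?_, ?_, ?_⟩, ⟨?_, ?_, ?_, ?_, ?_, ?_, ?_⟩, ⟨?_, ?_, ?_⟩,
    ⟨?_, ?_, ?_, ?_, ?_, ?_⟩, ?_, ?_, ?_⟩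
  · rintro (v | ⟨a, x⟩)
    · exact .inl ⟨v, rfl⟩
    · exact .inr ⟨a, x, rfl⟩
  · rintro _ a ⟨x, rfl⟩ ⟨v, hv⟩
    cases hv
  · rintro _ a b ⟨x, rfl⟩ ⟨y, hy⟩
    cases hy
    rfl
  · rintro _ ⟨v, rfl⟩
    exact ⟨_, flat_part.2 ⟨v, rfl, rfl⟩⟩
  · intro x i h
    replace h := flat_part.1 h
    obtain ⟨v, rfl, -⟩ := h
    exact ⟨v, rfl⟩
  · intro x i j h h'
    replace h := flat_part.1 h
    obtain ⟨v, rfl, rfl⟩ := h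
    replace h' := flat_part.1 h'
    obtain ⟨w, hw, rfl⟩ := h'
    cases hw
    rfl
  · intro x y h
    replace h := flat_le_iff.1 h
    obtain ⟨a, x, y, rfl, rfl, -⟩ := h
    exact ⟨a, ⟨x, rfl⟩, y, rfl⟩
  · rintro _ a ⟨x, rfl⟩
    exact .mk a x x le_rfl
  · intro x y h h'
    replace h := flat_le_iff.1 h
    obtain ⟨a, x, y, rfl, rfl, h⟩ := h
    rw [le_antisymm h (flat_le_inr.1 h')]
  · intro x y z h h'
    replace h := flat_le_iff.1 h
    obtain ⟨a, x, y, rfl, rfl, h⟩ := h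
    replace h' := flat_le_iff.1 h'
    obtain ⟨_, _, z, ⟨⟩, rfl, h'⟩ := h'
    exact .mk a x z (h.trans h')
  · intro x y z h h'
    replace h := flat_le_iff.1 h
    obtain ⟨a, x, z, rfl, rfl, h⟩ := h
    replace h' := flat_le_iff.1 h'
    obtain ⟨_, y, _, rfl, ⟨⟩, h'⟩ := h'
    exact ((D.tree a).chain x y z h h').imp (.mk _ _ _) (.mk _ _ _)
  · rintro _ _ a ⟨x, rfl⟩ ⟨y, rfl⟩
    obtain ⟨m, h, h'⟩ := (D.tree a).connected x y
    exact ⟨(.inr ⟨a, m⟩ : D.Carrier), .mk _ _ _ h, .mk _ _ _ h'⟩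
  · rintro x ⟨f, hf, hne⟩
    obtain ⟨a, _, x, -, rfl, -⟩ := flat_le_iff.1 (hf 0)
    have : ∀ i, ∃ y : (D.tree a).Node, y ≤ x ∧ f i = (.inr ⟨a, y⟩ : D.Carrier) := by
      intro i
      obtain ⟨_, y, _, h, ⟨⟩, h'⟩ := flat_le_iff.1 (hf i)
      exact ⟨y, h', h⟩
    choose g hg hfg using this
    have hg' : Function.Injective g := by
      intro i j h
      by_contra hij
      exact hne i j hij (by rw [hfg, hfg, h])
    have h1 : (Set.range g).ncard ≤ (Set.Iic x).ncard :=
      Set.ncard_le_ncard (by rintro _ ⟨i, rfl⟩; exact hg i) (Set.toFinite _)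
    rw [Set.ncard_range_of_injective hg', Nat.card_fin] at h1
    have := hD a x
    omega
  · intro x h
    replace h := flat_tri_iff.1 h
    obtain ⟨a, y, _, rfl, hz, h⟩ := h
    obtain rfl := inr_injective hz
    exact (D.tree a).tri_irrefl y h
  · intro x y z h h'
    replace h := flat_tri_iff.1 h
    obtain ⟨a, x, y, rfl, rfl, h⟩ := h
    replace h' := flat_tri_iff.1 h'
    obtain ⟨_, _, z, ⟨⟩, rfl, h'⟩ := h'
    exact .mk a x z ((D.tree a).tri_trans _ _ _ h h')
  · intro x y hxy
    constructor
    · intro h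
      have : ∃ a x' y', x = (.inr ⟨a, x'⟩ : D.Carrier) ∧ y = (.inr ⟨a, y'⟩ : D.Carrier) ∧
          ((D.tree a).tri x' y' ∨ (D.tree a).tri y' x') := by
        rcases h with h | h
        · replace h := flat_tri_iff.1 h
          obtain ⟨a, x, y, rfl, rfl, h⟩ := h
          exact ⟨a, x, y, rfl, rfl, .inl h⟩
        · replace h := flat_tri_iff.1 h
          obtain ⟨a, y, x, rfl, rfl, h⟩ := h
          exact ⟨a, x, y, rfl, rfl, .inr h⟩
      obtain ⟨a, x, y, rfl, rfl, this⟩ := this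
      have hne : x ≠ y := fun h => hxy (by rw [h])
      obtain ⟨p, hp, hx, hy⟩ := ((D.tree a).tri_comparable x y hne).1 this
      exact ⟨(.inr ⟨a, p⟩ : D.Carrier), (mem_C_iff a p).1 hp, flat_cov.2 ⟨a, p, x, rfl, rfl, hx⟩,
        flat_cov.2 ⟨a, p, y, rfl, rfl, hy⟩⟩
    · rintro ⟨p, hp, hx, hy⟩
      replace hx := flat_cov.1 hx
      obtain ⟨a, p, x, rfl, rfl, hx⟩ := hx
      replace hy := flat_cov.1 hy
      obtain ⟨_, _, y, ⟨⟩, rfl, hy⟩ := hy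
      have hne : x ≠ y := fun h => hxy (by rw [h])
      exact (((D.tree a).tri_comparable x y hne).2 ⟨p, (mem_C_iff a p).2 hp, hx, hy⟩).imp
        flat_tri_inr.2 flat_tri_inr.2
  · intro v x h
    replace h := flat_leaf_iff.1 h
    obtain ⟨a, v, rfl, rfl⟩ := h
    exact ⟨a, _, v.2, ⟨v.1, rfl, rfl⟩, _, rfl⟩
  · intro x i a h ha
    replace h := flat_part.1 h
    obtain ⟨v, rfl, rfl⟩ := h
    exact ⟨(.inr ⟨a, (D.tree a).leaf ⟨v, ha⟩⟩ : D.Carrier), ⟨_, rfl⟩, .mk a ⟨v, ha⟩⟩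
  · rintro v _ _ a h h' ⟨x, rfl⟩ ⟨y, rfl⟩
    replace h := flat_leaf_iff.1 h
    obtain ⟨_, v, rfl, ⟨⟩⟩ := h
    replace h' := flat_leaf_iff.1 h'
    obtain ⟨_, w, hw, ⟨⟩⟩ := h'
    rw [Subtype.ext (Sum.inl_injective hw)]
  · intro v w x h h'
    replace h := flat_leaf_iff.1 h
    obtain ⟨a, v, rfl, rfl⟩ := h
    replace h' := flat_leaf_iff.1 h'
    obtain ⟨b, w, rfl, hz⟩ := h'
    obtain ⟨rfl, hz⟩ := Sigma.mk.inj (Sum.inr_injective hz)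
    rw [(D.tree a).leaf_injective (eq_of_heq hz)]
  · intro v x h
    replace h := flat_leaf_iff.1 h
    obtain ⟨a, v, rfl, rfl⟩ := h
    exact fun h => flat_internal.1 h (TModel.isMax_leaf _ _)
  · rintro _ a ⟨x, rfl⟩ h
    obtain ⟨v, rfl⟩ := (D.tree a).exists_eq_leaf (not_not.1 fun h' => h (flat_internal.2 h'))
    exact ⟨(.inl v.1 : D.Carrier), .mk a v⟩
  · intro x l h
    replace h := flat_label.1 h
    obtain ⟨a, x, hx, -⟩ := h
    exact flat_internal.2 hx
  · intro x l l' h h'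
    replace h := flat_label.1 h
    obtain ⟨a, x, hx, rfl⟩ := h
    exact (label_inr.1 h').2
  · rintro _ a hx ⟨x, rfl⟩
    have hx := flat_internal.1 hx
    have h := D.isPiece a
    cases a with
    | inl i => exact (h.2.2 x hx).imp (.mk _ _ hx) (.mk _ _ hx)
    | inr p =>
      exact (h.1 x hx).imp (fun h => .mk _ _ hx h.2)
        (Or.imp (fun h => .mk _ _ hx h.2) fun h => .mk _ _ hx h.2)

end Amalgam

/-! ### Structures that satisfy the axioms are amalgams -/

namespace Flat

variable {n H : ℕ} {M : FinStr (flatLang n)}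

theorem GroundOK.piece_of_not_ground (hM : GroundOK M) {x : M} (hx : ¬ M.un .ground x) :
    ∃ a, M.un (.piece a) x := (hM.1 x).resolve_left hx

/-- The part of an element of the ground. -/
noncomputable def partOf (hM : GroundOK M) (v : {x : M // M.un .ground x}) : Fin n :=
  (hM.2.2.2.1 v.1 v.2).choose

theorem partOf_iff (hM : GroundOK M) (v : {x : M // M.un .ground x}) (i : Fin n) :
    M.un (.part i) v.1 ↔ partOf hM v = i := by
  have h := (hM.2.2.2.1 v.1 v.2).choose_spec
  constructor
  · exact fun h' => hM.2.2.2.2.2 _ _ _ h h'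
  · rintro rfl
    exact h

variable (M) in
/-- The nodes of a piece. -/
def PieceNode (a : PieceIdx n) : Type := {x : M // M.un (.piece a) x}

instance (a : PieceIdx n) : Finite (PieceNode M a) :=
  inferInstanceAs (Finite {x : M // M.un (.piece a) x})

/-- The tree-order of a piece. -/
@[reducible] def pieceOrder (hM : OrderOK M H) (a : PieceIdx n) : PartialOrder (PieceNode M a) where
  le x y := M.bin .le x.1 y.1
  le_refl x := hM.2.1 x.1 a x.2
  le_trans x y z := hM.2.2.2.1 x.1 y.1 z.1
  le_antisymm x y h h' := Subtype.ext (hM.2.2.1 x.1 y.1 h h')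

theorem piece_of_le (hM : Good M H) {a : PieceIdx n} {x y : M} (h : M.bin .le x y) :
    M.un (.piece a) x ↔ M.un (.piece a) y := by
  obtain ⟨b, hx, hy⟩ := hM.2.1.1 x y h
  constructor
  · exact fun h => hM.1.2.2.1 x a b h hx ▸ hy
  · exact fun h => hM.1.2.2.1 y a b h hy ▸ hx

theorem isMax_iff (hM : Good M H) {a : PieceIdx n} (x : PieceNode M a) :
    @IsMax _ (pieceOrder hM.2.1 a).toLE x ↔ ¬ Internal M x.1 := by
  let _ := pieceOrder hM.2.1 a
  constructor
  · rintro h ⟨y, hy, hne⟩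
    let y' : PieceNode M a := ⟨y, (piece_of_le hM hy).1 x.2⟩
    have h1 : x ≤ y' := hy
    exact hne (congrArg Subtype.val (le_antisymm (α := PieceNode M a) h1 (h h1)))
  · intro h y hy
    by_cases hxy : x = y
    · exact hxy.ge
    · exact (h ⟨y.1, hy, fun h => hxy (Subtype.ext h)⟩).elim

theorem cov_iff (hM : Good M H) {a : PieceIdx n} (x y : PieceNode M a) :
    Cov M x.1 y.1 ↔ @CovBy _ (pieceOrder hM.2.1 a).toPreorder.toLT x y := by
  let _ := pieceOrder hM.2.1 a
  constructor
  · rintro ⟨h1, h2, h3⟩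
    have h1' : x ≤ y := h1
    refine ⟨lt_of_le_of_ne h1' fun h => h2 (congrArg _ h), fun z hz hz' => ?_⟩
    rcases h3 z.1 hz.le hz'.le with h | h
    · exact hz.ne' (Subtype.ext h)
    · exact hz'.ne (Subtype.ext h)
  · intro h
    refine ⟨h.le, fun h' => h.ne (Subtype.ext h'), fun z hz hz' => ?_⟩
    let z' : PieceNode M a := ⟨z, (piece_of_le hM hz).1 x.2⟩
    have h1 : x ≤ z' := hz
    have h2 : z' ≤ y := hz'
    rcases h1.lt_or_eq with h1 | h1
    · rcases h2.lt_or_eq with h2 | h2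
      · exact (h.2 h1 h2).elim
      · exact .inr (congrArg Subtype.val h2)
    · exact .inl (congrArg Subtype.val h1).symm

theorem exists_leafOf (hM : Good M H) (a : PieceIdx n) (v : pieceGround (partOf hM.1) a) :
    ∃ x : PieceNode M a, M.bin .leaf v.1.1 x.1 := by
  obtain ⟨x, hx, h⟩ := hM.2.2.2.1.2.1 v.1.1 _ a ((partOf_iff hM.1 v.1 _).2 rfl) v.2
  exact ⟨⟨x, hx⟩, h⟩

open Classical in
/-- The tree formed by a piece. -/
noncomputable def pieceTree (hM : Good M H) (a : PieceIdx n) :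
    TModel (pieceGround (partOf hM.1) a) where
  Node := PieceNode M a
  finite := inferInstance
  order := pieceOrder hM.2.1 a
  chain x y z := hM.2.1.2.2.2.2.1 x.1 y.1 z.1
  connected x y := by
    obtain ⟨z, hz, hz'⟩ := hM.2.1.2.2.2.2.2.1 x.1 y.1 a x.2 y.2
    exact ⟨⟨z, (piece_of_le hM hz).2 x.2⟩, hz, hz'⟩
  C := {x | M.un (.label .O) x.1}
  C_internal x hx h := (isMax_iff hM x).1 h (hM.2.2.2.2.1 x.1 _ hx)
  tri x y := M.bin .tri x.1 y.1
  tri_irrefl x := hM.2.2.1.1 x.1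
  tri_trans x y z := hM.2.2.1.2.1 x.1 y.1 z.1
  tri_comparable x y hxy := by
    rw [hM.2.2.1.2.2 x.1 y.1 fun h => hxy (Subtype.ext h)]
    constructor
    · rintro ⟨p, hp, h1, h2⟩
      let p' : PieceNode M a := ⟨p, (piece_of_le hM h1.1).2 x.2⟩
      exact ⟨p', hp, (cov_iff hM p' x).1 h1, (cov_iff hM p' y).1 h2⟩
    · rintro ⟨p, hp, h1, h2⟩
      exact ⟨p.1, hp, (cov_iff hM p x).2 h1, (cov_iff hM p y).2 h2⟩
  leaf v := (exists_leafOf hM a v).choose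
  leaf_injective v w h := by
    have h1 := (exists_leafOf hM a v).choose_spec
    have h2 := (exists_leafOf hM a w).choose_spec
    have h : (exists_leafOf hM a v).choose = (exists_leafOf hM a w).choose := h
    rw [← h] at h2
    exact Subtype.ext (Subtype.ext (hM.2.2.2.1.2.2.2.1 _ _ _ h1 h2))
  leaf_range := by
    ext x
    constructor
    · rintro ⟨v, rfl⟩
      exact (isMax_iff hM _).2 (hM.2.2.2.1.2.2.2.2.1 _ _ (exists_leafOf hM a v).choose_spec)
    · intro hx
      obtain ⟨v, hv⟩ := hM.2.2.2.1.2.2.2.2.2 x.1 a x.2 ((isMax_iff hM x).1 hx)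
      obtain ⟨b, i, hb, hi, hx'⟩ := hM.2.2.2.1.1 v x.1 hv
      obtain rfl := hM.1.2.2.1 _ _ _ x.2 hx'
      have hv' : M.un .ground v := hM.1.2.2.2.2.1 _ _ hi
      have hp := (partOf_iff hM.1 ⟨v, hv'⟩ i).1 hi
      have hg : (⟨v, hv'⟩ : {x : M // M.un .ground x}) ∈ pieceGround (partOf hM.1) a := by
        change a.Has _
        rw [hp]
        exact hb
      refine ⟨⟨⟨v, hv'⟩, hg⟩, Subtype.ext ?_⟩
      exact hM.2.2.2.1.2.2.1 v _ _ a (exists_leafOf hM a ⟨⟨v, hv'⟩, hg⟩).choose_spec hv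
        (Subtype.prop _) x.2
  label x := if h : ∃ l, M.un (.label l) x.1 then h.choose else .U
  color v := match a with
    | .inl _ => 0
    | .inr p => if partOf hM.1 v = p.1.1 then 0 else 1

theorem pieceTree_label (hM : Good M H) {a : PieceIdx n} {x : (pieceTree hM a).Node} {l : NodeLabel}
    (h : M.un (.label l) x.1) : (pieceTree hM a).label x = l := by
  have h' : ∃ l, M.un (.label l) x.1 := ⟨l, h⟩
  have : (pieceTree hM a).label x = h'.choose := dif_pos h'
  rw [this]
  exact hM.2.2.2.2.2.1 _ _ _ h'.choose_spec h

theorem isPiece_pieceTree (hM : Good M H) (a : PieceIdx n) :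
    IsPiece (partOf hM.1) a (pieceTree hM a) := by
  have key : ∀ x : (pieceTree hM a).Node, ¬ IsMax x → Internal M x.1 := fun x hx => by
    by_contra h
    exact hx ((isMax_iff hM x).2 h)
  have hC : ∀ x : (pieceTree hM a).Node, x ∈ (pieceTree hM a).C ↔ M.un (.label .O) x.1 :=
    fun x => Iff.rfl
  have huniq := hM.2.2.2.2.2.1
  have hlab := hM.2.2.2.2.2.2
  cases a with
  | inl i =>
    refine ⟨Set.eq_empty_of_forall_notMem fun x hx => ?_, fun _ => rfl, fun x hx => ?_⟩
    · have h1 := hM.2.2.2.2.1 x.1 _ hx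
      rcases hlab x.1 _ h1 x.2 with h | h
      · cases huniq _ _ _ h hx
      · cases huniq _ _ _ h hx
    · exact (hlab x.1 _ (key x hx) x.2).imp (pieceTree_label hM) (pieceTree_label hM)
  | inr p =>
    refine ⟨fun x hx => ?_, fun v => ?_⟩
    · rw [hC]
      rcases hlab x.1 _ (key x hx) x.2 with h | h | h
      · exact .inl ⟨fun h' => (nomatch huniq _ _ _ h h'), pieceTree_label hM h⟩
      · exact .inr (.inl ⟨fun h' => (nomatch huniq _ _ _ h h'), pieceTree_label hM h⟩)
      · exact .inr (.inr ⟨h, pieceTree_label hM h⟩)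
    · change (if _ then _ else _) = _ ↔ _
      split_ifs with h
      · simp [h]
      · simp [h]

/-- The amalgam described by a structure. -/
noncomputable def toAmalgam (hM : Good M H) : Amalgam n {x : M // M.un .ground x} where
  part := partOf hM.1
  tree := pieceTree hM
  isPiece := isPiece_pieceTree hM

theorem heightLE_toAmalgam (hM : Good M H) : (toAmalgam hM).HeightLE H := by
  intro a x
  by_contra! h
  have h : H + 1 ≤ Nat.card (Set.Iic x) := h
  let e := Finite.equivFin (Set.Iic x)
  refine hM.2.1.2.2.2.2.2.2 x.1 ⟨fun i => (e.symm (Fin.castLE h i)).1.1,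
    fun i => (e.symm (Fin.castLE h i)).2, fun i j hij h' => hij ?_⟩
  exact Fin.castLE_injective h (e.symm.injective (Subtype.ext (Subtype.ext h')))

/-- The identification of a structure with the amalgam that it describes. -/
def toAmalgamMap (hM : Good M H) : (toAmalgam hM).Carrier → M
  | .inl v => v.1
  | .inr ⟨_, x⟩ => x.1

theorem toAmalgamMap_bijective (hM : Good M H) : Function.Bijective (toAmalgamMap hM) := by
  constructor
  · rintro (v | ⟨a, x⟩) (w | ⟨b, y⟩) h
    · exact congrArg Sum.inl (Subtype.ext h)
    · have h : v.1 = y.1 := h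
      exact (hM.1.2.1 y.1 b y.2 (h ▸ v.2)).elim
    · have h : x.1 = w.1 := h
      exact (hM.1.2.1 x.1 a x.2 (h ▸ w.2)).elim
    · have h : x.1 = y.1 := h
      obtain rfl : a = b := hM.1.2.2.1 x.1 a b x.2 (h ▸ y.2)
      rw [show x = y from Subtype.ext h]
  · intro x
    by_cases h : M.un .ground x
    · exact ⟨.inl ⟨x, h⟩, rfl⟩
    · obtain ⟨a, ha⟩ := hM.1.piece_of_not_ground h
      exact ⟨.inr ⟨a, ⟨x, ha⟩⟩, rfl⟩

theorem toAmalgamMap_un (hM : Good M H) (r : FlatUn n) (x : (toAmalgam hM).Carrier) :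
    (toAmalgam hM).flat.un r x ↔ M.un r (toAmalgamMap hM x) := by
  cases r with
  | ground =>
    rw [Amalgam.flat_ground]
    constructor
    · rintro ⟨v, rfl⟩
      exact v.2
    · intro h
      rcases x with v | ⟨a, x⟩
      · exact ⟨v, rfl⟩
      · exact (hM.1.2.1 x.1 a x.2 h).elim
  | part i =>
    rw [Amalgam.flat_part]
    constructor
    · rintro ⟨v, rfl, h⟩
      exact (partOf_iff hM.1 v i).2 h
    · intro h
      rcases x with v | ⟨a, x⟩
      · exact ⟨v, rfl, (partOf_iff hM.1 v i).1 h⟩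
      · exact (hM.1.2.1 x.1 a x.2 (hM.1.2.2.2.2.1 _ _ h)).elim
  | piece a =>
    rw [Amalgam.flat_piece]
    constructor
    · rintro ⟨x, rfl⟩
      exact x.2
    · intro h
      rcases x with v | ⟨b, x⟩
      · exact (hM.1.2.1 v.1 a h v.2).elim
      · obtain rfl := hM.1.2.2.1 x.1 _ _ x.2 h
        exact ⟨x, rfl⟩
  | label l =>
    rw [Amalgam.flat_label]
    constructor
    · rintro ⟨a, x, hx, h⟩
      have hx : Internal M x.1 := by
        by_contra h'
        exact hx ((isMax_iff hM x).2 h')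
      -- An internal node does have a label, so the default value in `pieceTree` is not involved.
      have : ∃ l, M.un (.label l) x.1 := by
        have := hM.2.2.2.2.2.2 x.1 a hx x.2
        cases a with
        | inl i => exact this.elim (fun h => ⟨_, h⟩) fun h => ⟨_, h⟩
        | inr p => exact this.elim (fun h => ⟨_, h⟩) (Or.elim · (fun h => ⟨_, h⟩) fun h => ⟨_, h⟩)
      obtain ⟨l', hl'⟩ := this
      have h1 := pieceTree_label hM (x := x) hl'
      have h2 : (pieceTree hM a).label x = l := h
      rw [h1] at h2
      exact h2 ▸ hl'
    · intro h
      have hi := hM.2.2.2.2.1 _ _ h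
      rcases x with v | ⟨a, x⟩
      · obtain ⟨y, hy, -⟩ := hi
        obtain ⟨a, ha, -⟩ := hM.2.1.1 _ _ hy
        exact (hM.1.2.1 v.1 a ha v.2).elim
      · exact .mk a x (fun h' => (isMax_iff hM x).1 h' hi) (pieceTree_label hM (x := x) h)

theorem toAmalgamMap_bin (hM : Good M H) (r : FlatBin) (x y : (toAmalgam hM).Carrier) :
    (toAmalgam hM).flat.bin r x y ↔ M.bin r (toAmalgamMap hM x) (toAmalgamMap hM y) := by
  have key : ∀ x y : (toAmalgam hM).Carrier, ∀ a, M.un (.piece a) (toAmalgamMap hM x) →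
      M.un (.piece a) (toAmalgamMap hM y) →
      ∃ x' y', x = .inr ⟨a, x'⟩ ∧ y = .inr ⟨a, y'⟩ := by
    intro x y a hx hy
    obtain ⟨x', rfl⟩ := Amalgam.flat_piece.1 ((toAmalgamMap_un hM (.piece a) x).2 hx)
    obtain ⟨y', rfl⟩ := Amalgam.flat_piece.1 ((toAmalgamMap_un hM (.piece a) y).2 hy)
    exact ⟨x', y', rfl, rfl⟩
  cases r with
  | le =>
    rw [Amalgam.flat_le]
    constructor
    · rintro ⟨a, x, y, h⟩
      exact h
    · intro h
      obtain ⟨a, hx, hy⟩ := hM.2.1.1 _ _ h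
      obtain ⟨x, y, rfl, rfl⟩ := key x y a hx hy
      exact .mk a x y h
  | leaf =>
    rw [Amalgam.flat_leaf]
    constructor
    · rintro ⟨a, v⟩
      exact (exists_leafOf hM a v).choose_spec
    · intro h
      obtain ⟨a, i, ha, hi, hx⟩ := hM.2.2.2.1.1 _ _ h
      obtain ⟨v, rfl, hv⟩ := Amalgam.flat_part.1 ((toAmalgamMap_un hM (.part i) x).2 hi)
      obtain ⟨y, rfl⟩ := Amalgam.flat_piece.1 ((toAmalgamMap_un hM (.piece a) y).2 hx)
      have hg : v ∈ pieceGround (toAmalgam hM).part a := by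
        change a.Has _
        rw [hv]
        exact ha
      have : y = ((toAmalgam hM).tree a).leaf ⟨v, hg⟩ := Subtype.ext <|
        hM.2.2.2.1.2.2.1 v.1 _ _ a h (exists_leafOf hM a ⟨v, hg⟩).choose_spec y.2 (Subtype.prop _)
      rw [this]
      exact .mk a ⟨v, hg⟩
  | tri =>
    rw [Amalgam.flat_tri]
    constructor
    · rintro ⟨a, x, y, h⟩
      exact h
    · intro h
      have hne : toAmalgamMap hM x ≠ toAmalgamMap hM y := fun h' =>
        hM.2.2.1.1 (toAmalgamMap hM y) (by rwa [h'] at h)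
      obtain ⟨p, -, h1, h2⟩ := (hM.2.2.1.2.2 _ _ hne).1 (.inl h)
      obtain ⟨a, ha, hx⟩ := hM.2.1.1 _ _ h1.1
      obtain ⟨x, y, rfl, rfl⟩ := key x y a hx ((piece_of_le hM h2.1).1 ha)
      exact .mk a x y h

/-- The identification is an isomorphism for the signature with tree-orders, and isomorphisms
preserve everything that is definable in this signature. -/
theorem rel_toAmalgamMap (hM : Good M H) (k : ℕ) (R : (amalgLang n).Relations k)
    (x : Fin k → (toAmalgam hM).Carrier) :
    Rel k R (toAmalgam hM).flat x ↔ Rel k R M fun i => toAmalgamMap hM (x i) := by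
  obtain ⟨φ, hφ⟩ := foDef_rel k R
  let e : (toAmalgam hM).flat ≃[flatLang n] M :=
    ⟨.ofBijective _ (toAmalgamMap_bijective hM), fun {k} f => isEmptyElim f, by
      rintro _ (r | r) x
      · refine (M.relMap_un r _).trans (Iff.trans ?_ ((toAmalgam hM).flat.relMap_un r x).symm)
        exact (toAmalgamMap_un hM r (x 0)).symm
      · refine (M.relMap_bin r _).trans (Iff.trans ?_ ((toAmalgam hM).flat.relMap_bin r x).symm)
        exact (toAmalgamMap_bin hM r (x 0) (x 1)).symm⟩
  refine (hφ _ _).symm.trans (Iff.trans ?_ (hφ _ _))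
  exact (StrongHomClass.realize_formula e φ).symm

end Flat

/-- The empty tree. -/
def TModel.empty (S : Type) [IsEmpty S] : TModel S where
  Node := Empty
  finite := inferInstance
  order := inferInstance
  chain x := x.elim
  connected x := x.elim
  C := ∅
  C_internal x := x.elim
  tri _ _ := False
  tri_irrefl x := x.elim
  tri_trans x := x.elim
  tri_comparable x := x.elim
  leaf s := isEmptyElim s
  leaf_injective s := isEmptyElim s
  leaf_range := Set.ext fun x => x.elim
  label x := x.elim
  color s := isEmptyElim s

/-- The empty amalgam. -/
def Amalgam.empty (n : ℕ) : Amalgam n Empty where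
  part v := v.elim
  tree a := .empty _
  isPiece a := by
    cases a with
    | inl i => exact ⟨rfl, fun s => s.1.elim, fun x => x.elim⟩
    | inr p => exact ⟨fun x => x.elim, fun s => s.1.elim⟩

instance (n : ℕ) : IsEmpty (Amalgam.empty n).str :=
  ⟨fun x => x.elim Empty.elim fun p => Empty.elim p.2⟩

/-- The interpretation of amalgams in amalgams with tree-orders; it outputs the empty structure
when the input is not an amalgam. -/
theorem exists_unflatten (n H : ℕ) : ∃ T : Transduction (flatLang n) (amalgLang n),
    (∀ {V : Type} [Finite V] (D : Amalgam n V), D.HeightLE H → T.Out D.flat D.str id) ∧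
    ∀ M N f, T.Out M N f → N ∈ amalgamsOfHeightLE n H := by
  have : FODef₁ fun (M : FinStr (flatLang n)) (_ : M) => Flat.Good M H := inferInstance
  -- The domain is defined by a sentence: all elements are kept if the axioms hold, and none
  -- otherwise.
  obtain ⟨T, hT⟩ := Transduction.exists_interpreting (L := flatLang n) (L' := amalgLang n)
    (fun M _ => Flat.Good M H) Flat.Rel Flat.foDef_rel
  refine ⟨T, fun {V} _ D hD => (hT _ _ _).2 ⟨Function.injective_id, ?_, ?_⟩, fun M N f h => ?_⟩
  · exact Set.ext fun x => ⟨fun _ => Amalgam.good_flat hD, fun _ => ⟨x, rfl⟩⟩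
  · exact fun k R x => Amalgam.flat_rel k R x
  · obtain ⟨h1, h2, h3⟩ := (hT _ _ _).1 h
    by_cases hM : Flat.Good M H
    · refine ⟨_, inferInstance, Flat.toAmalgam hM, Flat.heightLE_toAmalgam hM, ?_⟩
      have hf : Function.Bijective f := ⟨h1, fun x => by
        have : x ∈ {x : M | Flat.Good M H} := hM
        rwa [← h2] at this⟩
      let e : N ≃ (Flat.toAmalgam hM).Carrier := (Equiv.ofBijective f hf).trans
        (Equiv.ofBijective _ (Flat.toAmalgamMap_bijective hM)).symm
      have he : ∀ x, Flat.toAmalgamMap hM (e x) = f x := fun x =>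
        (Equiv.ofBijective _ (Flat.toAmalgamMap_bijective hM)).apply_symm_apply (f x)
      refine ⟨⟨e, fun {k} g => isEmptyElim g, fun {k} R x => ?_⟩⟩
      refine (Amalgam.flat_rel k R _).trans ((Flat.rel_toAmalgamMap hM k R _).trans ?_)
      rw [h3]
      simp only [Function.comp_apply]
      exact iff_of_eq (congrArg _ (funext fun i => he (x i)))
    · have hN : IsEmpty N := ⟨fun x => by
        have : f x ∈ {x : M | Flat.Good M H} := h2 ▸ ⟨x, rfl⟩
        exact hM this⟩
      refine ⟨Empty, inferInstance, .empty n, fun a x => x.elim, ⟨⟨⟨hN.elim, isEmptyElim, hN.elim,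
        isEmptyElim⟩, fun {k} g => isEmptyElim g, fun {k} R x => ?_⟩⟩⟩
      -- There is no relation symbol of arity 0, so the relations cannot distinguish two empty
      -- structures.
      rcases k with _ | k
      · rcases R with _ | _
      · exact hN.elim (x 0)

/-! ### Bounded reachability -/

section Reach

variable {X : Type} (W : X → Prop) (K : X → X → Prop)

/-- There is a path with at most `k` edges from `x` to `y` whose vertices other than `x` are in
`W`. -/
def Reach : ℕ → X → X → Prop
  | 0, x, y => x = y
  | k + 1, x, y => Reach k x y ∨ ∃ z, W z ∧ K x z ∧ Reach k z y

variable {W K}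

theorem Reach.mono {k l : ℕ} (h : k ≤ l) {x y : X} (hr : Reach W K k x y) : Reach W K l x y := by
  induction h with
  | refl => exact hr
  | step _ ih => exact .inl ih

theorem Reach.trans {k l : ℕ} {x y z : X} (h : Reach W K k x y) (h' : Reach W K l y z) :
    Reach W K (k + l) x z := by
  induction k generalizing x with
  | zero =>
    obtain rfl : x = y := h
    exact h'.mono (by omega)
  | succ k ih =>
    rw [Nat.succ_add]
    rcases h with h | ⟨w, hw, hxw, h⟩
    · exact .inl (ih h)
    · exact .inr ⟨w, hw, hxw, ih h⟩

theorem Reach.single {x y : X} (hy : W y) (h : K x y) : Reach W K 1 x y :=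
  .inr ⟨y, hy, h, rfl⟩

/-- Used to transfer reachability between the leaves of a subtree and the corresponding vertices of
the marked graph. The relations need to agree on `W` only, because all intermediate vertices are in
`W`. -/
theorem Reach.map {Y : Type} {W' : Y → Prop} {K' : Y → Y → Prop} {g : X → Y}
    (hg : Function.Injective g) (hW : ∀ y, W' y ↔ ∃ x, W x ∧ g x = y)
    (hK : ∀ x y, W x → W y → (K' (g x) (g y) ↔ K x y)) {k : ℕ} {x y : X} (hx : W x) :
    Reach W' K' k (g x) (g y) ↔ Reach W K k x y := by
  induction k generalizing x with
  | zero => exact hg.eq_iff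
  | succ k ih =>
    refine or_congr (ih hx) ⟨?_, ?_⟩
    · rintro ⟨z, hz, hxz, h⟩
      obtain ⟨w, hw, rfl⟩ := (hW z).1 hz
      exact ⟨w, hw, (hK x w hx hw).1 hxz, (ih hw).1 h⟩
    · rintro ⟨w, hw, hxw, h⟩
      exact ⟨g w, (hW _).2 ⟨w, hw, rfl⟩, (hK x w hx hw).2 hxw, (ih hw).2 h⟩

/-- A relation that holds along edges holds for reachable pairs. -/
theorem Reach.closed {k : ℕ} {x y : X} (h : Reach W K k x y) (Z : X → Prop)
    (hZ : ∀ a b, W a → W b → K a b → Z a → Z b) (hx : W x) (hxZ : Z x) : Z y := by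
  induction k generalizing x with
  | zero => exact (h : x = y) ▸ hxZ
  | succ k ih =>
    rcases h with h | ⟨z, hz, hxz, h⟩
    · exact ih h hx hxZ
    · exact ih h hz (hZ x z hx hz hxz hxZ)

/-- Any vertex in or next to a complete bipartite graph. -/
theorem reach_of_core (hK : ∀ x y, K x y → K y x) (P Q : X → Prop) (hP : ∀ x, P x → W x)
    (hQ : ∀ x, Q x → W x) (hP' : ∃ x, P x) (hQ' : ∃ x, Q x) (hPQ : ∀ x y, P x → Q y → K x y)
    (hn : ∀ x, W x → ∃ y, (P y ∨ Q y) ∧ (x = y ∨ K x y)) {x y : X} (hx : W x) (hy : W y) :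
    Reach W K 4 x y := by
  obtain ⟨p, hp⟩ := hP'
  obtain ⟨q, hq⟩ := hQ'
  -- Inside the complete bipartite graph, two vertices on the same side are joined through the other
  -- side. Entering and leaving this graph costs one step each, whence the bound 4.
  have core : ∀ a b, (P a ∨ Q a) → (P b ∨ Q b) → Reach W K 2 a b := by
    rintro a b (ha | ha) (hb | hb)
    · exact (Reach.single (hQ _ hq) (hPQ _ _ ha hq)).trans
        (.single (hP _ hb) (hK _ _ (hPQ _ _ hb hq)))
    · exact (Reach.single (hQ _ hb) (hPQ _ _ ha hb)).mono (by norm_num)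
    · exact (Reach.single (hP _ hb) (hK _ _ (hPQ _ _ hb ha))).mono (by norm_num)
    · exact (Reach.single (hP _ hp) (hK _ _ (hPQ _ _ hp ha))).trans
        (.single (hQ _ hb) (hPQ _ _ hp hb))
  obtain ⟨a, ha, hxa⟩ := hn x hx
  obtain ⟨b, hb, hyb⟩ := hn y hy
  have h1 : Reach W K 1 x a := by
    rcases hxa with rfl | h
    · exact .inl rfl
    · exact .single (ha.elim (hP _) (hQ _)) h
  have h2 : Reach W K 1 b y := by
    rcases hyb with rfl | h
    · exact .inl rfl
    · exact .single hy (hK _ _ h)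
  exact (h1.trans (core a b ha hb)).trans h2

variable (W K) in
/-- Every cut of `W` is crossed by `K`. -/
def CutConn : Prop :=
  ∀ Z : X → Prop, (∃ x, W x ∧ Z x) → (∃ x, W x ∧ ¬ Z x) → ∃ x y, W x ∧ W y ∧ Z x ∧ ¬ Z y ∧ K x y

theorem CutConn.exists_adj (h : CutConn W K) {x y : X} (hx : W x) (hy : W y) (hxy : x ≠ y) :
    ∃ z, W z ∧ K x z := by
  obtain ⟨_, z, -, hz, rfl, -, h⟩ := h (· = x) ⟨x, hx, rfl⟩ ⟨y, hy, hxy.symm⟩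
  exact ⟨z, hz, h⟩

/-- The case of a connected bipartite graph with a bipartition into two sets that are completely
joined as far as the colors permit it, where one of these sets misses a color. -/
theorem reach_of_empty_quarter (hK : ∀ x y, K x y → K y x) (c A : X → Prop)
    (hc : ∀ x y, W x → W y → K x y → (c x ↔ ¬ c y))
    (hA : ∃ x, W x ∧ A x) (hR : ∃ x, W x ∧ ¬ A x)
    (hcross : ∀ x y, W x → W y → A x → ¬ A y → (c x ↔ ¬ c y) → K x y) (hconn : CutConn W K)
    (hempty : ∀ x, W x → A x → ¬ c x) {x y : X} (hx : W x) (hy : W y) : Reach W K 4 x y := by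
  obtain ⟨a, haW, ha⟩ := hA
  obtain ⟨r, hrW, hr⟩ := hR
  have hne : a ≠ r := fun h => hr (h ▸ ha)
  have hnb : ∀ x, W x → ∃ z, W z ∧ K x z := fun x hx => by
    by_cases hxa : x = a
    · exact hconn.exists_adj hx hrW (hxa ▸ hne)
    · exact hconn.exists_adj hx haW hxa
  obtain ⟨z, hz, haz⟩ := hnb a haW
  have hcz : c z := by
    by_contra h
    exact hempty a haW ha ((hc a z haW hz haz).2 h)
  -- All vertices in `A` lack `c`, so their neighbors have `c` and are outside of `A`. The set `A`
  -- and the vertices with `c` outside of `A` form the core; any remaining vertex lacks `c`, and its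
  -- neighbors have `c`.
  refine reach_of_core hK (fun x => W x ∧ A x) (fun x => W x ∧ ¬ A x ∧ c x) (fun _ h => h.1)
    (fun _ h => h.1) ⟨a, haW, ha⟩ ⟨z, hz, fun h => hempty z hz h hcz, hcz⟩ ?_ ?_ hx hy
  · rintro x y ⟨hx, hxA⟩ ⟨hy, hyA, hyc⟩
    exact hcross x y hx hy hxA hyA (iff_of_false (hempty x hx hxA) (not_not.2 hyc))
  · intro x hx
    by_cases hxA : A x
    · exact ⟨x, .inl ⟨hx, hxA⟩, .inl rfl⟩
    · by_cases hxc : c x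
      · exact ⟨x, .inr ⟨hx, hxA, hxc⟩, .inl rfl⟩
      · obtain ⟨w, hw, hxw⟩ := hnb x hx
        have hwc : c w := by
          by_contra h
          exact hxc ((hc x w hx hw hxw).2 h)
        exact ⟨w, .inr ⟨hw, fun h => hempty w hw h hwc, hwc⟩, .inr hxw⟩

/-- `A` and `c` divide `W` into four quarters. If none is empty, opposite quarters span two complete
bipartite graphs, in each of which two steps suffice; by connectedness some edge links these two
graphs, and `2 + 1 + 2 = 5`. If a quarter is empty, `reach_of_empty_quarter` applies, possibly with
`A` or `c` replaced by its complement. -/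
theorem reach_of_join (hK : ∀ x y, K x y → K y x) (c A : X → Prop)
    (hc : ∀ x y, W x → W y → K x y → (c x ↔ ¬ c y))
    (hA : ∃ x, W x ∧ A x) (hR : ∃ x, W x ∧ ¬ A x)
    (hcross : ∀ x y, W x → W y → A x → ¬ A y → (c x ↔ ¬ c y) → K x y) (hconn : CutConn W K)
    {x y : X} (hx : W x) (hy : W y) : Reach W K 5 x y := by
  have hcc : ∀ x y, W x → W y → K x y → (¬ c x ↔ ¬ ¬ c y) := fun x y hx hy h =>
    not_congr (hc x y hx hy h)
  have hcross' : ∀ x y, W x → W y → ¬ A x → ¬ ¬ A y → (c x ↔ ¬ c y) → K x y :=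
    fun x y hx hy hA hA' h => hK _ _ (hcross y x hy hx (not_not.1 hA') hA (by tauto))
  have hR' : ∃ x, W x ∧ ¬ ¬ A x := by simpa using hA
  by_cases h1 : ∀ x, W x → A x → ¬ c x
  · exact (reach_of_empty_quarter hK c A hc hA hR hcross hconn h1 hx hy).mono (by norm_num)
  by_cases h2 : ∀ x, W x → A x → ¬ ¬ c x
  · exact (reach_of_empty_quarter hK (fun x => ¬ c x) A hcc hA hR
      (fun x y hx hy hA hA' h => hcross x y hx hy hA hA' (not_iff_not.1 h)) hconn h2 hx hy).mono
      (by norm_num)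
  by_cases h3 : ∀ x, W x → ¬ A x → ¬ c x
  · exact (reach_of_empty_quarter hK c (fun x => ¬ A x) hc hR hR' hcross' hconn h3 hx hy).mono
      (by norm_num)
  by_cases h4 : ∀ x, W x → ¬ A x → ¬ ¬ c x
  · exact (reach_of_empty_quarter hK (fun x => ¬ c x) (fun x => ¬ A x) hcc hR hR'
      (fun x y hx hy hA hA' h => hcross' x y hx hy hA hA' (not_iff_not.1 h)) hconn h4 hx hy).mono
      (by norm_num)
  push Not at h1 h2 h3 h4
  obtain ⟨a0, ha0W, ha0, ca0⟩ := h1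
  obtain ⟨a1, ha1W, ha1, ca1⟩ := h2
  obtain ⟨r0, hr0W, hr0, cr0⟩ := h3
  obtain ⟨r1, hr1W, hr1, cr1⟩ := h4
  have key : ∀ x y, W x → W y → (A x ↔ ¬ A y) → (c x ↔ ¬ c y) → K x y := by
    intro x y hx hy hA hC
    by_cases h : A x
    · exact hcross x y hx hy h (hA.1 h) hC
    · exact hcross' x y hx hy h (fun h' => h (hA.2 h')) hC
  have half : ∀ x y, W x → W y → ((A x ↔ c x) ↔ (A y ↔ c y)) → Reach W K 2 x y := by
    intro x y hx hy h
    obtain ⟨z, hz, hzA, hzc⟩ : ∃ z, W z ∧ ((A z ↔ ¬ A x) ∧ (c z ↔ ¬ c x)) := by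
      by_cases hA : A x <;> by_cases hC : c x
      · exact ⟨r1, hr1W, by simp [hA, hC, hr1, cr1]⟩
      · exact ⟨r0, hr0W, by simp [hA, hC, hr0, cr0]⟩
      · exact ⟨a1, ha1W, by simp [hA, hC, ha1, ca1]⟩
      · exact ⟨a0, ha0W, by simp [hA, hC, ha0, ca0]⟩
    by_cases hxy : A x ↔ A y
    · have hxy' : c x ↔ c y := by clear * - h hxy; tauto
      exact (Reach.single hz (key x z hx hz (iff_not_comm.1 hzA) (iff_not_comm.1 hzc))).trans
        (.single hy (key z y hz hy (hzA.trans (not_congr hxy)) (hzc.trans (not_congr hxy'))))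
    · refine (Reach.single hy (key x y hx hy ?_ ?_)).mono (by norm_num)
      · clear * - hxy; tauto
      · clear * - h hxy; tauto
  by_cases hxy : (A x ↔ c x) ↔ (A y ↔ c y)
  · exact (half x y hx hy hxy).mono (by norm_num)
  · obtain ⟨p, q, hp, hq, hpZ, hqZ, hpq⟩ := hconn (fun z => (A z ↔ c z) ↔ (A x ↔ c x))
      ⟨x, hx, Iff.rfl⟩ ⟨y, hy, fun h => hxy h.symm⟩
    exact ((half x p hx hp hpZ.symm).trans (.single hq hpq)).trans
      (half q y hq hy (by clear * - hxy hqZ; tauto))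

/-- The core consists of the vertices in `A` with `c` and of those outside of `A` without `c`. A
vertex in one of the other two quarters has all its neighbors in the core: the missing cross edges
keep them on its own side of `A`, and the coloring gives them the other color. -/
theorem reach_of_halfJoin (hK : ∀ x y, K x y → K y x) (c A : X → Prop)
    (hc : ∀ x y, W x → W y → K x y → (c x ↔ ¬ c y))
    (hA : ∃ x, W x ∧ A x ∧ c x) (hR : ∃ x, W x ∧ ¬ A x ∧ ¬ c x)
    (hcross : ∀ x y, W x → W y → A x → ¬ A y → c x → ¬ c y → K x y)
    (hcross' : ∀ x y, W x → W y → A x → ¬ A y → ¬ c x → c y → ¬ K x y) (hconn : CutConn W K)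
    {x y : X} (hx : W x) (hy : W y) : Reach W K 5 x y := by
  obtain ⟨a, haW, ha, hac⟩ := hA
  obtain ⟨r, hrW, hr, hrc⟩ := hR
  have hne : a ≠ r := fun h => hr (h ▸ ha)
  have hnb : ∀ x, W x → ∃ z, W z ∧ K x z := fun x hx => by
    by_cases hxa : x = a
    · exact hconn.exists_adj hx hrW (hxa ▸ hne)
    · exact hconn.exists_adj hx haW hxa
  refine (reach_of_core hK (fun x => W x ∧ A x ∧ c x) (fun x => W x ∧ ¬ A x ∧ ¬ c x)
    (fun _ h => h.1) (fun _ h => h.1) ⟨a, haW, ha, hac⟩ ⟨r, hrW, hr, hrc⟩ ?_ ?_ hx hy).mono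
    (by norm_num)
  · rintro x y ⟨hx, hxA, hxc⟩ ⟨hy, hyA, hyc⟩
    exact hcross x y hx hy hxA hyA hxc hyc
  · intro x hx
    obtain ⟨w, hw, hxw⟩ := hnb x hx
    have h1 := hc x w hx hw hxw
    by_cases hxA : A x <;> by_cases hxc : c x
    · exact ⟨x, .inl ⟨hx, hxA, hxc⟩, .inl rfl⟩
    · have hwc : c w := by tauto
      have hwA : A w := by
        by_contra h
        exact hcross' x w hx hw hxA h hxc hwc hxw
      exact ⟨w, .inl ⟨hw, hwA, hwc⟩, .inr hxw⟩
    · have hwc : ¬ c w := by tauto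
      have hwA : ¬ A w := fun h => hcross' w x hw hx h hxA hwc hxc (hK _ _ hxw)
      exact ⟨w, .inr ⟨hw, hwA, hwc⟩, .inr hxw⟩
    · exact ⟨x, .inr ⟨hx, hxA, hxc⟩, .inl rfl⟩

end Reach

/-! ### Defining the classes of an ordered partition from their numbers modulo 3 -/

section Reach

variable {X : Type} {W : X → Prop} {K : X → X → Prop}

theorem Reach.weaken {W' : X → Prop} (hW : ∀ x, W x → W' x) {k : ℕ} {x y : X}
    (h : Reach W K k x y) : Reach W' K k x y := by
  induction k generalizing x with
  | zero => exact h
  | succ k ih => exact h.imp ih fun ⟨z, hz, hxz, h⟩ => ⟨z, hW z hz, hxz, ih h⟩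

variable (W K) in
/-- A vertex `x` with the property `c` and a vertex `y` without it cannot be separated by means of
vertices with other marks. -/
def Unseparated (c : X → Prop) (mk : Fin 3 → X → Prop) (m : Fin 3) (x y : X) : Prop :=
  (¬ ∃ p, W p ∧ ¬ c p ∧ mk (m + 1) p ∧ K x p ∧ ∃ q, W q ∧ c q ∧ mk (m + 2) q ∧ K q y ∧ ¬ K q p) ∧
  (¬ ∃ p, W p ∧ ¬ c p ∧ mk (m + 2) p ∧ ¬ K x p ∧ ∃ q, W q ∧ c q ∧ mk (m + 1) q ∧ ¬ K q y ∧ K q p)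

variable (W K) in
/-- The definition of the classes of an ordered partition of a half graph like bipartite graph from
their numbers modulo 3. -/
def SameMark (c : X → Prop) (mk : Fin 3 → X → Prop) (x y : X) : Prop :=
  ∃ m, mk m x ∧ mk m y ∧
    (c x → c y → ∀ z, W z → ¬ c z → ¬ mk m z → (K x z ↔ K y z)) ∧
    (¬ c x → ¬ c y → ∀ z, W z → c z → ¬ mk m z → (K z x ↔ K z y)) ∧
    (c x → ¬ c y → Unseparated W K c mk m x y) ∧
    (¬ c x → c y → Unseparated W K c mk m y x)

/-- Distinct indices that agree modulo 3 differ by at least 3. Hence there are two distinct classes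
strictly between them, and these provide `p` and `q`; the two clauses correspond to the two possible
orders of `x` and `y`. If the indices are equal, the marks ensure that all adjacencies involved
compare indices, and the resulting inequalities form an impossible cycle. -/
theorem unseparated_iff (c : X → Prop) (mk : Fin 3 → X → Prop) (idx : X → ℕ)
    (hmk : ∀ m x, W x → (mk m x ↔ idx x % 3 = m))
    (hK : ∀ x y, W x → W y → idx x ≠ idx y → c x → ¬ c y → (K x y ↔ idx x < idx y))
    (hc : ∀ x, W x → ∀ i < idx x, (∃ z, W z ∧ idx z = i ∧ c z) ∧ ∃ z, W z ∧ idx z = i ∧ ¬ c z)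
    {m : Fin 3} {x y : X} (hx : W x) (hy : W y) (hmx : mk m x) (hmy : mk m y) (hcx : c x)
    (hcy : ¬ c y) : Unseparated W K c mk m x y ↔ idx x = idx y := by
  have h1 : (m + 1 : Fin 3).val = (m.val + 1) % 3 := by simp [Fin.val_add]
  have h2 : (m + 2 : Fin 3).val = (m.val + 2) % 3 := by simp [Fin.val_add]
  have hm := m.isLt
  rw [hmk _ _ hx] at hmx
  rw [hmk _ _ hy] at hmy
  constructor
  · rintro ⟨ha, hb⟩
    by_contra hne
    rcases Nat.lt_or_gt_of_ne hne with h | h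
    · obtain ⟨-, p, hp, hpi, hpc⟩ := hc y hy (idx x + 1) (by omega)
      obtain ⟨⟨q, hq, hqi, hqc⟩, -⟩ := hc y hy (idx x + 2) (by omega)
      refine ha ⟨p, hp, hpc, (hmk _ _ hp).2 (by omega), (hK x p hx hp (by omega) hcx hpc).2
        (by omega), q, hq, hqc, (hmk _ _ hq).2 (by omega), (hK q y hq hy (by omega) hqc hcy).2
        (by omega), fun h' => ?_⟩
      have := (hK q p hq hp (by omega) hqc hpc).1 h'
      omega
    · obtain ⟨-, p, hp, hpi, hpc⟩ := hc x hx (idx x - 1) (by omega)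
      obtain ⟨⟨q, hq, hqi, hqc⟩, -⟩ := hc x hx (idx y + 1) (by omega)
      refine hb ⟨p, hp, hpc, (hmk _ _ hp).2 (by omega), fun h' => ?_, q, hq, hqc,
        (hmk _ _ hq).2 (by omega), fun h' => ?_, (hK q p hq hp (by omega) hqc hpc).2 (by omega)⟩
      · have := (hK x p hx hp (by omega) hcx hpc).1 h'
        omega
      · have := (hK q y hq hy (by omega) hqc hcy).1 h'
        omega
  · intro h
    constructor
    · rintro ⟨p, hp, hpc, hpm, hxp, q, hq, hqc, hqm, hqy, hqp⟩
      rw [hmk _ _ hp] at hpm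
      rw [hmk _ _ hq] at hqm
      rw [hK _ _ hx hp (by omega) hcx hpc] at hxp
      rw [hK _ _ hq hy (by omega) hqc hcy] at hqy
      rw [hK _ _ hq hp (by omega) hqc hpc] at hqp
      omega
    · rintro ⟨p, hp, hpc, hpm, hxp, q, hq, hqc, hqm, hqy, hqp⟩
      rw [hmk _ _ hp] at hpm
      rw [hmk _ _ hq] at hqm
      rw [hK _ _ hx hp (by omega) hcx hpc] at hxp
      rw [hK _ _ hq hy (by omega) hqc hcy] at hqy
      rw [hK _ _ hq hp (by omega) hqc hpc] at hqp
      omega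

/-- Nothing is known about adjacency inside a class, so only vertices with another mark, which are
in another class, serve as witnesses. Two vertices of the same color in different classes with the
same mark are told apart by a vertex of the other color in the class that follows the smaller index.
-/
theorem sameMark_iff (c : X → Prop) (mk : Fin 3 → X → Prop) (idx : X → ℕ)
    (hmk : ∀ m x, W x → (mk m x ↔ idx x % 3 = m))
    (hK : ∀ x y, W x → W y → idx x ≠ idx y → c x → ¬ c y → (K x y ↔ idx x < idx y))
    (hc : ∀ x, W x → ∀ i < idx x, (∃ z, W z ∧ idx z = i ∧ c z) ∧ ∃ z, W z ∧ idx z = i ∧ ¬ c z)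
    {x y : X} (hx : W x) (hy : W y) : SameMark W K c mk x y ↔ idx x = idx y := by
  constructor
  · rintro ⟨m, hmx, hmy, h1, h2, h3, h4⟩
    by_cases hcx : c x <;> by_cases hcy : c y
    · by_contra hne
      wlog hlt : idx x < idx y generalizing x y
      · exact this hy hx hmy hmx (fun h h' z hz hcz hmz => (h1 h' h z hz hcz hmz).symm)
          (fun h => absurd hcy h) (fun _ h => absurd hcx h) (fun h => absurd hcy h) hcy hcx
          (Ne.symm hne) (by omega)
      have hmx' := (hmk _ _ hx).1 hmx
      have hmy' := (hmk _ _ hy).1 hmy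
      obtain ⟨-, p, hp, hpi, hpc⟩ := hc y hy (idx x + 1) (by omega)
      have := h1 hcx hcy p hp hpc (fun h => by rw [hmk _ _ hp] at h; omega)
      rw [hK _ _ hx hp (by omega) hcx hpc, hK _ _ hy hp (by omega) hcy hpc] at this
      omega
    · exact (unseparated_iff c mk idx hmk hK hc hx hy hmx hmy hcx hcy).1 (h3 hcx hcy)
    · exact ((unseparated_iff c mk idx hmk hK hc hy hx hmy hmx hcy hcx).1 (h4 hcx hcy)).symm
    · by_contra hne
      wlog hlt : idx x < idx y generalizing x y
      · exact this hy hx hmy hmx (fun h => absurd h hcy)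
          (fun h h' z hz hcz hmz => (h2 h' h z hz hcz hmz).symm)
          (fun h => absurd h hcy) (fun _ h => absurd h hcx) hcy hcx
          (Ne.symm hne) (by omega)
      have hmx' := (hmk _ _ hx).1 hmx
      have hmy' := (hmk _ _ hy).1 hmy
      obtain ⟨⟨p, hp, hpi, hpc⟩, -⟩ := hc y hy (idx x + 1) (by omega)
      have := h2 hcx hcy p hp hpc (fun h => by rw [hmk _ _ hp] at h; omega)
      rw [hK _ _ hp hx (by omega) hpc hcx, hK _ _ hp hy (by omega) hpc hcy] at this
      omega
  · intro h
    have hmx : mk ⟨idx x % 3, by omega⟩ x := (hmk _ _ hx).2 rfl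
    have hmy : mk ⟨idx x % 3, by omega⟩ y := (hmk _ _ hy).2 (congrArg (· % 3) h.symm)
    have hne : ∀ z, W z → ¬ mk ⟨idx x % 3, by omega⟩ z → idx x ≠ idx z := fun z hz hmz h' =>
      hmz ((hmk _ _ hz).2 (by simp [h']))
    refine ⟨⟨idx x % 3, by omega⟩, hmx, hmy, fun hcx hcy z hz hcz hmz => ?_,
      fun hcx hcy z hz hcz hmz => ?_,
      fun hcx hcy => (unseparated_iff c mk idx hmk hK hc hx hy hmx hmy hcx hcy).2 h,
      fun hcx hcy => (unseparated_iff c mk idx hmk hK hc hy hx hmy hmx hcy hcx).2 h.symm⟩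
    · have := hne z hz hmz
      rw [hK _ _ hx hz this hcx hcz, hK _ _ hy hz (h ▸ this) hcy hcz, h]
    · have := hne z hz hmz
      rw [hK _ _ hz hx this.symm hcz hcx, hK _ _ hz hy (h ▸ this.symm) hcz hcy, h]

section Map

variable {Y : Type} {W' : Y → Prop} {K' : Y → Y → Prop} {g : X → Y}

theorem exists_and_map (hW : ∀ y, W' y ↔ ∃ x, W x ∧ g x = y) {P : X → Prop} {P' : Y → Prop}
    (h : ∀ x, W x → (P' (g x) ↔ P x)) : (∃ y, W' y ∧ P' y) ↔ ∃ x, W x ∧ P x := by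
  constructor
  · rintro ⟨y, hy, hP⟩
    obtain ⟨x, hx, rfl⟩ := (hW y).1 hy
    exact ⟨x, hx, (h x hx).1 hP⟩
  · rintro ⟨x, hx, hP⟩
    exact ⟨g x, (hW _).2 ⟨x, hx, rfl⟩, (h x hx).2 hP⟩

theorem forall_map (hW : ∀ y, W' y ↔ ∃ x, W x ∧ g x = y) {P : X → Prop} {P' : Y → Prop}
    (h : ∀ x, W x → (P' (g x) ↔ P x)) : (∀ y, W' y → P' y) ↔ ∀ x, W x → P x := by
  constructor
  · exact fun hP x hx => (h x hx).1 (hP _ ((hW _).2 ⟨x, hx, rfl⟩))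
  · intro hP y hy
    obtain ⟨x, hx, rfl⟩ := (hW y).1 hy
    exact (h x hx).2 (hP x hx)

variable (hW : ∀ y, W' y ↔ ∃ x, W x ∧ g x = y)
  (hK : ∀ x y, W x → W y → (K' (g x) (g y) ↔ K x y)) {c : X → Prop} {c' : Y → Prop}
  (hc : ∀ x, W x → (c' (g x) ↔ c x)) {mk : Fin 3 → X → Prop} {mk' : Fin 3 → Y → Prop}
  (hmk : ∀ m x, W x → (mk' m (g x) ↔ mk m x))

include hW hK hc hmk

theorem unseparated_map {m : Fin 3} {x y : X} (hx : W x) (hy : W y) :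
    Unseparated W' K' c' mk' m (g x) (g y) ↔ Unseparated W K c mk m x y := by
  refine and_congr (not_congr ?_) (not_congr ?_) <;>
  · refine exists_and_map hW fun p hp => and_congr (not_congr (hc p hp)) (and_congr (hmk _ p hp) ?_)
    refine and_congr (by rw [hK x p hx hp]) (exists_and_map hW fun q hq => ?_)
    rw [hc q hq, hmk _ q hq, hK q y hq hy, hK q p hq hp]

theorem sameMark_map {x y : X} (hx : W x) (hy : W y) :
    SameMark W' K' c' mk' (g x) (g y) ↔ SameMark W K c mk x y := by
  refine exists_congr fun m => ?_
  rw [hmk m x hx, hmk m y hy, hc x hx, hc y hy, unseparated_map hW hK hc hmk hx hy,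
    unseparated_map hW hK hc hmk hy hx]
  refine and_congr_right fun _ => and_congr_right fun _ => and_congr ?_ (and_congr_left' ?_)
  · refine imp_congr Iff.rfl (imp_congr Iff.rfl (forall_map hW fun z hz => ?_))
    rw [hc z hz, hmk m z hz, hK x z hx hz, hK y z hy hz]
  · refine imp_congr Iff.rfl (imp_congr Iff.rfl (forall_map hW fun z hz => ?_))
    rw [hc z hz, hmk m z hz, hK z x hz hx, hK z y hz hy]

end Map

end Reach

/-! ### Siblings in clean trees -/

namespace TModel

variable {S : Type} {T : TModel S}

theorem isGLB_of_covBy {u a b x y : T.Node} (hab : a ≠ b) (ha : u ⋖ a) (hb : u ⋖ b) (hx : a ≤ x)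
    (hy : b ≤ y) : IsGLB {x, y} u := by
  refine ⟨by simp [lowerBounds, ha.le.trans hx, hb.le.trans hy], fun z hz => ?_⟩
  have hz : z ≤ x ∧ z ≤ y := by simpa [lowerBounds] using hz
  rcases T.chain z a x hz.1 hx with h | h
  · rcases h.lt_or_eq with h | rfl
    · exact le_of_lt_of_covBy ha h
    · exact (hab (child_unique ha hb hz.2 hy)).elim
  · exact (hab (child_unique ha hb (h.trans hz.2) hy)).elim

theorem not_isMax_of_covBy {u a : T.Node} (h : u ⋖ a) : ¬ IsMax u := fun h' => h'.not_lt h.lt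

theorem ne_of_covBy {u a b : T.Node} (hab : a ≠ b) (ha : u ⋖ a) (hb : u ⋖ b) {s t : S}
    (hs : a ≤ T.leaf s) (ht : b ≤ T.leaf t) : s ≠ t := by
  rintro rfl
  exact hab (child_unique ha hb hs ht)

theorem exists_child_of_mem_leaves {u : T.Node} (hu : ¬ IsMax u) {s : S} (hs : s ∈ T.leaves u) :
    ∃ a, u ⋖ a ∧ a ≤ T.leaf s := by
  refine exists_child_of_lt (lt_of_le_of_ne hs ?_)
  rintro rfl
  exact hu (T.isMax_leaf s)

theorem adj_iff_of_isGLB_of_isCotree (hT : T.IsCotree) {s t : S} (hst : s ≠ t) {m : T.Node}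
    (hm : IsGLB {T.leaf s, T.leaf t} m) : T.graph.Adj s t ↔ T.label m = .J := by
  have hm' : IsGLB {T.leaf t, T.leaf s} m := Set.pair_comm _ _ ▸ hm
  change s ≠ t ∧ (_ ∨ _) ↔ _
  rw [joins_iff_of_isCotree hT hst, joins_iff_of_isCotree hT hst.symm]
  constructor
  · rintro ⟨-, ⟨x, hx, h⟩ | ⟨x, hx, h⟩⟩
    · rwa [hm.unique hx]
    · rwa [hm'.unique hx]
  · exact fun h => ⟨hst, .inl ⟨m, hm, h⟩⟩

theorem adj_iff_of_isGLB_of_isBicotree (hT : T.IsBicotree) {s t : S} (hst : s ≠ t) {m : T.Node}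
    (hm : IsGLB {T.leaf s, T.leaf t} m) : T.graph.Adj s t ↔
      T.label m = .B ∧ T.color s ≠ T.color t ∨ T.label m = .O ∧
        ((T.color s = 0 ∧ T.color t = 1 ∧ ∃ x y, x ≤ T.leaf s ∧ y ≤ T.leaf t ∧ T.tri x y) ∨
          T.color t = 0 ∧ T.color s = 1 ∧ ∃ x y, x ≤ T.leaf t ∧ y ≤ T.leaf s ∧ T.tri x y) := by
  have hm' : IsGLB {T.leaf t, T.leaf s} m := Set.pair_comm _ _ ▸ hm
  change s ≠ t ∧ (_ ∨ _) ↔ _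
  rw [joins_iff_of_isBicotree hT hst, joins_iff_of_isBicotree hT hst.symm]
  constructor
  · rintro ⟨-, ⟨x, hx, h⟩ | ⟨x, hx, h⟩⟩
    · rw [hm.unique hx]
      exact h.imp id fun h => ⟨h.1, .inl h.2⟩
    · rw [hm'.unique hx]
      exact h.imp (fun h => ⟨h.1, h.2.symm⟩) fun h => ⟨h.1, .inr h.2⟩
  · rintro (h | ⟨h, h' | h'⟩)
    · exact ⟨hst, .inl ⟨m, hm, .inl h⟩⟩
    · exact ⟨hst, .inl ⟨m, hm, .inr ⟨h, h'⟩⟩⟩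
    · exact ⟨hst, .inr ⟨m, hm', .inr ⟨h, h'⟩⟩⟩

section Children

variable (hT : T.IsBicotree) {u a b : T.Node} (hab : a ≠ b) (ha : u ⋖ a) (hb : u ⋖ b) {s t : S}
  (hs : a ≤ T.leaf s) (ht : b ≤ T.leaf t)
include hT hab ha hb hs ht

theorem not_adj_of_label_U (hu : T.label u = .U) : ¬ T.graph.Adj s t := by
  rw [adj_iff_of_isGLB_of_isBicotree hT (ne_of_covBy hab ha hb hs ht)
    (isGLB_of_covBy hab ha hb hs ht)]
  simp [hu]

theorem adj_iff_of_label_B (hu : T.label u = .B) : T.graph.Adj s t ↔ T.color s ≠ T.color t := by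
  rw [adj_iff_of_isGLB_of_isBicotree hT (ne_of_covBy hab ha hb hs ht)
    (isGLB_of_covBy hab ha hb hs ht)]
  simp [hu]

theorem adj_iff_of_label_O (hu : T.label u = .O) (hcs : T.color s = 0) (hct : T.color t = 1) :
    T.graph.Adj s t ↔ T.tri a b := by
  rw [adj_iff_of_isGLB_of_isBicotree hT (ne_of_covBy hab ha hb hs ht)
    (isGLB_of_covBy hab ha hb hs ht)]
  simp only [hu, hcs, hct, reduceCtorEq, false_and, false_or, true_and, Fin.one_eq_zero_iff,
    OfNat.ofNat_ne_one, or_false]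
  constructor
  · rintro ⟨x, y, hx, hy, h⟩
    obtain ⟨-, hx', hy'⟩ := covBy_of_tri (isGLB_of_covBy hab ha hb hs ht) hx hy h
    rwa [child_unique ha hx' hs hx, child_unique hb hy' ht hy]
  · exact fun h => ⟨a, b, hs, ht, h⟩

end Children

/-- A walk that connects the two sides of the cut has an edge that leaves the side `Z` of the leaves
above `v`. Both ends of an edge are above the same child of `u`, so this edge stays above `v` and
crosses the cut. -/
theorem cutConn_of_childrenAreComponents {K : SimpleGraph S} {u v : T.Node}
    (h : T.ChildrenAreComponents K u) (huv : u ⋖ v) : CutConn (· ∈ T.leaves v) K.Adj := by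
  rintro Z ⟨x, hx, hxZ⟩ ⟨y, hy, hyZ⟩
  have hle : ∀ {s}, s ∈ T.leaves v → s ∈ T.leaves u := fun hs => huv.le.trans hs
  obtain ⟨p⟩ := (h ⟨x, hle hx⟩ ⟨y, hle hy⟩).2 ⟨v, huv, hx, hy⟩
  obtain ⟨d, -, hd1, hd2⟩ := p.exists_boundary_dart {s | s.1 ∈ T.leaves v ∧ Z s.1} ⟨hx, hxZ⟩
    fun h => hyZ h.2
  obtain ⟨w, hw, hw1, hw2⟩ := (h d.fst d.snd).1 d.adj.reachable
  obtain rfl := child_unique hw huv hw1 hd1.1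
  exact ⟨d.fst, d.snd, hd1.1, hw2, hd1.2, fun h => hd2 ⟨hw2, h⟩, d.adj⟩

theorem leaves_of_forall_covBy {u a : T.Node} (ha : u ⋖ a) (h : ∀ b, u ⋖ b → b = a) :
    T.leaves u = T.leaves a := by
  ext s
  constructor
  · intro hs
    obtain ⟨b, hb, hbs⟩ := exists_child_of_mem_leaves (not_isMax_of_covBy ha) hs
    exact h b hb ▸ hbs
  · exact fun hs => ha.le.trans hs

theorem exists_tri_minimal (hT : T.IsBicotree) {u : T.Node} (hu : ¬ IsMax u) (hl : T.label u = .O) :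
    ∃ a, u ⋖ a ∧ ∀ b, u ⋖ b → b ≠ a → T.tri a b := by
  have hC : u ∈ T.C := by
    rcases hT u hu with ⟨-, h⟩ | ⟨-, h⟩ | ⟨h, -⟩
    · simp [h] at hl
    · simp [h] at hl
    · exact h
  have : IsTrans T.Node T.tri := ⟨T.tri_trans⟩
  have : Std.Irrefl T.tri := ⟨T.tri_irrefl⟩
  obtain ⟨s, hs⟩ := T.exists_leaf_ge u
  obtain ⟨c, hc, -⟩ := exists_child_of_mem_leaves hu hs
  obtain ⟨a, ha, hmin⟩ := (Finite.wellFounded_of_trans_of_irrefl T.tri).has_min {a | u ⋖ a} ⟨c, hc⟩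
  exact ⟨a, ha, fun b hb hba =>
    ((T.tri_comparable a b hba.symm).2 ⟨u, hC, ha, hb⟩).resolve_right (hmin b hb)⟩

theorem color_eq_one_iff {c : Fin 2} : c = 1 ↔ ¬ c = 0 := by
  revert c
  decide

theorem color_ne_iff {c d : Fin 2} : c ≠ d ↔ (c = 0 ↔ ¬ d = 0) := by
  revert c d
  decide

theorem color_ne_iff' {c d : Fin 2} : c ≠ d ↔ (c = 1 ↔ ¬ d = 1) := by
  revert c d
  decide

/-- Connected subtrees of clean bicotrees have small diameter. -/
theorem reach_of_cutConn (hT : T.IsBicotree) (hc : T.CleanBicotree) {K : SimpleGraph S}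
    (hK : K = T.graph ∨ K = T.bipCompl) (u : T.Node) (hu : CutConn (· ∈ T.leaves u) K.Adj) {s t : S}
    (hs : s ∈ T.leaves u) (ht : t ∈ T.leaves u) : Reach (· ∈ T.leaves u) K.Adj 5 s t := by
  have hsymm : ∀ x y, K.Adj x y → K.Adj y x := fun x y h => h.symm
  have hcol : ∀ x y, K.Adj x y → T.color x ≠ T.color y := by
    rcases hK with rfl | rfl
    · exact fun x y h => color_ne_of_adj hT h
    · exact fun x y h => h.1
  induction u using WellFoundedGT.induction with
  | ind u ih =>
  by_cases hmax : IsMax u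
  · have h1 := le_antisymm hs (hmax hs)
    have h2 := le_antisymm ht (hmax ht)
    rw [T.leaf_injective (h1.symm.trans h2)]
    exact Reach.mono (k := 0) (by norm_num) rfl
  obtain ⟨a₀, ha₀, -⟩ := exists_child_of_mem_leaves hmax hs
  -- A node with a single child has the same leaves as this child. Clean bicotrees may contain such
  -- nodes.
  by_cases h1 : ∀ b, u ⋖ b → b = a₀
  · rw [leaves_of_forall_covBy ha₀ h1] at hu hs ht ⊢
    exact ih a₀ ha₀.lt hu hs ht
  push Not at h1
  obtain ⟨b₀, hb₀, hab₀⟩ := h1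
  have hb' : ∀ a x, u ⋖ a → x ∈ T.leaves u → ¬ a ≤ T.leaf x → ∃ b, u ⋖ b ∧ b ≠ a ∧ b ≤ T.leaf x := by
    intro a x ha hx hax
    obtain ⟨b, hb, hbx⟩ := exists_child_of_mem_leaves hmax hx
    exact ⟨b, hb, fun h => hax (h ▸ hbx), hbx⟩
  have hle : ∀ {a}, u ⋖ a → ∀ s, a ≤ T.leaf s → s ∈ T.leaves u := fun ha s hs => ha.le.trans hs
  obtain ⟨x₀, hx₀⟩ := T.exists_leaf_ge a₀
  obtain ⟨y₀, hy₀⟩ := T.exists_leaf_ge b₀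
  have hy₀' : ¬ a₀ ≤ T.leaf y₀ := fun h => hab₀ (child_unique hb₀ ha₀ hy₀ h)
  have hR : ∃ x, x ∈ T.leaves u ∧ ¬ a₀ ≤ T.leaf x := ⟨y₀, hle hb₀ _ hy₀, hy₀'⟩
  have hA : ∃ x, x ∈ T.leaves u ∧ a₀ ≤ T.leaf x := ⟨x₀, hle ha₀ _ hx₀, hx₀⟩
  -- The leaves above one child are set against all others. This is a join as soon as leaves above
  -- different children are adjacent whenever their colors differ.
  have join : (∀ x y, x ∈ T.leaves u → y ∈ T.leaves u → a₀ ≤ T.leaf x → ¬ a₀ ≤ T.leaf y →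
      T.color x ≠ T.color y → K.Adj x y) → Reach (· ∈ T.leaves u) K.Adj 5 s t := fun h =>
    reach_of_join hsymm (fun x => T.color x = 0) (fun x => a₀ ≤ T.leaf x)
      (fun x y _ _ h => color_ne_iff.1 (hcol x y h)) hA hR
      (fun x y hx hy hxA hyA h' => h x y hx hy hxA hyA (color_ne_iff.2 h')) hu hs ht
  -- At a U-node the graph itself, and at a B-node its bipartite complement, has no edge between
  -- different children, which contradicts connectedness. In the two other cases the graph in
  -- question is a join.
  rcases hT u hmax with ⟨-, hl⟩ | ⟨-, hl⟩ | ⟨-, hl⟩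
  · rcases hK with rfl | rfl
    · obtain ⟨x, y, hx, hy, hxA, hyA, h⟩ := hu (fun x => a₀ ≤ T.leaf x) hA hR
      obtain ⟨b, hb, hba, hby⟩ := hb' a₀ y ha₀ hy hyA
      exact (not_adj_of_label_U hT hba.symm ha₀ hb hxA hby hl h).elim
    · refine join fun x y hx hy hxA hyA h => ⟨h, ?_⟩
      obtain ⟨b, hb, hba, hby⟩ := hb' a₀ y ha₀ hy hyA
      exact not_adj_of_label_U hT hba.symm ha₀ hb hxA hby hl
  · rcases hK with rfl | rfl
    · refine join fun x y hx hy hxA hyA h => ?_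
      obtain ⟨b, hb, hba, hby⟩ := hb' a₀ y ha₀ hy hyA
      exact (adj_iff_of_label_B hT hba.symm ha₀ hb hxA hby hl).2 h
    · obtain ⟨x, y, hx, hy, hxA, hyA, h⟩ := hu (fun x => a₀ ≤ T.leaf x) hA hR
      obtain ⟨b, hb, hba, hby⟩ := hb' a₀ y ha₀ hy hyA
      exact (h.2 ((adj_iff_of_label_B hT hba.symm ha₀ hb hxA hby hl).2 h.1)).elim
  -- At an O-node the first child is set against the others: its leaves of color 0 are adjacent to
  -- all other leaves of color 1, its leaves of color 1 to no other leaf of color 0. By cleanness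
  -- both colors occur above each child.
  · obtain ⟨a, ha, hmin⟩ := exists_tri_minimal hT hmax hl
    obtain ⟨b, hb, hba⟩ : ∃ b, u ⋖ b ∧ b ≠ a := by
      by_cases h : a₀ = a
      · exact ⟨b₀, hb₀, h ▸ hab₀⟩
      · exact ⟨a₀, ha₀, h⟩
    have hO := (hc u hmax).2.2 hl
    have hadj : ∀ x y, y ∈ T.leaves u → a ≤ T.leaf x → ¬ a ≤ T.leaf y → T.color x = 0 →
        T.color y = 1 → T.graph.Adj x y := by
      intro x y hy hxA hyA hx0 hy1
      obtain ⟨b, hb, hba, hby⟩ := hb' a y ha hy hyA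
      exact (adj_iff_of_label_O hT hba.symm ha hb hxA hby hl hx0 hy1).2 (hmin b hb hba)
    have hnadj : ∀ x y, y ∈ T.leaves u → a ≤ T.leaf x → ¬ a ≤ T.leaf y → T.color x = 1 →
        T.color y = 0 → ¬ T.graph.Adj x y := by
      intro x y hy hxA hyA hx0 hy1 h
      obtain ⟨b, hb, hba, hby⟩ := hb' a y ha hy hyA
      have := (adj_iff_of_label_O hT hba hb ha hby hxA hl hy1 hx0).1 h.symm
      exact T.tri_irrefl _ (T.tri_trans _ _ _ this (hmin b hb hba))
    have hnb : ∀ y, b ≤ T.leaf y → ¬ a ≤ T.leaf y := fun y hy h => hba (child_unique hb ha hy h)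
    rcases hK with rfl | rfl
    · obtain ⟨x, hx, hxc⟩ := hO a ha 0
      obtain ⟨y, hy, hyc⟩ := hO b hb 1
      refine reach_of_halfJoin hsymm (fun x => T.color x = 0) (fun x => a ≤ T.leaf x)
        (fun x y _ _ h => color_ne_iff.1 (hcol x y h)) ⟨x, hle ha _ hx, hx, hxc⟩
        ⟨y, hle hb _ hy, hnb y hy, color_eq_one_iff.1 hyc⟩ ?_ ?_ hu hs ht
      · exact fun x y hx hy hxA hyA hxc hyc => hadj x y hy hxA hyA hxc (color_eq_one_iff.2 hyc)
      · exact fun x y hx hy hxA hyA hxc hyc => hnadj x y hy hxA hyA (color_eq_one_iff.2 hxc) hyc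
    -- In the bipartite complement the two colors exchange their roles.
    · obtain ⟨x, hx, hxc⟩ := hO a ha 1
      obtain ⟨y, hy, hyc⟩ := hO b hb 0
      have h0 : ∀ {c : Fin 2}, ¬ c = 1 → c = 0 := fun h => by
        rw [color_eq_one_iff] at h
        exact not_not.1 h
      refine reach_of_halfJoin hsymm (fun x => T.color x = 1) (fun x => a ≤ T.leaf x)
        (fun x y _ _ h => color_ne_iff'.1 (hcol x y h)) ⟨x, hle ha _ hx, hx, hxc⟩
        ⟨y, hle hb _ hy, hnb y hy, by simp [hyc]⟩ ?_ ?_ hu hs ht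
      · exact fun x y hx hy hxA hyA hxc hyc => ⟨by rw [hxc, h0 hyc]; decide,
          hnadj x y hy hxA hyA hxc (h0 hyc)⟩
      · exact fun x y hx hy hxA hyA hxc hyc h => h.2 (hadj x y hy hxA hyA (h0 hxc) hyc)

/-- The leaves `s` and `t` are above the same child of `u`. -/
def SameChild (T : TModel S) (u : T.Node) (s t : S) : Prop :=
  ∃ c, u ⋖ c ∧ c ≤ T.leaf s ∧ c ≤ T.leaf t

theorem SameChild.trans {u : T.Node} {r s t : S} (h : T.SameChild u r s) (h' : T.SameChild u s t) :
    T.SameChild u r t := by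
  obtain ⟨c, hc, hr, hs⟩ := h
  obtain ⟨d, hd, hs', ht⟩ := h'
  obtain rfl := child_unique hc hd hs hs'
  exact ⟨c, hc, hr, ht⟩

theorem sameChild_self {u : T.Node} (hu : ¬ IsMax u) {s : S} (hs : s ∈ T.leaves u) :
    T.SameChild u s s := by
  obtain ⟨c, hc, hcs⟩ := exists_child_of_mem_leaves hu hs
  exact ⟨c, hc, hcs, hcs⟩

/-- Edges of `K` never connect leaves above different children of `u`, whereas the leaves above one
child are connected and thus at distance at most 5 by `reach_of_cutConn`. -/
theorem sameChild_iff_reach (hT : T.IsBicotree) (hc : T.CleanBicotree) {K : SimpleGraph S}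
    (hK : K = T.graph ∨ K = T.bipCompl) {u : T.Node} (hu : ¬ IsMax u)
    (hKu : T.ChildrenAreComponents K u) {s t : S} (hs : s ∈ T.leaves u) :
    T.SameChild u s t ↔ Reach (· ∈ T.leaves u) K.Adj 5 s t := by
  constructor
  · rintro ⟨c, hc', hs, ht⟩
    exact (reach_of_cutConn hT hc hK c (cutConn_of_childrenAreComponents hKu hc') hs ht).weaken
      fun x hx => hc'.le.trans hx
  · intro h
    refine h.closed (fun x => T.SameChild u s x) (fun a b ha hb hab h => h.trans ?_) hs
      (sameChild_self hu hs)
    have hab' : (K.induce (T.leaves u)).Adj ⟨a, ha⟩ ⟨b, hb⟩ := hab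
    exact (hKu ⟨a, ha⟩ ⟨b, hb⟩).1 hab'.reachable

/-- The labels alternate, so leaves above different children of a child `c` of `u` are related by
`K`; leaves above the same child of `c` are joined through a leaf above another one. Leaves above
different children of `u` are not related. Two steps would do; the bound 5 is the one used for
bicotrees. -/
theorem sameChild_iff_reach_of_isCotree (hc : T.CleanCotree) {u : T.Node} (hu : ¬ IsMax u)
    {K : S → S → Prop} (hK : ∀ s t m, s ≠ t → IsGLB {T.leaf s, T.leaf t} m →
      (K s t ↔ T.label m ≠ T.label u)) {s t : S} (hs : s ∈ T.leaves u) :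
    T.SameChild u s t ↔ Reach (· ∈ T.leaves u) K 5 s t := by
  constructor
  · rintro ⟨c, huc, hs, ht⟩
    by_cases hcm : IsMax c
    · have h1 := le_antisymm hs (hcm hs)
      have h2 := le_antisymm ht (hcm ht)
      rw [T.leaf_injective (h1.symm.trans h2)]
      exact Reach.mono (k := 0) (by norm_num) rfl
    have hle : ∀ {z}, c ≤ T.leaf z → z ∈ T.leaves u := fun h => huc.le.trans h
    have hadj : ∀ a b, c ⋖ a → c ⋖ b → a ≠ b → ∀ x y, a ≤ T.leaf x → b ≤ T.leaf y → K x y :=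
      fun a b ha hb hab x y hx hy =>
        (hK x y c (ne_of_covBy hab ha hb hx hy) (isGLB_of_covBy hab ha hb hx hy)).2
          (hc.2 u c huc hcm).symm
    obtain ⟨a, ha, has⟩ := exists_child_of_mem_leaves hcm hs
    obtain ⟨b, hb, hbt⟩ := exists_child_of_mem_leaves hcm ht
    by_cases hab : a = b
    · subst hab
      obtain ⟨d, hd, hda⟩ : ∃ d, c ⋖ d ∧ d ≠ a := by
        obtain ⟨d, e, hde, hd, he⟩ := hc.1 c hcm
        by_cases h : d = a
        · exact ⟨e, he, h ▸ hde.symm⟩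
        · exact ⟨d, hd, h⟩
      obtain ⟨z, hz⟩ := T.exists_leaf_ge d
      exact ((Reach.single (W := (· ∈ T.leaves u)) (hle (hd.le.trans hz)) (hadj a d ha hd hda.symm s z has hz)).trans
        (Reach.single (W := (· ∈ T.leaves u)) (hle ht) (hadj d a hd ha hda z t hz hbt))).mono (by norm_num)
    · exact (Reach.single (W := (· ∈ T.leaves u)) (hle ht) (hadj a b ha hb hab s t has hbt)).mono (by norm_num)
  · intro h
    refine h.closed (fun x => T.SameChild u s x) (fun x y hx hy hxy h => h.trans ?_) hs
      (sameChild_self hu hs)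
    obtain ⟨a, ha, hax⟩ := exists_child_of_mem_leaves hu hx
    obtain ⟨b, hb, hby⟩ := exists_child_of_mem_leaves hu hy
    by_cases hab : a = b
    · exact ⟨a, ha, hax, hab ▸ hby⟩
    · exact ((hK x y u (ne_of_covBy hab ha hb hax hby) (isGLB_of_covBy hab ha hb hax hby)).1 hxy
        rfl).elim

/-- The number of siblings before a child of an ordered node. -/
noncomputable def index (T : TModel S) (x : T.Node) : ℕ := {y | T.tri y x}.ncard

theorem index_lt {x y : T.Node} (h : T.tri x y) : T.index x < T.index y :=
  Set.ncard_lt_ncard ⟨fun z hz => T.tri_trans z x y hz h, fun h' => T.tri_irrefl x (h' h)⟩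
    (Set.toFinite _)

theorem index_lt_iff {u x y : T.Node} (hu : u ∈ T.C) (hx : u ⋖ x) (hy : u ⋖ y) :
    T.index x < T.index y ↔ T.tri x y := by
  refine ⟨fun h => ?_, index_lt⟩
  have hne : x ≠ y := fun e => h.ne (e ▸ rfl)
  exact ((T.tri_comparable x y hne).2 ⟨u, hu, hx, hy⟩).resolve_right fun h' => h.asymm (index_lt h')

theorem index_inj {u x y : T.Node} (hu : u ∈ T.C) (hx : u ⋖ x) (hy : u ⋖ y)
    (h : T.index x = T.index y) : x = y := by
  by_contra hne
  rcases (T.tri_comparable x y hne).2 ⟨u, hu, hx, hy⟩ with h' | h'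
  · exact (index_lt h').ne h
  · exact (index_lt h').ne' h

/-- The index is injective on the siblings before `x`. There are `T.index x` of them, with indices
smaller than this number, so by counting all smaller values occur. -/
theorem exists_index_eq {u x : T.Node} (hx : u ⋖ x) : ∀ i < T.index x,
    ∃ y, u ⋖ y ∧ T.index y = i := by
  have hsib : ∀ y, T.tri y x → u ∈ T.C ∧ u ⋖ y := fun y hy => by
    have hne : y ≠ x := fun e => T.tri_irrefl x (e ▸ hy)
    obtain ⟨p, hp, hpy, hpx⟩ := (T.tri_comparable y x hne).1 (.inl hy)
    obtain rfl := covBy_unique hpx hx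
    exact ⟨hp, hpy⟩
  have hinj : Set.InjOn T.index {y | T.tri y x} := fun y hy z hz h =>
    index_inj (hsib y hy).1 (hsib y hy).2 (hsib z hz).2 h
  have := Set.eq_of_subset_of_ncard_le (s := T.index '' {y | T.tri y x}) (t := Set.Iio (T.index x))
    (by rintro _ ⟨y, hy, rfl⟩; exact index_lt hy)
    (by rw [hinj.ncard_image, ← Finset.coe_Iio, Set.ncard_coe_finset, Nat.card_Iio]; rfl)
    (Set.toFinite _)
  intro i hi
  obtain ⟨y, hy, rfl⟩ := this.ge hi
  exact ⟨y, (hsib y hy).2, rfl⟩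

/-- The children of an O-node form an ordered partition to which `sameMark_iff` applies: across
children adjacency compares positions, and by cleanness every child has leaves of both colors. -/
theorem sameChild_iff_sameMark (hT : T.IsBicotree) (hc : T.CleanBicotree) {u : T.Node}
    (hu : ¬ IsMax u) (hl : T.label u = .O) {mk : Fin 3 → S → Prop}
    (hmk : ∀ m a s, u ⋖ a → a ≤ T.leaf s → (mk m s ↔ T.index a % 3 = m)) {s t : S}
    (hs : s ∈ T.leaves u) (ht : t ∈ T.leaves u) :
    T.SameChild u s t ↔
      SameMark (· ∈ T.leaves u) T.graph.Adj (fun s => T.color s = 0) mk s t := by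
  classical
  have hC : u ∈ T.C := by
    rcases hT u hu with ⟨-, h⟩ | ⟨-, h⟩ | ⟨h, -⟩
    · simp [h] at hl
    · simp [h] at hl
    · exact h
  choose f hf hfs using fun s (hs : s ∈ T.leaves u) => exists_child_of_mem_leaves hu hs
  -- The value 0 outside of the subtree is never consulted.
  let idx : S → ℕ := fun s => if h : s ∈ T.leaves u then T.index (f s h) else 0
  have hidx : ∀ a s, u ⋖ a → a ≤ T.leaf s → idx s = T.index a := by
    intro a s ha has
    have hs : s ∈ T.leaves u := ha.le.trans has
    simp only [idx, dif_pos hs]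
    rw [child_unique (hf s hs) ha (hfs s hs) has]
  rw [sameMark_iff (fun s => T.color s = 0) mk idx ?_ ?_ ?_ hs ht]
  · constructor
    · rintro ⟨c, hc, h1, h2⟩
      rw [hidx c s hc h1, hidx c t hc h2]
    · intro h
      rw [hidx _ s (hf s hs) (hfs s hs), hidx _ t (hf t ht) (hfs t ht)] at h
      have := index_inj hC (hf s hs) (hf t ht) h
      exact ⟨f s hs, hf s hs, hfs s hs, this ▸ hfs t ht⟩
  · intro m x hx
    rw [hmk m _ x (hf x hx) (hfs x hx), hidx _ x (hf x hx) (hfs x hx)]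
  · intro x y hx hy hne hcx hcy
    rw [hidx _ x (hf x hx) (hfs x hx), hidx _ y (hf y hy) (hfs y hy)] at hne ⊢
    rw [index_lt_iff hC (hf x hx) (hf y hy)]
    exact adj_iff_of_label_O hT (fun h => hne (congrArg T.index h)) (hf x hx) (hf y hy) (hfs x hx) (hfs y hy)
      hl hcx (color_eq_one_iff.2 hcy)
  · intro x hx i hi
    rw [hidx _ x (hf x hx) (hfs x hx)] at hi
    obtain ⟨y, hy, rfl⟩ := exists_index_eq (hf x hx) i hi
    obtain ⟨p, hp, hpc⟩ := (hc u hu).2.2 hl y hy 0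
    obtain ⟨q, hq, hqc⟩ := (hc u hu).2.2 hl y hy 1
    exact ⟨⟨p, hy.le.trans hp, hidx y p hy hp, hpc⟩,
      q, hy.le.trans hq, hidx y q hy hq, color_eq_one_iff.1 hqc⟩

end TModel

/-! ### Defining the nodes of clean trees in the graph -/

/-- Kinds of marks of the leaves of a tree, for given depth `d`: the leaf has depth at least `d`; the
leaf has depth `d`; the leaf represents its ancestor at depth `d`; the label of this ancestor; its
number modulo 3 among its siblings. -/
inductive MarkKind
  | deep
  | leaf
  | rep
  | label (l : NodeLabel)
  | index (m : Fin 3)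

instance : Finite MarkKind :=
  Finite.of_surjective (α := Fin 3 ⊕ NodeLabel ⊕ Fin 3)
    (Sum.elim ![.deep, .leaf, .rep] (Sum.elim .label .index)) fun r =>
    match r with
    | .deep => ⟨.inl 0, rfl⟩
    | .leaf => ⟨.inl 1, rfl⟩
    | .rep => ⟨.inl 2, rfl⟩
    | .label l => ⟨.inr (.inl l), rfl⟩
    | .index m => ⟨.inr (.inr m), rfl⟩

/-- Marks for the vertices: the part, and a mark for each piece and each depth. -/
abbrev Mark (n H : ℕ) : Type := Fin n ⊕ (PieceIdx n × Fin (H + 1) × MarkKind)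

/-- The signature of graphs with marked vertices. -/
abbrev markLang (n H : ℕ) : FirstOrder.Language.{0, 0} := binLang (Mark n H) Unit

namespace Marked

variable {n H : ℕ}

/-- The marks of given kind for the piece `a` and the depth `d`. -/
def Has (k : MarkKind) (a : PieceIdx n) (d : ℕ) (M : FinStr (markLang n H)) (x : M) : Prop :=
  M.un (.inr (a, Fin.ofNat (H + 1) d, k)) x

/-- The first color class of a piece. -/
def Col (a : PieceIdx n) (M : FinStr (markLang n H)) (x : M) : Prop :=
  match a with
  | .inl _ => True
  | .inr p => M.un (.inl p.1.1) x

/-- The graph modeled by the piece `a`, where the vertices are in this piece. -/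
def Adj (a : PieceIdx n) (M : FinStr (markLang n H)) (x y : M) : Prop :=
  match a with
  | .inl _ => M.bin () x y
  | .inr p => (M.un (.inl p.1.1) x ↔ ¬ M.un (.inl p.1.1) y) ∧ M.bin () x y

/-- The complement, respectively the bipartite complement, of this graph. -/
def Coadj (a : PieceIdx n) (M : FinStr (markLang n H)) (x y : M) : Prop :=
  match a with
  | .inl _ => ¬ M.bin () x y
  | .inr p => (M.un (.inl p.1.1) x ↔ ¬ M.un (.inl p.1.1) y) ∧ ¬ M.bin () x y

/-- The vertices `x` and `y` are above the same child of the node that corresponds to the class of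
`x` with respect to `W`. -/
def Step (W : ∀ M : FinStr (markLang n H), M → M → Prop) (a : PieceIdx n) (d : ℕ)
    (M : FinStr (markLang n H)) (x y : M) : Prop :=
  (Has (.label .U) a d M x ∧ Reach (W M x) (Adj a M) 5 x y) ∨
    ((Has (.label .J) a d M x ∨ Has (.label .B) a d M x) ∧ Reach (W M x) (Coadj a M) 5 x y) ∨
    (Has (.label .O) a d M x ∧
      SameMark (W M x) (Adj a M) (Col a M) (fun m => Has (.index m) a (d + 1) M) x y)

/-- In the tree of the piece `a`, the vertices `x` and `y` have a common ancestor at depth `d`. -/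
def Common (a : PieceIdx n) : ℕ → ∀ M : FinStr (markLang n H), M → M → Prop
  | 0, M, x, y => Has .deep a 0 M x ∧ Has .deep a 0 M y
  | d + 1, M, x, y => Common a d M x y ∧ Has .deep a (d + 1) M x ∧ Has .deep a (d + 1) M y ∧
      Step (Common a d) a d M x y

instance (k : MarkKind) (a : PieceIdx n) (d : ℕ) : FODef₁ (Has (H := H) k a d) :=
  inferInstanceAs (FODef₁ fun (M : FinStr (markLang n H)) => M.un _)

instance (a : PieceIdx n) : FODef₁ (Col (H := H) a) := by
  cases a <;> exact ⟨by unfold Col; infer_instance⟩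

instance (a : PieceIdx n) : FODef₂ (Adj (H := H) a) := by
  cases a <;> exact ⟨by unfold Adj; infer_instance⟩

instance (a : PieceIdx n) : FODef₂ (Coadj (H := H) a) := by
  cases a <;> exact ⟨by unfold Coadj; infer_instance⟩

end Marked

/-! ### Definability of bounded reachability and of the marked classes -/

section FODef

variable {L : FirstOrder.Language.{0, 0}}

/-- The induction has to range over all types of variables, because each step of a path introduces a
new quantified vertex. -/
theorem FODef.reach (W K : ∀ M : FinStr L, M → M → Prop) [FODef₂ W] [FODef₂ K] (k : ℕ)
    {α : Type} (w i j : α) : FODef fun M v => Reach (W M (v w)) (K M) k (v i) (v j) := by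
  induction k generalizing α with
  | zero => exact FODef.eq i j
  | succ k ih =>
    have h1 := ih w i j
    have h2 : FODef fun (M : FinStr L) (v : Option α → M) =>
      Reach (W M (v (some w))) (K M) k (v none) (v (some j)) := ih (some w) none (some j)
    unfold Reach
    infer_instance

variable (W K : ∀ M : FinStr L, M → M → Prop) [FODef₂ W] [FODef₂ K] (c : ∀ M : FinStr L, M → Prop)
  [FODef₁ c] (mk : Fin 3 → ∀ M : FinStr L, M → Prop) [∀ m, FODef₁ (mk m)] {α : Type} (w i j : α)

theorem FODef.unseparated (m : Fin 3) : FODef fun M v =>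
    Unseparated (W M (v w)) (K M) (c M) (fun m => mk m M) m (v i) (v j) := by
  unfold Unseparated
  beta_reduce
  infer_instance

theorem FODef.sameMark : FODef fun M v =>
    SameMark (W M (v w)) (K M) (c M) (fun m => mk m M) (v i) (v j) := by
  have h1 := FODef.unseparated W K c mk w i j
  have h2 := FODef.unseparated W K c mk w j i
  unfold SameMark
  beta_reduce
  have h3 : ∀ m, FODef fun M (v : α → M) => mk m M (v i) ∧ mk m M (v j) := inferInstance
  have h4 : ∀ m, FODef fun M (v : α → M) => c M (v i) → c M (v j) →
      ∀ z, W M (v w) z → ¬ c M z → ¬ mk m M z → (K M (v i) z ↔ K M (v j) z) := inferInstance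
  have h5 : ∀ m, FODef fun M (v : α → M) => ¬ c M (v i) → ¬ c M (v j) →
      ∀ z, W M (v w) z → c M z → ¬ mk m M z → (K M z (v i) ↔ K M z (v j)) := inferInstance
  infer_instance

end FODef

namespace Marked

variable {n H : ℕ}

instance (W : ∀ M : FinStr (markLang n H), M → M → Prop) [FODef₂ W] (a : PieceIdx n) (d : ℕ) :
    FODef₂ (Step W a d) := by
  have h1 := FODef.reach W (Adj a) 5 (0 : Fin 2) 0 1
  have h2 := FODef.reach W (Coadj a) 5 (0 : Fin 2) 0 1
  have h3 := FODef.sameMark W (Adj a) (Col a) (fun m => Has (.index m) a (d + 1)) (0 : Fin 2) 0 1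
  exact ⟨by unfold Step; infer_instance⟩

instance (a : PieceIdx n) (d : ℕ) : FODef₂ (Common (H := H) a d) := by
  induction d with
  | zero => exact ⟨by unfold Common; infer_instance⟩
  | succ d ih => exact ⟨by unfold Common; infer_instance⟩

end Marked

/-! ### Marks of leaves and common ancestors -/

namespace TModel

variable {S : Type} (T : TModel S)

/-- A leaf above a given node. -/
noncomputable def rep (u : T.Node) : S := (T.exists_leaf_ge u).choose

theorem le_rep (u : T.Node) : u ≤ T.leaf (T.rep u) := (T.exists_leaf_ge u).choose_spec

/-- The marks of the leaves. -/
def mark : MarkKind → ℕ → S → Prop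
  | .deep, d, s => d ≤ T.depth (T.leaf s)
  | .leaf, d, s => T.depth (T.leaf s) = d
  | .rep, d, s => ∃ u, u ≤ T.leaf s ∧ T.depth u = d ∧ T.rep u = s
  | .label l, d, s => ∃ u, u ≤ T.leaf s ∧ T.depth u = d ∧ ¬ IsMax u ∧ T.label u = l
  | .index m, d, s => ∃ u, u ≤ T.leaf s ∧ T.depth u = d ∧ T.index u % 3 = m

variable {T}

theorem mark_label_iff {u : T.Node} {s : S} (hu : u ≤ T.leaf s) {l : NodeLabel} :
    T.mark (.label l) (T.depth u) s ↔ ¬ IsMax u ∧ T.label u = l := by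
  constructor
  · rintro ⟨v, hv, hd, h⟩
    rwa [← eq_of_depth_eq hv hu hd]
  · exact fun h => ⟨u, hu, rfl, h⟩

theorem mark_index_iff {u : T.Node} {s : S} (hu : u ≤ T.leaf s) {m : Fin 3} :
    T.mark (.index m) (T.depth u) s ↔ T.index u % 3 = m := by
  constructor
  · rintro ⟨v, hv, hd, h⟩
    rwa [← eq_of_depth_eq hv hu hd]
  · exact fun h => ⟨u, hu, rfl, h⟩

/-- The leaves `s` and `t` have a common ancestor at depth `d`. -/
def Common (T : TModel S) (d : ℕ) (s t : S) : Prop :=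
  ∃ u, T.depth u = d ∧ u ≤ T.leaf s ∧ u ≤ T.leaf t

theorem common_iff_mem_leaves {u : T.Node} {s t : S} (hs : u ≤ T.leaf s) :
    T.Common (T.depth u) s t ↔ t ∈ T.leaves u := by
  constructor
  · rintro ⟨v, hv, hvs, hvt⟩
    rwa [eq_of_depth_eq hvs hs hv] at hvt
  · exact fun ht => ⟨u, rfl, hs, ht⟩

theorem common_zero (s t : S) : T.Common 0 s t := by
  obtain ⟨u, hu, hd⟩ := exists_le_depth_eq (T.leaf s) 0 (Nat.zero_le _)
  exact ⟨u, hd, hu, T.depth_eq_zero_iff.1 hd _⟩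

theorem not_isMax_of_depth_lt {u : T.Node} {s : S} (hs : u ≤ T.leaf s)
    (h : T.depth u + 1 ≤ T.depth (T.leaf s)) : ¬ IsMax u := fun hu => by
  rw [le_antisymm (hu hs) hs] at h
  omega

theorem sameChild_iff_common {u : T.Node} {s t : S} (hs : u ≤ T.leaf s) :
    T.SameChild u s t ↔ T.Common (T.depth u + 1) s t := by
  constructor
  · rintro ⟨c, hc, hcs, hct⟩
    exact ⟨c, depth_of_covBy hc, hcs, hct⟩
  · rintro ⟨c, hc, hcs, hct⟩
    have huc : u < c := lt_of_le_of_ne (le_of_depth_le hs hcs (by omega)) fun h => by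
      rw [h] at hc
      omega
    obtain ⟨d, hd, hdc⟩ := exists_child_of_lt huc
    have := eq_of_depth_eq hdc le_rfl ((depth_of_covBy hd).trans hc.symm)
    exact ⟨c, this ▸ hd, hcs, hct⟩

theorem Common.of_succ {d : ℕ} {s t : S} (h : T.Common (d + 1) s t) : T.Common d s t := by
  obtain ⟨u, hu, hs, ht⟩ := h
  obtain ⟨v, hv, hd⟩ := exists_le_depth_eq u d (by omega)
  exact ⟨v, hd, hv.trans hs, hv.trans ht⟩

end TModel

namespace Amalgam

variable {n : ℕ} {V : Type} (D : Amalgam n V)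

/-- The marks of the vertices. -/
def mark (H : ℕ) : Mark n H → V → Prop
  | .inl i, v => D.part v = i
  | .inr (a, d, k), v => ∃ h : a.Has (D.part v), (D.tree a).mark k d ⟨v, h⟩

/-- The graph `G` with marks, if its vertices are identified with those of the amalgam. -/
def marked (H : ℕ) {G : FinGraph} (ε : G.V ≃ V) : FinStr (markLang n H) :=
  G.colored fun m x => D.mark H m (ε x)

/-- The vertex of the marked graph that corresponds to a vertex of the amalgam. -/
def vtx (H : ℕ) {G : FinGraph} (ε : G.V ≃ V) (v : V) : D.marked H ε := ε.symm v

variable {D} {H : ℕ} {G : FinGraph} {ε : G.V ≃ V} {a : PieceIdx n}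

theorem vtx_injective : Function.Injective (D.vtx H ε) := ε.symm.injective

theorem marked_un (m : Mark n H) (v : V) :
    (D.marked H ε).un m (D.vtx H ε v) ↔ D.mark H m v := by
  change D.mark H m (ε (ε.symm v)) ↔ _
  rw [ε.apply_symm_apply]

theorem has_vtx {k : MarkKind} {d : ℕ} (hd : d ≤ H) {v : V} :
    Marked.Has k a d (D.marked H ε) (D.vtx H ε v) ↔
      ∃ h : a.Has (D.part v), (D.tree a).mark k d ⟨v, h⟩ := by
  unfold Marked.Has
  rw [marked_un]
  have h : ∀ d', d' = d → ((∃ h : a.Has (D.part v), (D.tree a).mark k d' ⟨v, h⟩) ↔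
    ∃ h : a.Has (D.part v), (D.tree a).mark k d ⟨v, h⟩) := by
    rintro _ rfl
    rfl
  exact h _ (Nat.mod_eq_of_lt (by omega))

theorem has_iff {k : MarkKind} {d : ℕ} (hd : d ≤ H) (s : pieceGround D.part a) :
    Marked.Has k a d (D.marked H ε) (D.vtx H ε s) ↔ (D.tree a).mark k d s := by
  rw [has_vtx hd]
  exact ⟨fun ⟨_, h⟩ => h, fun h => ⟨s.2, h⟩⟩

theorem exists_of_has {k : MarkKind} {d : ℕ} (hd : d ≤ H) {x : D.marked H ε}
    (h : Marked.Has k a d (D.marked H ε) x) : ∃ s : pieceGround D.part a, D.vtx H ε s = x := by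
  obtain ⟨v, rfl⟩ : ∃ v, D.vtx H ε v = x := ε.symm.surjective x
  obtain ⟨h, -⟩ := (has_vtx hd).1 h
  exact ⟨⟨v, h⟩, rfl⟩

theorem col_iff (s : pieceGround D.part a) :
    Marked.Col a (D.marked H ε) (D.vtx H ε s) ↔ (D.tree a).color s = 0 := by
  have hp := D.isPiece a
  cases a with
  | inl i => exact iff_of_true trivial (hp.2.1 s)
  | inr p =>
    rw [hp.2 s]
    exact marked_un _ _

theorem mark_inl_iff {p : {p : Fin n × Fin n // p.1 < p.2}} {s t : pieceGround D.part (.inr p)} :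
    (D.mark H (.inl p.1.1) s ↔ ¬ D.mark H (.inl p.1.1) t) ↔ D.part s ≠ D.part t := by
  have hne := p.2.ne
  change (D.part s = p.1.1 ↔ ¬ D.part t = p.1.1) ↔ _
  rcases (s.2 : _ ∨ _) with hs | hs <;> rcases (t.2 : _ ∨ _) with ht | ht <;>
    simp [hs, ht, hne, hne.symm]

theorem graph_adj_iff_inl {i : Fin n} (s t : pieceGround D.part (.inl i)) :
    D.graph.Adj s t ↔ (D.tree (.inl i)).graph.Adj s t := by
  rw [adj_iff_of_part_eq (part_eq_of_mem s t)]
  constructor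
  · rintro ⟨j, hs, ht, h⟩
    obtain rfl : i = j := (s.2 : D.part s = i).symm.trans hs
    exact h
  · exact fun h => ⟨i, s.2, t.2, h⟩

theorem graph_adj_iff_inr {p : {p : Fin n × Fin n // p.1 < p.2}}
    (s t : pieceGround D.part (.inr p)) (hst : D.part s ≠ D.part t) :
    D.graph.Adj s t ↔ (D.tree (.inr p)).graph.Adj s t := by
  rw [adj_iff_of_part_ne hst]
  constructor
  · rintro ⟨q, hs, ht, h⟩
    obtain rfl : p = q := by
      have hp := p.2
      have hq := q.2
      have hs' : _ ∨ _ := s.2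
      have ht' : _ ∨ _ := t.2
      have hs : _ ∨ _ := hs
      have ht : _ ∨ _ := ht
      apply Subtype.ext
      apply Prod.ext <;> omega
    exact h
  · exact fun h => ⟨p, s.2, t.2, h⟩

variable (hG : ∀ x y, D.graph.Adj (ε x) (ε y) ↔ G.graph.Adj x y)

include hG

theorem marked_bin (v w : V) :
    (D.marked H ε).bin () (D.vtx H ε v) (D.vtx H ε w) ↔ D.graph.Adj v w := by
  change G.graph.Adj (ε.symm v) (ε.symm w) ↔ _
  rw [← hG, ε.apply_symm_apply, ε.apply_symm_apply]

theorem adj_iff (s t : pieceGround D.part a) :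
    Marked.Adj a (D.marked H ε) (D.vtx H ε s) (D.vtx H ε t) ↔ (D.tree a).graph.Adj s t := by
  cases a with
  | inl i => exact (marked_bin hG _ _).trans (graph_adj_iff_inl s t)
  | inr p =>
    change ((D.marked H ε).un _ _ ↔ ¬ (D.marked H ε).un _ _) ∧ (D.marked H ε).bin _ _ _ ↔ _
    rw [marked_un, marked_un, marked_bin hG, mark_inl_iff]
    constructor
    · exact fun h => (graph_adj_iff_inr s t h.1).1 h.2
    · exact fun h => ⟨part_ne_of_adj h, (graph_adj_iff_inr s t (part_ne_of_adj h)).2 h⟩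

theorem coadj_inl {i : Fin n} (s t : pieceGround D.part (.inl i)) :
    Marked.Coadj (.inl i) (D.marked H ε) (D.vtx H ε s) (D.vtx H ε t) ↔
      ¬ (D.tree (.inl i)).graph.Adj s t :=
  not_congr ((marked_bin hG _ _).trans (graph_adj_iff_inl s t))

theorem coadj_inr {p : {p : Fin n × Fin n // p.1 < p.2}} (s t : pieceGround D.part (.inr p)) :
    Marked.Coadj (.inr p) (D.marked H ε) (D.vtx H ε s) (D.vtx H ε t) ↔
      (D.tree (.inr p)).bipCompl.Adj s t := by
  unfold Marked.Coadj
  have hp := (D.isPiece (.inr p)).2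
  have h : (D.tree (.inr p)).color s ≠ (D.tree (.inr p)).color t ↔ D.part s ≠ D.part t := by
    rw [TModel.color_ne_iff, hp, hp]
    exact mark_inl_iff (H := H)
  change ((D.marked H ε).un _ _ ↔ ¬ (D.marked H ε).un _ _) ∧ ¬ (D.marked H ε).bin _ _ _ ↔ _
  rw [marked_un, marked_un, marked_bin hG, mark_inl_iff]
  refine Iff.trans (and_congr_right fun h' => ?_) (and_congr_left' h.symm)
  rw [graph_adj_iff_inr s t h']

/-- The common ancestors of the leaves of a clean amalgam are defined in the marked graph. -/
theorem common_iff (hD : D.Clean) {d : ℕ} (hd : d ≤ H) (x y : D.marked H ε) :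
    Marked.Common a d (D.marked H ε) x y ↔ ∃ s t : pieceGround D.part a,
      D.vtx H ε s = x ∧ D.vtx H ε t = y ∧ (D.tree a).Common d s t := by
  have hinj : Function.Injective fun s : pieceGround D.part a => D.vtx H ε s :=
    fun s t h => Subtype.ext (vtx_injective h)
  induction d generalizing x y with
  | zero =>
    constructor
    · rintro ⟨h1, h2⟩
      obtain ⟨s, rfl⟩ := exists_of_has hd h1
      obtain ⟨t, rfl⟩ := exists_of_has hd h2
      exact ⟨s, t, rfl, rfl, TModel.common_zero s t⟩
    · rintro ⟨s, t, rfl, rfl, -⟩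
      exact ⟨(has_iff hd s).2 (Nat.zero_le _), (has_iff hd t).2 (Nat.zero_le _)⟩
  | succ d ih =>
    have ih := ih (by omega)
    -- Let `u` be the common ancestor at depth `d`. By induction the class of `s` at this depth
    -- consists of the leaves above `u`; the marks of `s` give the label of `u`, and the
    -- characterization of `SameChild` for this label applies.
    have key : ∀ s t : pieceGround D.part a, (D.tree a).Common d s t →
        d + 1 ≤ (D.tree a).depth ((D.tree a).leaf s) →
        ((D.tree a).Common (d + 1) s t ↔
          Marked.Step (Marked.Common a d) a d (D.marked H ε) (D.vtx H ε s) (D.vtx H ε t)) := by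
      rintro s t ⟨u, rfl, hs, ht⟩ hds
      have hu := TModel.not_isMax_of_depth_lt hs hds
      have hW : ∀ z, Marked.Common a ((D.tree a).depth u) (D.marked H ε) (D.vtx H ε s) z ↔
          ∃ r, r ∈ (D.tree a).leaves u ∧ D.vtx H ε r = z := by
        intro z
        refine (ih _ _).trans ?_
        constructor
        · rintro ⟨s', r, h1, h2, h3⟩
          obtain rfl := hinj h1
          exact ⟨r, (TModel.common_iff_mem_leaves hs).1 h3, h2⟩
        · rintro ⟨r, hr, h⟩
          exact ⟨s, r, rfl, h, (TModel.common_iff_mem_leaves hs).2 hr⟩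
      have hadj : ∀ s t, s ∈ (D.tree a).leaves u → t ∈ (D.tree a).leaves u →
          (Marked.Adj a (D.marked H ε) (D.vtx H ε s) (D.vtx H ε t) ↔ (D.tree a).graph.Adj s t) :=
        fun s t _ _ => adj_iff hG s t
      rw [← TModel.sameChild_iff_common hs, Marked.Step]
      simp only [has_iff (show (D.tree a).depth u ≤ H by omega), TModel.mark_label_iff hs, hu,
        not_false_eq_true, true_and]
      clear ih
      have hp := D.isPiece a
      have hc := hD a
      cases a with
      | inl i =>
        rcases hp.2.2 u hu with hl | hl
        · simp only [hl, reduceCtorEq, true_and, false_and, or_false]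
          rw [Reach.map (g := fun s : pieceGround D.part (.inl i) => D.vtx H ε s) hinj hW hadj hs]
          refine TModel.sameChild_iff_reach_of_isCotree hc hu (fun s t m hst hm => ?_) hs
          rw [TModel.adj_iff_of_isGLB_of_isCotree hp hst hm, hl]
          rcases hp.2.2 m (TModel.not_isMax_of_isGLB hst hm) with h | h <;> simp [h]
        · simp only [hl, reduceCtorEq, true_and, false_and, or_false, false_or]
          rw [Reach.map (g := fun s : pieceGround D.part (.inl i) => D.vtx H ε s) (K := fun s t => ¬ (D.tree (.inl i)).graph.Adj s t)
            hinj hW (fun s t _ _ => coadj_inl hG s t) hs]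
          refine TModel.sameChild_iff_reach_of_isCotree hc hu (fun s t m hst hm => ?_) hs
          rw [TModel.adj_iff_of_isGLB_of_isCotree hp hst hm, hl]
      | inr p =>
        rcases hp.1 u hu with ⟨-, hl⟩ | ⟨-, hl⟩ | ⟨-, hl⟩
        · simp only [hl, reduceCtorEq, true_and, false_and, or_false]
          rw [Reach.map (g := fun s : pieceGround D.part (.inr p) => D.vtx H ε s) hinj hW hadj hs]
          exact TModel.sameChild_iff_reach hp.1 hc (.inl rfl) hu ((hc u hu).1 hl) hs
        · simp only [hl, reduceCtorEq, true_and, false_and, or_false, false_or, or_true]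
          rw [Reach.map (g := fun s : pieceGround D.part (.inr p) => D.vtx H ε s) hinj hW (fun s t _ _ => coadj_inr hG s t) hs]
          exact TModel.sameChild_iff_reach hp.1 hc (.inr rfl) hu ((hc u hu).2.1 hl) hs
        · simp only [hl, reduceCtorEq, true_and, false_and, or_false, false_or]
          rw [sameMark_map (g := fun s : pieceGround D.part (.inr p) => D.vtx H ε s) hW hadj (fun s _ => col_iff s)
            (fun m s _ => has_iff hd s) hs ht]
          -- The mark that numbers a child belongs to the depth of the child, which is one more than
          -- the depth of `u`.
          refine TModel.sameChild_iff_sameMark hp.1 hc hu hl (fun m v r hv hr => ?_) hs ht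
          rw [← TModel.depth_of_covBy hv]
          exact TModel.mark_index_iff hr
    constructor
    · rintro ⟨h1, h2, h3, h4⟩
      obtain ⟨s, t, rfl, rfl, hst⟩ := (ih _ _).1 h1
      exact ⟨s, t, rfl, rfl, (key s t hst ((has_iff hd s).1 h2)).2 h4⟩
    · rintro ⟨s, t, rfl, rfl, hst⟩
      have hdeep : ∀ {s t}, (D.tree a).Common (d + 1) s t →
          d + 1 ≤ (D.tree a).depth ((D.tree a).leaf s) := by
        rintro s t ⟨u, hu, hs, -⟩
        exact hu ▸ TModel.depth_le hs
      have h1 := hdeep hst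
      have h2 : d + 1 ≤ (D.tree a).depth ((D.tree a).leaf t) := by
        obtain ⟨u, hu, hs, ht⟩ := hst
        exact hdeep ⟨u, hu, ht, hs⟩
      exact ⟨(ih _ _).2 ⟨s, t, rfl, rfl, hst.of_succ⟩, (has_iff hd s).2 h1, (has_iff hd t).2 h2,
        (key s t hst.of_succ h1).1 hst⟩

end Amalgam

/-! ### Accessibility of clean amalgams -/

namespace Marked

variable {n H : ℕ}

/-- The node at depth `d + 1` represented by `x` is before the one represented by `y`. -/
def Tri (a : PieceIdx n) (d : ℕ) (M : FinStr (markLang n H)) (x y : M) : Prop :=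
  Common a d M x y ∧ Has (.label .O) a d M x ∧ ¬ Common a (d + 1) M x y ∧
    ∃ x', Common a (d + 1) M x x' ∧ Col a M x' ∧
      ∃ y', Common a (d + 1) M y y' ∧ ¬ Col a M y' ∧ Adj a M x' y'

instance (a : PieceIdx n) (d : ℕ) : FODef₂ (Tri (H := H) a d) := ⟨by unfold Tri; infer_instance⟩

variable (n H) in
/-- Indices of the copies: the ground, and a copy for the nodes at a given depth of a given tree. -/
abbrev Copy : Type := Option (PieceIdx n × Fin (H + 1))

/-- The elements that are kept in the copies. -/
def dom : Copy n H → ∀ M : FinStr (markLang n H), M → Prop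
  | none, _, _ => True
  | some (a, d), M, x => Has .rep a d M x

/-- The unary relations in the copies. -/
def un : FlatUn n → Copy n H → ∀ M : FinStr (markLang n H), M → Prop
  | .ground, none, _, _ => True
  | .part i, none, M, x => M.un (.inl i) x
  | .piece a, some (b, _), _, _ => a = b
  | .label l, some (a, d), M, x => Has (.label l) a d M x
  | _, _, _, _ => False

/-- The binary relations in the copies. -/
def bin : FlatBin → Copy n H → Copy n H → ∀ M : FinStr (markLang n H), M → M → Prop
  | .le, some (a, d), some (b, d'), M, x, y => (a = b ∧ d ≤ d') ∧ Common a d M x y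
  | .leaf, none, some (a, d), M, x, y => x = y ∧ Has .leaf a d M x
  | .tri, some (a, d), some (b, d'), M, x, y =>
      ∃ e : Fin H, (a = b ∧ d.1 = e + 1 ∧ d'.1 = e + 1) ∧ Tri a e M x y
  | _, _, _, _, _, _ => False

instance (κ : Copy n H) : FODef₁ (dom κ) := by
  rcases κ with _ | ⟨a, d⟩ <;> exact ⟨by unfold dom; infer_instance⟩

instance (r : FlatUn n) (κ : Copy n H) : FODef₁ (un r κ) := by
  rcases r with _ | i | a | l <;> rcases κ with _ | ⟨a, d⟩ <;> exact ⟨by unfold un; infer_instance⟩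

instance (r : FlatBin) (κ μ : Copy n H) : FODef₂ (bin r κ μ) := by
  rcases r with _ | _ | _ <;> rcases κ with _ | ⟨a, d⟩ <;> rcases μ with _ | ⟨b, d'⟩ <;>
    exact ⟨by unfold bin; infer_instance⟩

end Marked

namespace TModel

variable {S : Type} {T : TModel S}

theorem le_iff_common {u v : T.Node} :
    u ≤ v ↔ T.depth u ≤ T.depth v ∧ T.Common (T.depth u) (T.rep u) (T.rep v) := by
  constructor
  · exact fun h => ⟨depth_le h, u, rfl, T.le_rep u, h.trans (T.le_rep v)⟩
  · rintro ⟨h, w, hw, hwu, hwv⟩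
    rw [eq_of_depth_eq hwu (T.le_rep u) hw] at hwv
    exact le_of_depth_le hwv (T.le_rep v) h

/-- Cleanness provides a leaf of color 0 above the first child and a leaf of color 1 above the
second one. They are adjacent exactly if the children come in this order. For cotrees both sides are
false. -/
theorem tri_iff_common (hT : T.IsCotree ∨ T.IsBicotree ∧ T.CleanBicotree) {u v : T.Node} :
    T.tri u v ↔ ∃ d, (T.depth u = d + 1 ∧ T.depth v = d + 1) ∧ T.Common d (T.rep u) (T.rep v) ∧
      T.mark (.label .O) d (T.rep u) ∧ ¬ T.Common (d + 1) (T.rep u) (T.rep v) ∧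
      ∃ s, T.Common (d + 1) (T.rep u) s ∧ T.color s = 0 ∧
        ∃ t, T.Common (d + 1) (T.rep v) t ∧ ¬ T.color t = 0 ∧ T.graph.Adj s t := by
  rcases hT with hT | ⟨hT, hc⟩
  · constructor
    · intro h
      have hne : u ≠ v := fun e => T.tri_irrefl v (e ▸ h)
      obtain ⟨p, hp, -⟩ := (T.tri_comparable u v hne).1 (.inl h)
      rw [hT.1] at hp
      exact hp.elim
    · rintro ⟨d, -, -, ⟨p, -, -, hp, hl⟩, -⟩
      rcases hT.2.2 p hp with h | h <;> simp [hl] at h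
  constructor
  · intro h
    have hne : u ≠ v := fun e => T.tri_irrefl v (e ▸ h)
    obtain ⟨p, hpC, hpu, hpv⟩ := (T.tri_comparable u v hne).1 (.inl h)
    have hp := not_isMax_of_covBy hpu
    have hl : T.label p = .O := by
      rcases hT p hp with ⟨h, -⟩ | ⟨h, -⟩ | ⟨-, h⟩
      exacts [(h hpC).elim, (h hpC).elim, h]
    obtain ⟨s, hs, hs0⟩ := (hc p hp).2.2 hl u hpu 0
    obtain ⟨t, ht, ht1⟩ := (hc p hp).2.2 hl v hpv 1
    have hu := depth_of_covBy hpu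
    have hv := depth_of_covBy hpv
    refine ⟨T.depth p, ⟨hu, hv⟩, ⟨p, rfl, hpu.le.trans (T.le_rep u), hpv.le.trans (T.le_rep v)⟩,
      (mark_label_iff (hpu.le.trans (T.le_rep u))).2 ⟨hp, hl⟩, ?_, s, ⟨u, hu, T.le_rep u, hs⟩, hs0,
      t, ⟨v, hv, T.le_rep v, ht⟩, color_eq_one_iff.1 ht1,
      (adj_iff_of_label_O hT hne hpu hpv hs ht hl hs0 ht1).2 h⟩
    rintro ⟨w, hw, hwu, hwv⟩
    exact hne ((eq_of_depth_eq hwu (T.le_rep u) (hw.trans hu.symm)).symm.trans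
      (eq_of_depth_eq hwv (T.le_rep v) (hw.trans hv.symm)))
  · rintro ⟨d, ⟨hu, hv⟩, ⟨p, rfl, hpu, hpv⟩, hl, hne, s, hs, hs0, t, ht, ht1, hst⟩
    obtain ⟨-, hl⟩ := (mark_label_iff hpu).1 hl
    have hcov : ∀ {w : T.Node}, T.depth w = T.depth p + 1 → p ≤ T.leaf (T.rep w) → p ⋖ w := by
      intro w hw hpw
      have hlt : p < w := lt_of_le_of_ne (le_of_depth_le hpw (T.le_rep w) (by omega)) fun h => by
        rw [← h] at hw
        omega
      obtain ⟨c, hc, hcw⟩ := exists_child_of_lt hlt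
      rwa [← eq_of_depth_eq hcw le_rfl ((depth_of_covBy hc).trans hw.symm)]
    have hmem : ∀ {w : T.Node} {r : S}, T.depth w = T.depth p + 1 →
        T.Common (T.depth p + 1) (T.rep w) r → w ≤ T.leaf r := by
      intro w r hw h
      rw [← hw] at h
      exact (common_iff_mem_leaves (T.le_rep w)).1 h
    refine (adj_iff_of_label_O hT ?_ (hcov hu hpu) (hcov hv hpv) (hmem hu hs) (hmem hv ht) hl hs0
      (color_eq_one_iff.2 ht1)).1 hst
    rintro rfl
    exact hne ⟨u, hu, T.le_rep u, T.le_rep u⟩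

theorem HeightLE.depth_lt {h : ℕ} (hT : T.HeightLE h) (x : T.Node) : T.depth x < h := by
  have := hT x
  rw [ncard_Iic] at this
  omega

end TModel

namespace Amalgam

variable {n : ℕ} {V : Type} [Finite V] {D : Amalgam n V} {H : ℕ} {G : FinGraph} {ε : G.V ≃ V}

/-- The clones that form the amalgam. -/
noncomputable def clone (hD : D.HeightLE H) (ε : G.V ≃ V) :
    D.Carrier → D.marked H ε × Marked.Copy n H
  | .inl v => (D.vtx H ε v, none)
  | .inr ⟨a, x⟩ => (D.vtx H ε ((D.tree a).rep x),
      some (a, ⟨(D.tree a).depth x, ((hD a).depth_lt x).trans (Nat.lt_succ_self H)⟩))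

omit [Finite V] in
-- A node is determined by its tree, its depth and its representative, since the nodes below a leaf
-- have distinct depths.
theorem clone_injective (hD : D.HeightLE H) (ε : G.V ≃ V) :
    Function.Injective (D.clone hD ε) := by
  rintro (v | ⟨a, x⟩) (w | ⟨b, y⟩) h
  · exact congrArg Sum.inl (vtx_injective (congrArg Prod.fst h))
  · cases congrArg Prod.snd h
  · cases congrArg Prod.snd h
  · have h1 := vtx_injective (congrArg Prod.fst h)
    have h2 := Option.some.inj (congrArg Prod.snd h)
    obtain rfl : a = b := congrArg Prod.fst h2
    have h3 : (D.tree a).depth x = (D.tree a).depth y := congrArg (fun p => p.2.1) h2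
    have h1 : (D.tree a).rep x = (D.tree a).rep y := Subtype.ext h1
    rw [TModel.eq_of_depth_eq ((D.tree a).le_rep x) (h1 ▸ (D.tree a).le_rep y) h3]

omit [Finite V] in
theorem range_clone (hD : D.HeightLE H) (ε : G.V ≃ V) :
    Set.range (D.clone hD ε) = {p | Marked.dom p.2 (D.marked H ε) p.1} := by
  ext ⟨x, _ | ⟨a, d⟩⟩
  · refine iff_of_true ?_ trivial
    obtain ⟨v, rfl⟩ : ∃ v, D.vtx H ε v = x := ε.symm.surjective x
    exact ⟨.inl v, rfl⟩
  · constructor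
    · rintro ⟨v | ⟨b, y⟩, h⟩
      · cases congrArg Prod.snd h
      · cases h
        exact (has_iff (k := .rep) ((hD a).depth_lt y).le _).2 ⟨y, (D.tree a).le_rep y, rfl, rfl⟩
    · intro h
      have h : Marked.Has .rep a d (D.marked H ε) x := h
      obtain ⟨s, rfl⟩ := exists_of_has (Nat.le_of_lt_succ d.2) h
      obtain ⟨u, hu, hd, rfl⟩ := (has_iff (Nat.le_of_lt_succ d.2) s).1 h
      exact ⟨.inr ⟨a, u⟩, Prod.ext rfl (congrArg some (Prod.ext rfl (Fin.ext hd)))⟩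

theorem un_clone (hD : D.HeightLE H) (ε : G.V ≃ V) (r : FlatUn n) (x : D.Carrier) :
    D.flat.un r x ↔ Marked.un r (D.clone hD ε x).2 (D.marked H ε) (D.clone hD ε x).1 := by
  rcases r with _ | i | a | l <;> rcases x with v | ⟨b, x⟩
  · exact iff_of_true ⟨v, rfl⟩ trivial
  · exact iff_of_false (fun ⟨v, h⟩ => by cases h) id
  · refine Iff.trans ?_ (marked_un _ _).symm
    exact ⟨fun ⟨w, h, h'⟩ => Sum.inl_injective h ▸ h', fun h => ⟨v, rfl, h⟩⟩
  · exact iff_of_false (fun ⟨v, h, _⟩ => by cases h) id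
  · exact iff_of_false (fun ⟨v, h⟩ => by cases h) id
  · exact ⟨fun ⟨y, h⟩ => by cases h; rfl, fun h => ⟨h ▸ x, by cases h; rfl⟩⟩
  · exact iff_of_false (fun h => by cases flat_label.1 h) id
  · refine flat_label_inr.trans (Iff.trans ?_ (has_iff ((hD b).depth_lt x).le _).symm)
    exact (TModel.mark_label_iff ((D.tree b).le_rep x)).symm

omit [Finite V] in
theorem common_vtx (hG : ∀ x y, D.graph.Adj (ε x) (ε y) ↔ G.graph.Adj x y) (hD : D.Clean)
    {a : PieceIdx n} {d : ℕ} (hd : d ≤ H) {s t : pieceGround D.part a} :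
    Marked.Common a d (D.marked H ε) (D.vtx H ε s) (D.vtx H ε t) ↔ (D.tree a).Common d s t := by
  rw [common_iff hG hD hd]
  constructor
  · rintro ⟨s', t', hs, ht, h⟩
    rwa [Subtype.ext (vtx_injective hs), Subtype.ext (vtx_injective ht)] at h
  · exact fun h => ⟨s, t, rfl, rfl, h⟩

omit [Finite V] in
theorem tri_vtx (hG : ∀ x y, D.graph.Adj (ε x) (ε y) ↔ G.graph.Adj x y) (hD : D.Clean)
    {a : PieceIdx n} {d : ℕ} (hd : d < H) {s t : pieceGround D.part a} :
    Marked.Tri a d (D.marked H ε) (D.vtx H ε s) (D.vtx H ε t) ↔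
      (D.tree a).Common d s t ∧
      (D.tree a).mark (.label .O) d s ∧ ¬ (D.tree a).Common (d + 1) s t ∧
      ∃ s', (D.tree a).Common (d + 1) s s' ∧ (D.tree a).color s' = 0 ∧
        ∃ t', (D.tree a).Common (d + 1) t t' ∧ ¬ (D.tree a).color t' = 0 ∧
          (D.tree a).graph.Adj s' t' := by
  have hW : ∀ (s : pieceGround D.part a) (z : D.marked H ε),
      Marked.Common a (d + 1) (D.marked H ε) (D.vtx H ε s) z ↔
        ∃ t, (D.tree a).Common (d + 1) s t ∧ D.vtx H ε t = z := by
    intro s z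
    rw [common_iff hG hD hd]
    constructor
    · rintro ⟨s', t, hs, ht, h⟩
      exact ⟨t, Subtype.ext (vtx_injective hs) ▸ h, ht⟩
    · rintro ⟨t, h, ht⟩
      exact ⟨s, t, rfl, ht, h⟩
  unfold Marked.Tri
  rw [common_vtx hG hD hd.le, common_vtx hG hD hd, has_iff hd.le]
  refine and_congr_right fun _ => and_congr_right fun _ => and_congr_right fun _ => ?_
  refine exists_and_map (hW s) fun s' _ => and_congr (col_iff s') ?_
  refine exists_and_map (hW t) fun t' _ => and_congr (not_congr (col_iff t')) ?_
  exact adj_iff hG s' t'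

theorem bin_clone (hG : ∀ x y, D.graph.Adj (ε x) (ε y) ↔ G.graph.Adj x y) (hD : D.HeightLE H)
    (hc : D.Clean) (r : FlatBin) (x y : D.Carrier) :
    D.flat.bin r x y ↔ Marked.bin r (D.clone hD ε x).2 (D.clone hD ε y).2 (D.marked H ε)
      (D.clone hD ε x).1 (D.clone hD ε y).1 := by
  rcases r with _ | _ | _
  · rcases x with v | ⟨a, x⟩ <;> rcases y with w | ⟨b, y⟩
    any_goals exact iff_of_false (fun h => by cases flat_le.1 h) id
    by_cases hab : a = b
    · subst hab
      refine flat_le_inr.trans (TModel.le_iff_common.trans ?_)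
      exact and_congr (and_iff_right rfl).symm (common_vtx hG hc ((hD a).depth_lt x).le).symm
    · exact iff_of_false (fun h => by cases flat_le.1 h; exact hab rfl) fun h => hab h.1.1
  · rcases x with v | ⟨a, x⟩ <;> rcases y with w | ⟨b, y⟩
    any_goals exact iff_of_false (fun h => by cases flat_leaf.1 h) id
    constructor
    · intro h
      obtain ⟨a, s, h1, h2⟩ := flat_leaf_iff.1 h
      cases h1
      cases h2
      -- A leaf is its own representative, because no other leaf is above it.
      have hr : (D.tree b).rep ((D.tree b).leaf s) = s := by
        have := (D.tree b).le_rep ((D.tree b).leaf s)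
        exact ((D.tree b).leaf_injective (le_antisymm this ((D.tree b).isMax_leaf s this))).symm
      refine ⟨congrArg (D.vtx H ε) (congrArg Subtype.val hr).symm, ?_⟩
      exact (has_iff ((hD b).depth_lt _).le s).2 rfl
    · rintro ⟨h1, h2⟩
      have h1 : v = _ := vtx_injective h1
      subst h1
      have h2 := (has_iff ((hD b).depth_lt y).le _).1 h2
      -- A node that is as deep as a leaf above it is equal to this leaf.
      have hy := TModel.eq_of_depth_eq le_rfl ((D.tree b).le_rep y) h2
      refine flat_leaf_iff.2 ⟨b, _, rfl, ?_⟩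
      exact congrArg (fun z => Sum.inr (Sigma.mk b z)) hy.symm
  · rcases x with v | ⟨a, x⟩ <;> rcases y with w | ⟨b, y⟩
    any_goals exact iff_of_false (fun h => by cases flat_tri.1 h) id
    by_cases hab : a = b
    · subst hab
      have hp : (D.tree a).IsCotree ∨ (D.tree a).IsBicotree ∧ (D.tree a).CleanBicotree := by
        have h1 := D.isPiece a
        have h2 := hc a
        cases a with
        | inl i => exact .inl h1
        | inr p => exact .inr ⟨h1.1, h2⟩
      refine flat_tri_inr.trans ((TModel.tri_iff_common hp).trans ⟨?_, ?_⟩)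
      · rintro ⟨d, ⟨h1, h2⟩, h3⟩
        have hd : d < H := by
          have := (hD a).depth_lt x
          omega
        exact ⟨⟨d, hd⟩, ⟨rfl, h1, h2⟩, (tri_vtx hG hc hd).2 h3⟩
      · rintro ⟨⟨d, hd⟩, ⟨-, h1, h2⟩, h3⟩
        exact ⟨d, ⟨h1, h2⟩, (tri_vtx hG hc hd).1 h3⟩
    · exact iff_of_false (fun h => by cases flat_tri.1 h; exact hab rfl) fun ⟨_, h, _⟩ => hab h.1

/-- Clean amalgams are obtained from the graphs that they model by a transduction. -/
theorem exists_out_flat (n H : ℕ) : ∃ T : Transduction FirstOrder.Language.graph (flatLang n),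
    ∀ {V : Type} [Finite V] (D : Amalgam n V) (hD : D.HeightLE H) (G : FinGraph) (ε : G.V ≃ V),
      D.Clean → (∀ x y, D.graph.Adj (ε x) (ε y) ↔ G.graph.Adj x y) →
        T.Out G.str D.flat fun x => (D.clone hD ε x).1 := by
  obtain ⟨T, hT⟩ := Transduction.exists_clones (Mark n H) (Marked.Copy n H) (FlatUn n) FlatBin
    Marked.dom Marked.un Marked.bin
  exact ⟨T, fun D hD G ε hc hG => hT G _ D.flat (D.clone hD ε) (clone_injective hD ε)
    (range_clone hD ε) (un_clone hD ε) (bin_clone hG hD hc)⟩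

end Amalgam

/-- A transduction from graphs to amalgams of bounded height, for which all clean models are
accessible. -/
theorem exists_sparse (n H : ℕ) : ∃ T : Transduction FirstOrder.Language.graph (amalgLang n),
    (∀ (G : FinGraph) (V : Type) [Finite V] (D : Amalgam n V), D.Clean → D.HeightLE H →
      ∀ e : ModelIso (SBuild n H) G D.str, Accessible T e) ∧
    ∀ (G : FinGraph) (M : FinStr (amalgLang n)) (o : M → G.str), T.Out G.str M o →
      M ∈ amalgamsOfHeightLE n H := by
  obtain ⟨T, hT⟩ := Amalgam.exists_out_flat n H
  obtain ⟨S, hS, hS'⟩ := exists_unflatten n H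
  refine ⟨.comp S T, fun G V _ D hc hD e => ?_, ?_⟩
  · obtain ⟨ε, hε, hG⟩ := Amalgam.exists_equiv_of_modelIso hD e
    refine ⟨_, ⟨D.flat, _, id, hT D hD G ε hc hG, hS D hD, rfl⟩, fun v => ?_⟩
    rw [hε]
    exact ε.symm_apply_apply v
  · rintro G M o ⟨P, f, g, -, h, -⟩
    exact hS' _ _ _ h

/-! ### Joining trees below a new root -/

namespace TModel

section Join

variable {S : Type} {N : ℕ} {X : Set S} {r : S → Fin N} (T : ∀ i, TModel {x // x ∈ X ∧ r x = i})

/-- The nodes of the join of a family of trees. -/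
abbrev JoinNode : Type := WithBot (Σ i, (T i).Node)

/-- The node of the join that corresponds to a node of one of the trees. -/
def nd (i : Fin N) (x : (T i).Node) : JoinNode T := ((⟨i, x⟩ : Σ i, (T i).Node) : WithBot _)

/-- The order of the children in the join, for a new root with label `l`. -/
inductive JoinTri (l : NodeLabel) : JoinNode T → JoinNode T → Prop
  | nd (i : Fin N) (x y : (T i).Node) (h : (T i).tri x y) : JoinTri l (nd T i x) (nd T i y)
  | root (hl : l = .O) (i j : Fin N) (hij : i < j) (x : (T i).Node) (y : (T j).Node)
      (hx : IsBot x) (hy : IsBot y) : JoinTri l (nd T i x) (nd T j y)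

variable {T}

theorem joinNode_cases (z : JoinNode T) : z = ⊥ ∨ ∃ i x, z = nd T i x := by
  by_cases hz : z = ⊥
  · exact .inl hz
  · obtain ⟨w, rfl⟩ := WithBot.ne_bot_iff_exists.1 hz
    exact .inr ⟨w.1, w.2, rfl⟩

theorem nd_ne_bot {i : Fin N} {x : (T i).Node} : nd T i x ≠ ⊥ := WithBot.coe_ne_bot

theorem nd_injective {i : Fin N} : Function.Injective (nd T i) := fun x y h => by
  have h := WithBot.coe_injective h
  cases h
  rfl

theorem nd_eq_nd {i j : Fin N} {x : (T i).Node} {y : (T j).Node} (h : nd T i x = nd T j y) :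
    i = j := congrArg Sigma.fst (WithBot.coe_injective h)

theorem nd_le_nd {i : Fin N} {x y : (T i).Node} : nd T i x ≤ nd T i y ↔ x ≤ y := by
  rw [nd, nd, WithBot.coe_le_coe, Sigma.mk_le_mk_iff]

theorem nd_le_iff {i : Fin N} {x : (T i).Node} {z : JoinNode T} :
    nd T i x ≤ z ↔ ∃ y, z = nd T i y ∧ x ≤ y := by
  constructor
  · intro h
    rcases joinNode_cases z with rfl | ⟨j, y, rfl⟩
    · exact (nd_ne_bot (le_bot_iff.1 h)).elim
    · obtain ⟨_, _, _, h'⟩ := WithBot.coe_le_coe.1 h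
      exact ⟨_, rfl, h'⟩
  · rintro ⟨y, rfl, h⟩
    exact nd_le_nd.2 h

theorem le_nd_iff {i : Fin N} {x : (T i).Node} {z : JoinNode T} :
    z ≤ nd T i x ↔ z = ⊥ ∨ ∃ y, z = nd T i y ∧ y ≤ x := by
  constructor
  · intro h
    rcases joinNode_cases z with rfl | ⟨j, y, rfl⟩
    · exact .inl rfl
    · obtain ⟨_, _, _, h'⟩ := WithBot.coe_le_coe.1 h
      exact .inr ⟨_, rfl, h'⟩
  · rintro (rfl | ⟨y, rfl, h⟩)
    · exact bot_le
    · exact nd_le_nd.2 h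

theorem nd_lt_nd {i : Fin N} {x y : (T i).Node} : nd T i x < nd T i y ↔ x < y := by
  rw [lt_iff_le_not_ge, lt_iff_le_not_ge, nd_le_nd, nd_le_nd]

theorem bot_covBy_iff {z : JoinNode T} : ⊥ ⋖ z ↔ ∃ i x, z = nd T i x ∧ IsBot x := by
  constructor
  · intro h
    rcases joinNode_cases z with rfl | ⟨i, x, rfl⟩
    · exact (h.lt.ne rfl).elim
    · refine ⟨i, x, rfl, fun y => ?_⟩
      obtain ⟨m, hmx, hmy⟩ := (T i).connected x y
      rcases hmx.lt_or_eq with hm | rfl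
      · exact (h.2 (bot_lt_iff_ne_bot.2 nd_ne_bot) (nd_lt_nd.2 hm)).elim
      · exact hmy
  · rintro ⟨i, x, rfl, hx⟩
    refine ⟨bot_lt_iff_ne_bot.2 nd_ne_bot, fun z hz hzx => ?_⟩
    rcases le_nd_iff.1 hzx.le with rfl | ⟨y, rfl, hy⟩
    · exact hz.ne rfl
    · exact (nd_lt_nd.1 hzx).not_ge (hx y)

theorem nd_covBy_iff {i : Fin N} {x : (T i).Node} {z : JoinNode T} :
    nd T i x ⋖ z ↔ ∃ y, z = nd T i y ∧ x ⋖ y := by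
  constructor
  · intro h
    obtain ⟨y, rfl, -⟩ := nd_le_iff.1 h.le
    exact ⟨y, rfl, nd_lt_nd.1 h.lt, fun c hc hcy => h.2 (nd_lt_nd.2 hc) (nd_lt_nd.2 hcy)⟩
  · rintro ⟨y, rfl, h⟩
    refine ⟨nd_lt_nd.2 h.lt, fun z hz hzy => ?_⟩
    obtain ⟨w, rfl, -⟩ := nd_le_iff.1 hz.le
    exact h.2 (nd_lt_nd.1 hz) (nd_lt_nd.1 hzy)

theorem nd_covBy_nd {i : Fin N} {x y : (T i).Node} : nd T i x ⋖ nd T i y ↔ x ⋖ y := by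
  rw [nd_covBy_iff]
  exact ⟨fun ⟨z, hz, h⟩ => nd_injective hz ▸ h, fun h => ⟨y, rfl, h⟩⟩

theorem isMax_nd {i : Fin N} {x : (T i).Node} : IsMax (nd T i x) ↔ IsMax x := by
  constructor
  · exact fun h y hy => nd_le_nd.1 (h (nd_le_nd.2 hy))
  · intro h z hz
    obtain ⟨y, rfl, hy⟩ := nd_le_iff.1 hz
    exact nd_le_nd.2 (h hy)

theorem exists_isBot_le {S : Type} {T : TModel S} (x : T.Node) : ∃ b ≤ x, IsBot b := by
  obtain ⟨b, hb, hd⟩ := exists_le_depth_eq x 0 (Nat.zero_le _)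
  exact ⟨b, hb, T.depth_eq_zero_iff.1 hd⟩

/-- A root has no siblings. So a comparison inside one of the joined trees and a comparison between
roots of different trees have no node in common, which is what transitivity of `JoinTri` needs. -/
theorem not_tri_of_isBot {S : Type} {T : TModel S} {x y : T.Node} (h : T.tri x y) :
    ¬ IsBot x ∧ ¬ IsBot y := by
  have hne : x ≠ y := fun e => T.tri_irrefl y (e ▸ h)
  obtain ⟨p, -, hpx, hpy⟩ := (T.tri_comparable x y hne).1 (.inl h)
  exact ⟨fun hx => hpx.lt.not_ge (hx p), fun hy => hpy.lt.not_ge (hy p)⟩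

theorem joinTri_nd {l : NodeLabel} {i : Fin N} {x y : (T i).Node} :
    JoinTri T l (nd T i x) (nd T i y) ↔ (T i).tri x y := by
  constructor
  · generalize hz : nd T i x = z
    generalize hw : nd T i y = w
    rintro (⟨j, x', y', h⟩ | ⟨-, j, k, hjk, x', y', -, -⟩)
    · obtain rfl := nd_eq_nd hz
      rwa [nd_injective hz, nd_injective hw]
    · obtain rfl := nd_eq_nd hz
      obtain rfl := nd_eq_nd hw
      exact (lt_irrefl _ hjk).elim
  · exact .nd i x y

theorem joinTri_nd_of_ne {l : NodeLabel} {i j : Fin N} (hij : i ≠ j) {x : (T i).Node}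
    {y : (T j).Node} : JoinTri T l (nd T i x) (nd T j y) ↔ l = .O ∧ i < j ∧ IsBot x ∧ IsBot y := by
  constructor
  · generalize hz : nd T i x = z
    generalize hw : nd T j y = w
    rintro (⟨k, x', y', h⟩ | ⟨hl, k, k', hjk, x', y', hx, hy⟩)
    · exact (hij ((nd_eq_nd hz).trans (nd_eq_nd hw).symm)).elim
    · obtain rfl := nd_eq_nd hz
      obtain rfl := nd_eq_nd hw
      exact ⟨hl, hjk, nd_injective hz ▸ hx, nd_injective hw ▸ hy⟩
  · exact fun ⟨hl, h, hx, hy⟩ => .root hl i j h x y hx hy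

theorem exists_of_joinTri {l : NodeLabel} {z w : JoinNode T} (h : JoinTri T l z w) :
    ∃ i j x y, z = nd T i x ∧ w = nd T j y := by
  rcases h with ⟨i, x, y, -⟩ | ⟨-, i, j, -, x, y, -, -⟩
  exacts [⟨i, i, x, y, rfl, rfl⟩, ⟨i, j, x, y, rfl, rfl⟩]

variable (T)

theorem joinTri_trans (l : NodeLabel) (x y z : JoinNode T) (h : JoinTri T l x y)
    (h' : JoinTri T l y z) : JoinTri T l x z := by
  obtain ⟨i, j, x, y, rfl, rfl⟩ := exists_of_joinTri h
  obtain ⟨_, k, _, z, -, rfl⟩ := exists_of_joinTri h'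
  by_cases hij : i = j
  · subst hij
    have h1 := joinTri_nd.1 h
    by_cases hik : i = k
    · subst hik
      exact joinTri_nd.2 ((T i).tri_trans _ _ _ h1 (joinTri_nd.1 h'))
    · exact ((not_tri_of_isBot h1).2 ((joinTri_nd_of_ne hik).1 h').2.2.1).elim
  · obtain ⟨hl, hlt, hx, hy⟩ := (joinTri_nd_of_ne hij).1 h
    by_cases hjk : j = k
    · subst hjk
      exact ((not_tri_of_isBot (joinTri_nd.1 h')).1 hy).elim
    · obtain ⟨-, hlt', -, hz⟩ := (joinTri_nd_of_ne hjk).1 h'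
      exact .root hl i k (hlt.trans hlt') x z hx hz

/-- The nodes of the join with ordered children. -/
def joinC (l : NodeLabel) : Set (JoinNode T) :=
  {z | (z = ⊥ ∧ l = .O) ∨ ∃ i x, z = nd T i x ∧ x ∈ (T i).C}

variable {T} in
theorem nd_mem_joinC {l : NodeLabel} {i : Fin N} {x : (T i).Node} :
    nd T i x ∈ joinC T l ↔ x ∈ (T i).C := by
  constructor
  · rintro (⟨h, -⟩ | ⟨j, y, h, hy⟩)
    · exact (nd_ne_bot h).elim
    · obtain rfl := nd_eq_nd h
      rwa [nd_injective h]
  · exact fun h => .inr ⟨i, x, rfl, h⟩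

variable {T} in
theorem bot_mem_joinC {l : NodeLabel} : ⊥ ∈ joinC T l ↔ l = .O := by
  constructor
  · rintro (⟨-, h⟩ | ⟨i, x, h, -⟩)
    · exact h
    · exact (nd_ne_bot h.symm).elim
  · exact fun h => .inl ⟨rfl, h⟩

theorem joinTri_comparable (l : NodeLabel) (z w : JoinNode T) (hzw : z ≠ w) :
    (JoinTri T l z w ∨ JoinTri T l w z) ↔ ∃ p ∈ joinC T l, p ⋖ z ∧ p ⋖ w := by
  rcases joinNode_cases z with rfl | ⟨i, x, rfl⟩
  · refine iff_of_false ?_ fun ⟨p, _, h, _⟩ => not_lt_bot h.lt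
    rintro (h | h) <;> obtain ⟨i, j, x, y, h1, h2⟩ := exists_of_joinTri h
    exacts [nd_ne_bot h1.symm, nd_ne_bot h2.symm]
  rcases joinNode_cases w with rfl | ⟨j, y, rfl⟩
  · refine iff_of_false ?_ fun ⟨p, _, _, h⟩ => not_lt_bot h.lt
    rintro (h | h) <;> obtain ⟨i, j, x, y, h1, h2⟩ := exists_of_joinTri h
    exacts [nd_ne_bot h2.symm, nd_ne_bot h1.symm]
  by_cases hij : i = j
  · subst hij
    rw [joinTri_nd, joinTri_nd, (T i).tri_comparable x y fun h => hzw (h ▸ rfl)]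
    constructor
    · rintro ⟨p, hp, hx, hy⟩
      exact ⟨nd T i p, nd_mem_joinC.2 hp, nd_covBy_nd.2 hx, nd_covBy_nd.2 hy⟩
    · rintro ⟨p, hp, hx, hy⟩
      rcases le_nd_iff.1 hx.le with rfl | ⟨p, rfl, -⟩
      · obtain ⟨j, x', h1, hx'⟩ := bot_covBy_iff.1 hx
        obtain ⟨k, y', h2, hy'⟩ := bot_covBy_iff.1 hy
        obtain rfl := nd_eq_nd h1
        obtain rfl := nd_eq_nd h2
        rw [h1, h2] at hzw
        exact (hzw (congrArg _ (le_antisymm (hx' _) (hy' _)))).elim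
      · exact ⟨p, nd_mem_joinC.1 hp, nd_covBy_nd.1 hx, nd_covBy_nd.1 hy⟩
  · rw [joinTri_nd_of_ne hij, joinTri_nd_of_ne (Ne.symm hij)]
    constructor
    · intro h
      have : l = .O ∧ IsBot x ∧ IsBot y :=
        h.elim (fun h => ⟨h.1, h.2.2.1, h.2.2.2⟩) fun h => ⟨h.1, h.2.2.2, h.2.2.1⟩
      exact ⟨⊥, bot_mem_joinC.2 this.1, bot_covBy_iff.2 ⟨i, x, rfl, this.2.1⟩,
        bot_covBy_iff.2 ⟨j, y, rfl, this.2.2⟩⟩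
    · rintro ⟨p, hp, hx, hy⟩
      rcases le_nd_iff.1 hx.le with rfl | ⟨p, rfl, -⟩
      · obtain ⟨i', x', h1, hx'⟩ := bot_covBy_iff.1 hx
        obtain ⟨j', y', h2, hy'⟩ := bot_covBy_iff.1 hy
        obtain rfl := nd_eq_nd h1
        obtain rfl := nd_eq_nd h2
        rw [← nd_injective h1] at hx'
        rw [← nd_injective h2] at hy'
        have hl := bot_mem_joinC.1 hp
        exact (lt_or_gt_of_ne hij).imp (fun h => ⟨hl, h, hx', hy'⟩) fun h => ⟨hl, h, hy', hx'⟩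
      · obtain ⟨y', h, -⟩ := nd_covBy_iff.1 hy
        exact (hij (nd_eq_nd h).symm).elim

/-- The join of a family of trees, with a new root labeled `l`. -/
def join (l : NodeLabel) (c : S → Fin 2) (hX : X.Nonempty) : TModel X where
  Node := JoinNode T
  finite := inferInstanceAs (Finite (Option (Σ i, (T i).Node)))
  order := inferInstance
  chain x y z hx hy := by
    rcases joinNode_cases x with rfl | ⟨i, x, rfl⟩
    · exact .inl bot_le
    rcases joinNode_cases y with rfl | ⟨j, y, rfl⟩
    · exact .inr bot_le
    obtain ⟨w, rfl, hxw⟩ := nd_le_iff.1 hx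
    obtain ⟨w', h, hyw⟩ := nd_le_iff.1 hy
    obtain rfl := nd_eq_nd h
    obtain rfl := nd_injective h
    exact ((T i).chain x y w hxw hyw).imp nd_le_nd.2 nd_le_nd.2
  connected x y := ⟨⊥, bot_le, bot_le⟩
  C := joinC T l
  -- Some of the joined trees may be empty. As `X` is nonempty, at least one of them has a node, and
  -- the new root is internal.
  C_internal z hz h := by
    rcases hz with ⟨rfl, -⟩ | ⟨i, x, rfl, hx⟩
    · obtain ⟨s, hs⟩ := hX
      exact nd_ne_bot (le_bot_iff.1
        (h (bot_le : ⊥ ≤ nd T (r s) ((T (r s)).leaf ⟨s, hs, rfl⟩))))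
    · exact (T i).C_internal x hx (isMax_nd.1 h)
  tri := JoinTri T l
  tri_irrefl z h := by
    obtain ⟨i, -, x, -, rfl, -⟩ := exists_of_joinTri h
    exact (T i).tri_irrefl x (joinTri_nd.1 h)
  tri_trans := joinTri_trans T l
  tri_comparable := joinTri_comparable T l
  leaf s := nd T (r s) ((T (r s)).leaf ⟨s, s.2, rfl⟩)
  leaf_injective := by
    rintro ⟨s, hs⟩ ⟨t, ht⟩ h
    have key : ∀ i (hi : r t = i), nd T (r s) ((T (r s)).leaf ⟨s, hs, rfl⟩) =
        nd T i ((T i).leaf ⟨t, ht, hi⟩) → s = t := by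
      intro i hi h
      obtain rfl := nd_eq_nd h
      exact congrArg Subtype.val ((T _).leaf_injective (nd_injective h))
    exact Subtype.ext (key _ rfl h)
  leaf_range := by
    ext z
    constructor
    · rintro ⟨s, rfl⟩
      exact isMax_nd.2 ((T _).isMax_leaf _)
    · intro hz
      rcases joinNode_cases z with rfl | ⟨i, x, rfl⟩
      · obtain ⟨s, hs⟩ := hX
        exact (nd_ne_bot (le_bot_iff.1
          (hz (bot_le : ⊥ ≤ nd T (r s) ((T (r s)).leaf ⟨s, hs, rfl⟩))))).elim
      · obtain ⟨⟨s, hs, rfl⟩, rfl⟩ := (T i).exists_eq_leaf (isMax_nd.1 hz)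
        exact ⟨⟨s, hs⟩, rfl⟩
  label z := z.recBotCoe l fun x => (T x.1).label x.2
  color s := c s

variable {T} {l : NodeLabel} {c : S → Fin 2} {hX : X.Nonempty}

theorem join_leaf {i : Fin N} (s : {x // x ∈ X ∧ r x = i}) :
    (join T l c hX).leaf ⟨s, s.2.1⟩ = nd T i ((T i).leaf s) := by
  obtain ⟨s, hs, rfl⟩ := s
  rfl

theorem not_isMax_bot : ¬ IsMax (α := (join T l c hX).Node) (⊥ : JoinNode T) := by
  obtain ⟨s, hs⟩ := hX
  intro h
  exact nd_ne_bot (le_bot_iff.1 (h (bot_le : ⊥ ≤ nd T (r s) ((T (r s)).leaf ⟨s, hs, rfl⟩))))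

theorem HeightLE.join {k : ℕ} (hT : ∀ i, (T i).HeightLE k) :
    (join T l c hX).HeightLE (k + 1) := by
  intro z
  rcases joinNode_cases z with rfl | ⟨i, x, rfl⟩
  · have : Set.Iic (⊥ : JoinNode T) = {⊥} := Set.Iic_bot
    have h : (Set.Iic (⊥ : JoinNode T)).ncard ≤ k + 1 := by
      rw [this, Set.ncard_singleton]
      omega
    exact h
  · have : Set.Iic (nd T i x) = insert ⊥ (nd T i '' Set.Iic x) := by
      ext z
      refine le_nd_iff.trans (or_congr Iff.rfl ?_)
      exact ⟨fun ⟨y, hy, h⟩ => ⟨y, h, hy.symm⟩, fun ⟨y, h, hy⟩ => ⟨y, hy.symm, h⟩⟩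
    have h : (Set.Iic (nd T i x)).ncard ≤ k + 1 := by
      rw [this]
      refine (Set.ncard_insert_le _ _).trans ?_
      rw [Set.ncard_image_of_injective _ nd_injective]
      exact Nat.succ_le_succ (hT i x)
    exact h

theorem IsCotree.join (hT : ∀ i, (T i).IsCotree) (hl : l = .U ∨ l = .J) (hc : ∀ s, c s = 0) :
    (join T l c hX).IsCotree := by
  refine ⟨?_, fun s => hc s, fun z hz => ?_⟩
  · refine Set.eq_empty_of_forall_notMem fun z hz => ?_
    rcases hz with ⟨-, rfl⟩ | ⟨i, x, -, hx⟩
    · simp at hl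
    · rw [(hT i).1] at hx
      exact hx
  · rcases joinNode_cases z with rfl | ⟨i, x, rfl⟩
    · exact hl
    · exact (hT i).2.2 x fun h => hz (isMax_nd.2 h)

theorem IsBicotree.join (hT : ∀ i, (T i).IsBicotree) (hl : l ≠ .J) :
    (join T l c hX).IsBicotree := by
  intro z hz
  rcases joinNode_cases z with rfl | ⟨i, x, rfl⟩
  · change (⊥ ∉ joinC T l ∧ l = .U) ∨ (⊥ ∉ joinC T l ∧ l = .B) ∨ (⊥ ∈ joinC T l ∧ l = .O)
    simp only [bot_mem_joinC]
    cases l <;> simp at hl ⊢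
  · change (nd T i x ∉ joinC T l ∧ (T i).label x = .U) ∨ (nd T i x ∉ joinC T l ∧ (T i).label x = .B) ∨
      (nd T i x ∈ joinC T l ∧ (T i).label x = .O)
    simp only [nd_mem_joinC]
    exact hT i x fun h => hz (isMax_nd.2 h)

theorem isGLB_nd {i : Fin N} {x y : (T i).Node} {z : JoinNode T} :
    IsGLB {nd T i x, nd T i y} z ↔ ∃ m, z = nd T i m ∧ IsGLB {x, y} m := by
  have key : ∀ m, IsGLB {x, y} m → IsGLB {nd T i x, nd T i y} (nd T i m) := by
    intro m hm
    have h1 : m ≤ x := hm.1 (by simp)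
    have h2 : m ≤ y := hm.1 (by simp)
    refine ⟨by simp [lowerBounds, nd_le_nd, h1, h2], fun z hz => ?_⟩
    have hz : z ≤ nd T i x ∧ z ≤ nd T i y := by simpa [lowerBounds] using hz
    rcases le_nd_iff.1 hz.1 with rfl | ⟨w, rfl, hw⟩
    · exact bot_le
    · exact nd_le_nd.2 (hm.2 (by simp [lowerBounds, hw, nd_le_nd.1 hz.2]))
  constructor
  · intro h
    have : Nonempty (T i).Node := ⟨x⟩
    obtain ⟨m, hm⟩ := (T i).exists_isGLB x y
    exact ⟨m, h.unique (key m hm), hm⟩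
  · rintro ⟨m, rfl, hm⟩
    exact key m hm

theorem isGLB_nd_of_ne {i j : Fin N} (hij : i ≠ j) {x : (T i).Node} {y : (T j).Node} :
    IsGLB {nd T i x, nd T j y} ⊥ := by
  refine ⟨by simp [lowerBounds], fun z hz => ?_⟩
  have hz : z ≤ nd T i x ∧ z ≤ nd T j y := by simpa [lowerBounds] using hz
  rcases le_nd_iff.1 hz.1 with rfl | ⟨w, rfl, hw⟩
  · exact le_rfl
  · obtain ⟨v, h, -⟩ := nd_le_iff.1 hz.2
    exact (hij (nd_eq_nd h).symm).elim

theorem join_joins {i : Fin N} (hc : ∀ s, (T i).color s = c s) (s t : {x // x ∈ X ∧ r x = i}) :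
    (join T l c hX).Joins ⟨s, s.2.1⟩ ⟨t, t.2.1⟩ ↔ (T i).Joins s t := by
  unfold Joins
  rw [join_leaf, join_leaf, hc, hc]
  constructor
  · rintro ⟨z, hz, h, h'⟩
    obtain ⟨m, rfl, hm⟩ := isGLB_nd.1 hz
    refine ⟨m, hm, fun hC => ?_, h'⟩
    obtain ⟨a, b, h1, h2, h3, h4, h5⟩ := h (nd_mem_joinC.2 hC)
    obtain ⟨a, rfl, h6⟩ := nd_covBy_iff.1 h1
    obtain ⟨b, rfl, h7⟩ := nd_covBy_iff.1 h3
    exact ⟨a, b, h6, nd_le_nd.1 h2, h7, nd_le_nd.1 h4, joinTri_nd.1 h5⟩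
  · rintro ⟨m, hm, h, h'⟩
    refine ⟨nd T i m, isGLB_nd.2 ⟨m, rfl, hm⟩, fun hC => ?_, h'⟩
    obtain ⟨a, b, h1, h2, h3, h4, h5⟩ := h (nd_mem_joinC.1 hC)
    exact ⟨nd T i a, nd T i b, nd_covBy_nd.2 h1, nd_le_nd.2 h2, nd_covBy_nd.2 h3, nd_le_nd.2 h4,
      joinTri_nd.2 h5⟩

/-- Leaves of different trees have the new root as their infimum. Its children are the old roots,
and if it is an O-node these are ordered by the indices of the trees. -/
theorem join_joins_of_ne {s t : X} (hst : r s ≠ r t) :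
    (join T l c hX).Joins s t ↔ (l = .O → r s < r t) ∧ l.kappa (c s) (c t) := by
  have hglb : IsGLB {(join T l c hX).leaf s, (join T l c hX).leaf t} (⊥ : JoinNode T) :=
    isGLB_nd_of_ne hst
  constructor
  · rintro ⟨m, hm, h, h'⟩
    obtain rfl := hglb.unique hm
    refine ⟨fun hl => ?_, h'⟩
    obtain ⟨a, b, h1, h2, h3, h4, h5⟩ := h (bot_mem_joinC.2 hl)
    obtain ⟨i, a, rfl, -⟩ := bot_covBy_iff.1 h1
    obtain ⟨j, b, rfl, -⟩ := bot_covBy_iff.1 h3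
    obtain ⟨a', h6, -⟩ := nd_le_iff.1 h2
    obtain ⟨b', h7, -⟩ := nd_le_iff.1 h4
    obtain rfl := nd_eq_nd h6
    obtain rfl := nd_eq_nd h7
    exact ((joinTri_nd_of_ne hst).1 h5).2.1
  · rintro ⟨h, h'⟩
    refine ⟨(⊥ : JoinNode T), hglb, fun hC => ?_, h'⟩
    have hl := bot_mem_joinC.1 hC
    obtain ⟨a, ha, ha'⟩ := exists_isBot_le ((T (r s)).leaf ⟨s, s.2, rfl⟩)
    obtain ⟨b, hb, hb'⟩ := exists_isBot_le ((T (r t)).leaf ⟨t, t.2, rfl⟩)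
    exact ⟨nd T _ a, nd T _ b, bot_covBy_iff.2 ⟨_, a, rfl, ha'⟩, nd_le_nd.2 ha,
      bot_covBy_iff.2 ⟨_, b, rfl, hb'⟩, nd_le_nd.2 hb, .root hl _ _ (h hl) a b ha' hb'⟩

/-- The graph modeled by the join. -/
theorem join_graph {K : SimpleGraph S} (hc : ∀ i s, (T i).color s = c s)
    (hT : ∀ i, (T i).graph = K.comap Subtype.val)
    (hK : ∀ x ∈ X, ∀ y ∈ X, r x < r y → (K.Adj x y ↔ l.kappa (c x) (c y))) :
    (join T l c hX).graph = K.comap Subtype.val := by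
  have hsymm : l ≠ .O → ∀ i j : Fin 2, l.kappa i j → l.kappa j i := by
    cases l <;> simp [NodeLabel.kappa]
  have key : ∀ s t : X, r s < r t → ((join T l c hX).graph.Adj s t ↔ K.Adj s t) := by
    intro s t hst
    rw [hK s s.2 t t.2 hst]
    have hne : s ≠ t := fun e => hst.ne (e ▸ rfl)
    change s ≠ t ∧ (_ ∨ _) ↔ _
    rw [join_joins_of_ne hst.ne, join_joins_of_ne hst.ne']
    constructor
    · rintro ⟨-, h | ⟨h, h'⟩⟩
      · exact h.2
      · exact hsymm (fun hl => hst.asymm (h hl)) _ _ h'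
    · exact fun h => ⟨hne, .inl ⟨fun _ => hst, h⟩⟩
  ext ⟨s, hs⟩ ⟨t, ht⟩
  rcases lt_trichotomy (r s) (r t) with h | h | h
  · exact key ⟨s, hs⟩ ⟨t, ht⟩ h
  · have h1 : (T (r s)).graph.Adj ⟨s, hs, rfl⟩ ⟨t, ht, h.symm⟩ ↔ K.Adj s t := by
      rw [hT]
      rfl
    refine Iff.trans ?_ h1
    refine and_congr (not_congr ?_) (or_congr (join_joins (hc _) ⟨s, hs, rfl⟩ ⟨t, ht, h.symm⟩)
      (join_joins (hc _) ⟨t, ht, h.symm⟩ ⟨s, hs, rfl⟩))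
    simp
  · rw [SimpleGraph.adj_comm, key ⟨t, ht⟩ ⟨s, hs⟩ h]
    exact K.adj_comm t s

end Join

end TModel

/-! ### Components -/

section Components

variable {S : Type}

theorem CutConn.map {X Y : Type} {W : X → Prop} {K : X → X → Prop} {W' : Y → Prop}
    {K' : Y → Y → Prop} {g : X → Y} (h : CutConn W K) (hW : ∀ y, W' y ↔ ∃ x, W x ∧ g x = y)
    (hK : ∀ x y, W x → W y → K x y → K' (g x) (g y)) : CutConn W' K' := by
  rintro Z ⟨x', hx', hxZ⟩ ⟨y', hy', hyZ⟩
  obtain ⟨x, hx, rfl⟩ := (hW x').1 hx'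
  obtain ⟨y, hy, rfl⟩ := (hW y').1 hy'
  obtain ⟨x, y, hx, hy, hxZ, hyZ, h⟩ := h (fun x => Z (g x)) ⟨x, hx, hxZ⟩ ⟨y, hy, hyZ⟩
  exact ⟨g x, g y, (hW _).2 ⟨x, hx, rfl⟩, (hW _).2 ⟨y, hy, rfl⟩, hxZ, hyZ, hK x y hx hy h⟩

/-- The components are the classes of the equivalence relation generated by `K` inside `X`. Points
outside of `X` form classes of their own, with empty trace on `X`; this does no harm, since the
empty set is cut-connected. -/
theorem exists_components [Finite S] (X : Set S) {K : S → S → Prop}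
    (hK : ∀ x y, K x y → K y x) : ∃ (N : ℕ) (r : S → Fin N),
      (∀ x ∈ X, ∀ y ∈ X, K x y → r x = r y) ∧ ∀ i, CutConn (fun x => x ∈ X ∧ r x = i) K := by
  let R : S → S → Prop := fun x y => x ∈ X ∧ y ∈ X ∧ K x y
  have hR : Std.Symm R := ⟨fun x y h => ⟨h.2.1, h.1, hK x y h.2.2⟩⟩
  have hR' : Std.Symm (Relation.ReflTransGen R) := Relation.ReflTransGen.stdSymm
  let E : Setoid S := ⟨Relation.ReflTransGen R, fun _ => .refl,
    fun h => hR'.symm _ _ h, .trans⟩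
  obtain ⟨N, ⟨e⟩⟩ := Finite.exists_equiv_fin (Quotient E)
  refine ⟨N, fun x => e ⟦x⟧, fun x hx y hy h => congrArg e (Quotient.sound ?_), ?_⟩
  · exact Relation.ReflTransGen.single ⟨hx, hy, h⟩
  · rintro i Z ⟨x, ⟨hx, rfl⟩, hxZ⟩ ⟨y, ⟨hy, hyx⟩, hyZ⟩
    by_contra hno
    have hxy : Relation.ReflTransGen R x y := Quotient.exact (e.injective hyx.symm)
    have key : Z y := by
      clear hyx hyZ hy
      induction hxy with
      | refl => exact hxZ
      | @tail a b hxa hab ih =>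
        by_contra hb
        have ha : e ⟦a⟧ = e ⟦x⟧ := congrArg e (Quotient.sound (E.symm hxa))
        have hb' : e ⟦b⟧ = e ⟦x⟧ := congrArg e (Quotient.sound (E.symm (hxa.tail hab)))
        exact hno ⟨a, b, ⟨hab.1, ha⟩, ⟨hab.2.1, hb'⟩, ih, hb, hab.2.2⟩
    exact hyZ key

end Components

namespace TModel

variable {S : Type}

/-- The characterization by cuts and single edges avoids walks, so that it can be carried from the
joined trees to their join. -/
theorem childrenAreComponents_iff {T : TModel S} {K : SimpleGraph S} {u : T.Node}
    (hu : ¬ IsMax u) : T.ChildrenAreComponents K u ↔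
      (∀ v, u ⋖ v → CutConn (· ∈ T.leaves v) K.Adj) ∧
        ∀ s ∈ T.leaves u, ∀ t ∈ T.leaves u, K.Adj s t → T.SameChild u s t := by
  constructor
  · intro h
    refine ⟨fun v hv => cutConn_of_childrenAreComponents h hv, fun s hs t ht hst => ?_⟩
    have hst : (K.induce (T.leaves u)).Adj ⟨s, hs⟩ ⟨t, ht⟩ := hst
    exact (h _ _).1 hst.reachable
  · rintro ⟨h1, h2⟩ s t
    constructor
    · rintro ⟨p⟩
      change T.SameChild u s t
      induction p with
      | @nil s => exact sameChild_self hu s.2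
      | @cons x y z hxy _ ih => exact (h2 x x.2 y y.2 hxy).trans ih
    · rintro ⟨v, hv, hs, ht⟩
      by_contra hst
      obtain ⟨x, y, hx, hy, ⟨_, hsx⟩, hsy, hxy⟩ := h1 v hv
        (fun y => ∃ h : y ∈ T.leaves u, (K.induce (T.leaves u)).Reachable s ⟨y, h⟩)
        ⟨s, hs, s.2, .rfl⟩ ⟨t, ht, fun h => hst h.2⟩
      have hxy : (K.induce (T.leaves u)).Adj ⟨x, hv.le.trans hx⟩ ⟨y, hv.le.trans hy⟩ := hxy
      exact hsy ⟨_, hsx.trans hxy.reachable⟩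

section Join

variable {N : ℕ} {X : Set S} {r : S → Fin N} {T : ∀ i, TModel {x // x ∈ X ∧ r x = i}}
  {l : NodeLabel} {c : S → Fin 2} {hX : X.Nonempty} {K : SimpleGraph S}

theorem mem_leaves_nd {i : Fin N} {u : (T i).Node} {s : X} :
    s ∈ (join T l c hX).leaves (nd T i u) ↔
      ∃ t ∈ (T i).leaves u, (⟨t, t.2.1⟩ : X) = s := by
  constructor
  · intro h
    obtain ⟨y, hy, huy⟩ := nd_le_iff.1 h
    obtain ⟨s, hs⟩ := s
    obtain rfl : r s = i := nd_eq_nd hy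
    obtain rfl := nd_injective hy
    exact ⟨⟨s, hs, rfl⟩, huy, rfl⟩
  · rintro ⟨t, ht, rfl⟩
    change nd T i u ≤ (join T l c hX).leaf _
    rw [join_leaf]
    exact nd_le_nd.2 ht

theorem mem_leaves_nd_of_isBot {i : Fin N} {u : (T i).Node} (hu : IsBot u) {s : X} :
    s ∈ (join T l c hX).leaves (nd T i u) ↔ r s = i := by
  rw [mem_leaves_nd]
  constructor
  · rintro ⟨t, -, rfl⟩
    exact t.2.2
  · exact fun h => ⟨⟨s, s.2, h⟩, hu _, rfl⟩

theorem sameChild_nd {i : Fin N} {u : (T i).Node} {s t : {x // x ∈ X ∧ r x = i}}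
    (h : (T i).SameChild u s t) :
    (join T l c hX).SameChild (nd T i u) ⟨s, s.2.1⟩ ⟨t, t.2.1⟩ := by
  obtain ⟨v, hv, hs, ht⟩ := h
  refine ⟨nd T i v, nd_covBy_nd.2 hv, ?_⟩
  rw [join_leaf, join_leaf]
  exact ⟨nd_le_nd.2 hs, nd_le_nd.2 ht⟩

theorem ChildrenAreComponents.join {i : Fin N} {u : (T i).Node} (hu : ¬ IsMax u)
    {A : SimpleGraph {x // x ∈ X ∧ r x = i}} {B : SimpleGraph X}
    (hAB : ∀ s t, A.Adj s t ↔ B.Adj ⟨s, s.2.1⟩ ⟨t, t.2.1⟩)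
    (h : (T i).ChildrenAreComponents A u) :
    (join T l c hX).ChildrenAreComponents B (nd T i u) := by
  rw [childrenAreComponents_iff hu] at h
  refine (childrenAreComponents_iff fun h' => hu (isMax_nd.1 h')).2 ⟨?_, ?_⟩
  · intro v' hv'
    obtain ⟨v, rfl, hv⟩ := nd_covBy_iff.1 hv'
    exact (h.1 v hv).map (fun _ => mem_leaves_nd) fun s t _ _ hst => (hAB s t).1 hst
  · intro s' hs' t' ht' hst
    obtain ⟨s, hs, rfl⟩ := mem_leaves_nd.1 hs'
    obtain ⟨t, ht, rfl⟩ := mem_leaves_nd.1 ht'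
    exact sameChild_nd (h.2 s hs t ht ((hAB s t).2 hst))

theorem childrenAreComponents_bot {B : SimpleGraph X} {R : S → S → Prop}
    (hB : ∀ s t, B.Adj s t ↔ R s t) (hR : ∀ x ∈ X, ∀ y ∈ X, R x y → r x = r y)
    (hr : ∀ i, CutConn (fun x => x ∈ X ∧ r x = i) R) :
    (join T l c hX).ChildrenAreComponents B (⊥ : JoinNode T) := by
  refine (childrenAreComponents_iff not_isMax_bot).2 ⟨?_, ?_⟩
  · intro v' hv'
    obtain ⟨i, v, rfl, hv⟩ := bot_covBy_iff.1 hv'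
    rintro Z ⟨x, hx, hxZ⟩ ⟨y, hy, hyZ⟩
    obtain ⟨x, y, ⟨hxX, hx⟩, ⟨hyX, hy⟩, ⟨_, hxZ⟩, hyZ, h⟩ := hr i (fun x => ∃ h : x ∈ X, Z ⟨x, h⟩)
      ⟨x, ⟨x.2, (mem_leaves_nd_of_isBot hv).1 hx⟩, x.2, hxZ⟩
      ⟨y, ⟨y.2, (mem_leaves_nd_of_isBot hv).1 hy⟩, fun h => hyZ h.2⟩
    exact ⟨⟨x, hxX⟩, ⟨y, hyX⟩, (mem_leaves_nd_of_isBot hv).2 hx, (mem_leaves_nd_of_isBot hv).2 hy,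
      hxZ, fun h => hyZ ⟨hyX, h⟩, (hB _ _).2 h⟩
  · intro s _ t _ hst
    have hst := hR s s.2 t t.2 ((hB s t).1 hst)
    obtain ⟨b, -, hb⟩ := exists_isBot_le ((T (r s)).leaf ⟨s, s.2, rfl⟩)
    exact ⟨nd T _ b, bot_covBy_iff.2 ⟨_, b, rfl, hb⟩, (mem_leaves_nd_of_isBot hb).2 rfl,
      (mem_leaves_nd_of_isBot hb).2 hst.symm⟩

/-- At the old nodes nothing changes, because the join models a graph that induces the old graphs.
Only the conditions at the new root remain to be supplied. -/
theorem CleanBicotree.join (hT : ∀ i, (T i).CleanBicotree) (hc : ∀ i s, (T i).color s = c s)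
    (hg : ∀ i, (T i).graph = K.comap Subtype.val)
    (hg' : (join T l c hX).graph = K.comap Subtype.val)
    (hU : l = .U → (join T l c hX).ChildrenAreComponents (join T l c hX).graph (⊥ : JoinNode T))
    (hB : l = .B → (join T l c hX).ChildrenAreComponents (join T l c hX).bipCompl (⊥ : JoinNode T))
    (hO : l = .O → ∀ i, (∃ x ∈ X, r x = i) → ∀ d, ∃ x ∈ X, r x = i ∧ c x = d) :
    (join T l c hX).CleanBicotree := by
  intro z hz
  rcases joinNode_cases z with rfl | ⟨i, u, rfl⟩
  · refine ⟨hU, hB, fun hl v' hv' d => ?_⟩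
    obtain ⟨i, v, rfl, hv⟩ := bot_covBy_iff.1 hv'
    obtain ⟨s, -⟩ := (T i).exists_leaf_ge v
    obtain ⟨x, hx, hxi, hxd⟩ := hO hl i ⟨s, s.2⟩ d
    exact ⟨⟨x, hx⟩, (mem_leaves_nd_of_isBot hv).2 hxi, hxd⟩
  · have hu : ¬ IsMax u := fun h => hz (isMax_nd.2 h)
    obtain ⟨h1, h2, h3⟩ := hT i u hu
    have hadj : ∀ s t, (T i).graph.Adj s t ↔
        (TModel.join T l c hX).graph.Adj ⟨s, s.2.1⟩ ⟨t, t.2.1⟩ := fun s t => by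
      rw [hg, hg']
      rfl
    refine ⟨fun hl => (h1 hl).join hu hadj, fun hl => (h2 hl).join hu fun s t => ?_,
      fun hl v' hv' d => ?_⟩
    · exact and_congr (by rw [hc, hc]; rfl) (not_congr (hadj s t))
    · obtain ⟨v, rfl, hv⟩ := nd_covBy_iff.1 hv'
      obtain ⟨s, hs, hsd⟩ := h3 hl v hv d
      exact ⟨⟨s, s.2.1⟩, mem_leaves_nd.2 ⟨s, hs, rfl⟩, (hc i s).symm.trans hsd⟩

end Join

end TModel

/-! ### Clean models of cographs and sobs of bounded height -/

/-- The tree with a single node. -/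
def TModel.single (S : Type) [Unique S] (c : Fin 2) : TModel S where
  Node := Unit
  finite := inferInstance
  order := inferInstance
  chain _ _ _ _ _ := .inl le_rfl
  connected _ _ := ⟨(), le_rfl, le_rfl⟩
  C := ∅
  C_internal _ h := h.elim
  tri _ _ := False
  tri_irrefl _ := id
  tri_trans _ _ _ h := h.elim
  tri_comparable _ _ h := (h rfl).elim
  leaf _ := ()
  leaf_injective _ _ _ := Subsingleton.elim _ _
  leaf_range := by
    ext x
    exact ⟨fun _ => fun _ _ => le_rfl, fun _ => ⟨default, rfl⟩⟩
  label _ := .U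
  color _ := c

/-- The set `X` lies in a subtree of height at most `h`. -/
def TModel.Within {S : Type} (T : TModel S) (h : ℕ) (X : Set S) : Prop :=
  ∃ a, (∀ x ∈ X, a ≤ T.leaf x) ∧ ∀ y, a ≤ y → T.depth y < T.depth a + h

section Within

variable {S : Type} {T : TModel S}

theorem TModel.Within.subset {h : ℕ} {X Y : Set S} (hX : T.Within h X) (hY : Y ⊆ X) :
    T.Within h Y := by
  obtain ⟨a, ha, hd⟩ := hX
  exact ⟨a, fun x hx => ha x (hY hx), hd⟩

theorem TModel.within_child {h : ℕ} {X : Set S} {a b : T.Node}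
    (hd : ∀ y, a ≤ y → T.depth y < T.depth a + (h + 1)) (hab : a ⋖ b)
    (hX : ∀ x ∈ X, b ≤ T.leaf x) : T.Within h X := by
  refine ⟨b, hX, fun y hy => ?_⟩
  have := hd y (hab.le.trans hy)
  have := TModel.depth_of_covBy hab
  omega

/-- A set that is connected by a relation that does not hold between leaves above different children
lies above one child. -/
theorem TModel.within_of_cutConn {h : ℕ} {X : Set S} {a : T.Node} (ha : ¬ IsMax a)
    (hX : ∀ x ∈ X, a ≤ T.leaf x) (hd : ∀ y, a ≤ y → T.depth y < T.depth a + (h + 1))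
    {R : S → S → Prop} (hR : ∀ b b' x y, a ⋖ b → a ⋖ b' → b ≠ b' → b ≤ T.leaf x → b' ≤ T.leaf y →
      ¬ R x y) (hne : X.Nonempty) (hconn : CutConn (· ∈ X) R) : T.Within h X := by
  obtain ⟨x, hx⟩ := hne
  obtain ⟨b, hab, hbx⟩ := exists_child_of_mem_leaves ha (hX x hx)
  refine within_child hd hab fun y hy => ?_
  by_contra hby
  obtain ⟨p, q, hp, hq, hbp, hbq, hpq⟩ := hconn (fun z => b ≤ T.leaf z) ⟨x, hx, hbx⟩ ⟨y, hy, hby⟩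
  obtain ⟨b', hab', hbq'⟩ := exists_child_of_mem_leaves ha (hX q hq)
  exact hR b b' p q hab hab' (fun h => hbq (h ▸ hbq')) hbp hbq' hpq

theorem TModel.subsingleton_of_isMax {X : Set S} {a : T.Node} (ha : IsMax a)
    (hX : ∀ x ∈ X, a ≤ T.leaf x) : X.Subsingleton := fun x hx y hy =>
  T.leaf_injective ((le_antisymm (hX x hx) (ha (hX x hx))).symm.trans
    (le_antisymm (hX y hy) (ha (hX y hy))))

end Within

/-! ### Clean cotrees -/

section Cotree

variable {S : Type} (K : SimpleGraph S)

/-- The relation that connects the leaves above a node labeled J or U whose parent has a different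
label. -/
def LabelRel (l : NodeLabel) (x y : S) : Prop := l = .U ↔ K.Adj x y

/-- The subgraph of `K` induced by `X` has a clean cotree of height at most `h`; the graph
respectively its complement is disconnected, in accordance with the label of the root. -/
def HasCleanCotree (h : ℕ) (X : Set S) : Prop :=
  ∃ T : TModel X, T.IsCotree ∧ T.CleanCotree ∧ T.HeightLE h ∧ T.graph = K.comap Subtype.val ∧
    ∀ u : T.Node, IsBot u → ¬ IsMax u → ¬ CutConn (· ∈ X) (LabelRel K (T.label u))

variable {K}

theorem HasCleanCotree.mono {h k : ℕ} {X : Set S} (hX : HasCleanCotree K h X) (hk : h ≤ k) :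
    HasCleanCotree K k X := by
  obtain ⟨T, h1, h2, h3, h4⟩ := hX
  exact ⟨T, h1, h2, fun x => (h3 x).trans hk, h4⟩

theorem HasCleanCotree.of_subsingleton {h : ℕ} {X : Set S} (hX : X.Subsingleton) (hh : 1 ≤ h) :
    HasCleanCotree K h X := by
  rcases X.eq_empty_or_nonempty with rfl | ⟨x, hx⟩
  · exact ⟨.empty _, ⟨rfl, fun s => s.2.elim, fun u => u.elim⟩, ⟨fun u => u.elim, fun u => u.elim⟩,
      fun u => u.elim, by ext s; exact s.2.elim, fun u => u.elim⟩
  · have : Unique X := ⟨⟨⟨x, hx⟩⟩, fun y => Subtype.ext (hX y.2 hx)⟩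
    have hmax : ∀ u : (TModel.single X 0).Node, IsMax u := fun _ _ _ => le_rfl
    refine ⟨.single X 0, ⟨rfl, fun _ => rfl, fun u hu => (hu (hmax u)).elim⟩,
      ⟨fun u hu => (hu (hmax u)).elim, fun u v _ hv => (hv (hmax v)).elim⟩, fun u => ?_, ?_,
      fun u _ hu => (hu (hmax u)).elim⟩
    · refine (Set.ncard_le_one_of_subsingleton (α := Unit) _).trans hh
    · ext s t
      obtain rfl := Subsingleton.elim s t
      simp

theorem exists_ne_of_not_cutConn {N : ℕ} {X : Set S} {r : S → Fin N} {R : S → S → Prop}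
    (hX : X.Nonempty) (hr : ∀ i, CutConn (fun x => x ∈ X ∧ r x = i) R)
    (h : ¬ CutConn (· ∈ X) R) : ∃ x ∈ X, ∃ y ∈ X, r x ≠ r y := by
  by_contra hno
  push Not at hno
  obtain ⟨x, hx⟩ := hX
  refine h ?_
  have := hr (r x)
  rwa [show (fun y => y ∈ X ∧ r y = r x) = (· ∈ X) from
    funext fun y => propext ⟨fun h => h.1, fun h => ⟨h, hno y h x hx⟩⟩] at this

/-- Induction on the height of the subtree at `a`. `LabelRel` for the label of `a` does not relate
leaves above different children of `a`, so its components on `X` lie above single children. If `X`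
is connected, `a` is superfluous; otherwise clean cotrees of the components are joined below a root
with the label of `a`. A component is connected, so by the last clause of `HasCleanCotree` the root
of its cotree cannot have this label too, and labels alternate. -/
theorem hasCleanCotree_of_within [Finite S] {T : TModel S} (hT : T.IsCotree) (h : ℕ) (X : Set S)
    (hX : T.Within h X) : HasCleanCotree T.graph h X := by
  induction h generalizing X with
  | zero =>
    obtain ⟨a, -, hd⟩ := hX
    exact absurd (hd a le_rfl) (lt_irrefl _)
  | succ h ih =>
    obtain ⟨a, ha, hd⟩ := hX
    by_cases hmax : IsMax a
    · exact .of_subsingleton (TModel.subsingleton_of_isMax hmax ha) (by omega)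
    have hdiff : ∀ b b' x y, a ⋖ b → a ⋖ b' → b ≠ b' → b ≤ T.leaf x → b' ≤ T.leaf y →
        ¬ LabelRel T.graph (T.label a) x y := by
      intro b b' x y hb hb' hne hx hy
      rw [LabelRel, TModel.adj_iff_of_isGLB_of_isCotree hT (TModel.ne_of_covBy hne hb hb' hx hy)
        (TModel.isGLB_of_covBy hne hb hb' hx hy)]
      rcases hT.2.2 a hmax with h | h <;> simp [h]
    by_cases hconn : CutConn (· ∈ X) (LabelRel T.graph (T.label a))
    · rcases X.eq_empty_or_nonempty with rfl | hne
      · exact .of_subsingleton Set.subsingleton_empty (by omega)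
      · exact (ih X (TModel.within_of_cutConn hmax ha hd hdiff hne hconn)).mono (by omega)
    have hne : X.Nonempty := by
      by_contra h
      rw [Set.not_nonempty_iff_eq_empty] at h
      subst h
      exact hconn fun Z ⟨x, hx, _⟩ => hx.elim
    obtain ⟨N, r, hr, hr'⟩ := exists_components X (K := LabelRel T.graph (T.label a))
      fun x y h => h.trans (T.graph.adj_comm x y)
    have hC : ∀ i, HasCleanCotree T.graph h {x | x ∈ X ∧ r x = i} := by
      intro i
      rcases Set.eq_empty_or_nonempty {x | x ∈ X ∧ r x = i} with h' | h'
      · rw [h']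
        obtain ⟨b, hb, -⟩ := TModel.exists_child_of_mem_leaves hmax (ha _ hne.some_mem)
        have := hd b hb.le
        have := TModel.depth_of_covBy hb
        exact .of_subsingleton Set.subsingleton_empty (by omega)
      · exact ih _ (TModel.within_of_cutConn hmax (fun x hx => ha x hx.1) hd hdiff h' (hr' i))
    choose T' h1 h2 h3 h4 h5 using hC
    let T₀ : ∀ i, TModel {x // x ∈ X ∧ r x = i} := T'
    refine ⟨TModel.join T₀ (T.label a) (fun _ => 0) hne, .join h1 (hT.2.2 a hmax) fun _ => rfl,
      ⟨?_, ?_⟩, .join h3, TModel.join_graph (fun i => (h1 i).2.1) h4 ?_, ?_⟩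
    · intro z hz
      rcases TModel.joinNode_cases z with rfl | ⟨i, u, rfl⟩
      · obtain ⟨x, hx, y, hy, hxy⟩ := exists_ne_of_not_cutConn hne hr' hconn
        obtain ⟨b, -, hb⟩ := TModel.exists_isBot_le ((T₀ (r x)).leaf ⟨x, hx, rfl⟩)
        obtain ⟨b', -, hb'⟩ := TModel.exists_isBot_le ((T₀ (r y)).leaf ⟨y, hy, rfl⟩)
        exact ⟨TModel.nd T₀ _ b, TModel.nd T₀ _ b', fun h => hxy (TModel.nd_eq_nd h),
          TModel.bot_covBy_iff.2 ⟨_, b, rfl, hb⟩, TModel.bot_covBy_iff.2 ⟨_, b', rfl, hb'⟩⟩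
      · obtain ⟨b, b', hne, hb, hb'⟩ := (h2 i).1 u fun h => hz (TModel.isMax_nd.2 h)
        exact ⟨TModel.nd T₀ _ b, TModel.nd T₀ _ b', fun h => hne (TModel.nd_injective h),
          TModel.nd_covBy_nd.2 hb, TModel.nd_covBy_nd.2 hb'⟩
    · intro z w hzw hw
      rcases TModel.joinNode_cases z with rfl | ⟨i, u, rfl⟩
      · obtain ⟨i, b, rfl, hb⟩ := TModel.bot_covBy_iff.1 hzw
        intro hl
        have hl : T.label a = (T₀ i).label b := hl
        refine h5 i b hb (fun h => hw (TModel.isMax_nd.2 h)) ?_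
        rw [← hl]
        exact hr' i
      · obtain ⟨v, rfl, huv⟩ := TModel.nd_covBy_iff.1 hzw
        exact (h2 i).2 u v huv fun h => hw (TModel.isMax_nd.2 h)
    · intro x hx y hy hxy
      have := mt (hr x hx y hy) hxy.ne
      rw [LabelRel] at this
      rcases hT.2.2 a hmax with h | h <;> simpa [h, NodeLabel.kappa] using this
    · intro u hu _
      obtain rfl : u = (⊥ : TModel.JoinNode T₀) :=
        le_antisymm (hu (⊥ : TModel.JoinNode T₀)) (bot_le (α := TModel.JoinNode T₀))
      exact hconn

end Cotree

/-! ### Clean bicotrees -/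

section Bicotree

variable {S : Type} (c : S → Fin 2) (K : SimpleGraph S)

/-- The subgraph of the bipartite graph `K` induced by `X` has a clean bicotree of height at most
`h`. -/
def HasCleanBicotree (h : ℕ) (X : Set S) : Prop :=
  ∃ T : TModel X, T.IsBicotree ∧ T.CleanBicotree ∧ T.HeightLE h ∧ (∀ s, T.color s = c s) ∧
    T.graph = K.comap Subtype.val

variable {c K}

theorem HasCleanBicotree.mono {h k : ℕ} {X : Set S} (hX : HasCleanBicotree c K h X) (hk : h ≤ k) :
    HasCleanBicotree c K k X := by
  obtain ⟨T, h1, h2, h3, h4⟩ := hX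
  exact ⟨T, h1, h2, fun x => (h3 x).trans hk, h4⟩

theorem HasCleanBicotree.of_subsingleton {h : ℕ} {X : Set S} (hX : X.Subsingleton) (hh : 1 ≤ h) :
    HasCleanBicotree c K h X := by
  rcases X.eq_empty_or_nonempty with rfl | ⟨x, hx⟩
  · exact ⟨.empty _, fun u => u.elim, fun u => u.elim, fun u => u.elim, fun s => s.2.elim,
      by ext s; exact s.2.elim⟩
  · have : Unique X := ⟨⟨⟨x, hx⟩⟩, fun y => Subtype.ext (hX y.2 hx)⟩
    have hmax : ∀ u : (TModel.single X (c x)).Node, IsMax u := fun _ _ _ => le_rfl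
    refine ⟨.single X (c x), fun u hu => (hu (hmax u)).elim, fun u hu => (hu (hmax u)).elim,
      fun u => ?_, fun s => ?_, ?_⟩
    · exact (Set.ncard_le_one_of_subsingleton (α := Unit) _).trans hh
    · exact congrArg c (hX hx s.2)
    · ext s t
      obtain rfl := Subsingleton.elim s t
      simp

/-- The join of clean bicotrees of the components. -/
theorem HasCleanBicotree.of_components [Finite S] (hK : ∀ x y, K.Adj x y → c x ≠ c y)
    {l : NodeLabel} {R : S → S → Prop}
    (hl : l = .U ∧ R = K.Adj ∨ l = .B ∧ R = fun x y => c x ≠ c y ∧ ¬ K.Adj x y) {k : ℕ} {X : Set S}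
    (h : ∀ C ⊆ X, CutConn (· ∈ C) R → HasCleanBicotree c K k C) :
    HasCleanBicotree c K (k + 1) X := by
  rcases X.eq_empty_or_nonempty with rfl | hne
  · exact .of_subsingleton Set.subsingleton_empty (by omega)
  obtain ⟨N, r, hr, hr'⟩ := exists_components X (K := R) fun x y h => by
    rcases hl with ⟨-, rfl⟩ | ⟨-, rfl⟩
    · exact h.symm
    · exact ⟨h.1.symm, fun h' => h.2 h'.symm⟩
  choose T' h1 h2 h3 h4 h5 using fun i => h {x | x ∈ X ∧ r x = i} (fun x hx => hx.1) (hr' i)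
  let T₀ : ∀ i, TModel {x // x ∈ X ∧ r x = i} := T'
  have hg : (TModel.join T₀ l c hne).graph = K.comap Subtype.val := by
    refine TModel.join_graph h4 h5 fun x hx y hy hxy => ?_
    have := mt (hr x hx y hy) hxy.ne
    rcases hl with ⟨rfl, rfl⟩ | ⟨rfl, rfl⟩
    · exact iff_of_false this id
    · exact ⟨hK x y, fun h => by_contra fun h' => this ⟨h, h'⟩⟩
  refine ⟨TModel.join T₀ l c hne, .join h1 (by rcases hl with ⟨rfl, -⟩ | ⟨rfl, -⟩ <;> simp),
    .join h2 h4 h5 hg ?_ ?_ ?_, .join h3, fun _ => rfl, hg⟩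
  · rintro rfl
    rcases hl with ⟨-, rfl⟩ | ⟨h, -⟩
    · refine TModel.childrenAreComponents_bot (fun s t => ?_) hr hr'
      rw [hg]
      rfl
    · simp at h
  · rintro rfl
    rcases hl with ⟨h, -⟩ | ⟨-, rfl⟩
    · simp at h
    · refine TModel.childrenAreComponents_bot (R := fun x y => c x ≠ c y ∧ ¬ K.Adj x y)
        (fun s t => ?_) hr hr'
      change _ ∧ ¬ (TModel.join T₀ .B c hne).graph.Adj s t ↔ _
      rw [hg]
      rfl
  · rintro rfl
    rcases hl with ⟨h, -⟩ | ⟨h, -⟩ <;> simp at h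

variable (c) in
/-- All elements have the same color. -/
def Mono (X : Set S) : Prop := ∀ x ∈ X, ∀ y ∈ X, c x = c y

variable (c K) in
/-- All pairs with distinct colors are non-adjacent, or all these pairs are adjacent. -/
def Homog (A B : Set S) : Prop :=
  (∀ x ∈ A, ∀ y ∈ B, c x ≠ c y → ¬ K.Adj x y) ∨ ∀ x ∈ A, ∀ y ∈ B, c x ≠ c y → K.Adj x y

variable (c K) in
/-- Extension of a class by sets of vertices with one color, isolated or adjacent to all vertices of
the other color. -/
def HomogExt (P : Set S → Prop) (X : Set S) : Prop :=
  ∃ A ⊆ X, Mono c A ∧ P (X \ A) ∧ Homog c K A (X \ A)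

theorem HomogExt.subset {P : Set S → Prop} (hP : ∀ X Y, P X → Y ⊆ X → P Y) {X Y : Set S}
    (hX : HomogExt c K P X) (hY : Y ⊆ X) : HomogExt c K P Y := by
  obtain ⟨A, hA, hm, hPA, hh⟩ := hX
  have hsub : Y \ (A ∩ Y) ⊆ X \ A := fun y hy => ⟨hY hy.1, fun h => hy.2 ⟨h, hy.1⟩⟩
  exact ⟨A ∩ Y, Set.inter_subset_right, fun x hx y hy => hm x hx.1 y hy.1, hP _ _ hPA hsub,
    hh.imp (fun h x hx y hy => h x hx.1 y (hsub hy)) fun h x hx y hy => h x hx.1 y (hsub hy)⟩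

/-- Take adjacency or its bipartite complement, whichever is absent between `A` and the rest. It is
also absent inside `A`, where there is only one color. So its connected sets are single vertices of
`A` or avoid `A`, and one more level is enough. -/
theorem HomogExt.hasCleanBicotree [Finite S] (hK : ∀ x y, K.Adj x y → c x ≠ c y) {P : Set S → Prop}
    {k : ℕ} (hk : 1 ≤ k) (hP : ∀ X Y, P X → Y ⊆ X → P Y)
    (hPk : ∀ X, P X → HasCleanBicotree c K k X) {X : Set S} (hX : HomogExt c K P X) :
    HasCleanBicotree c K (k + 1) X := by
  obtain ⟨A, hA, hm, hPA, hh⟩ := hX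
  have key : ∀ R : S → S → Prop, (∀ x y, R x y → c x ≠ c y) →
      (∀ x ∈ A, ∀ y ∈ X \ A, ¬ R x y) → ∀ C ⊆ X, CutConn (· ∈ C) R → HasCleanBicotree c K k C := by
    intro R hR hRA C hC hconn
    by_cases hCA : ∃ x ∈ C, x ∈ A
    · obtain ⟨x, hxC, hxA⟩ := hCA
      have hx : ∀ y ∈ C, x = y := by
        intro y hy
        by_contra hne
        obtain ⟨z, hz, hxz⟩ := hconn.exists_adj hxC hy hne
        by_cases hzA : z ∈ A
        · exact hR x z hxz (hm x hxA z hzA)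
        · exact hRA x hxA z ⟨hC hz, hzA⟩ hxz
      exact .of_subsingleton (fun y hy z hz => (hx y hy).symm.trans (hx z hz)) hk
    · push Not at hCA
      exact hPk C (hP _ _ hPA fun x hx => ⟨hC hx, hCA x hx⟩)
  rcases hh with hh | hh
  · exact .of_components hK (.inl ⟨rfl, rfl⟩) (key _ hK fun x hx y hy h => hh x hx y hy (hK x y h) h)
  · exact .of_components hK (.inr ⟨rfl, rfl⟩)
      (key _ (fun x y h => h.1) fun x hx y hy h => h.2 (hh x hx y hy h.1))

/-! ### Regrouping the children of an ordered node -/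

section Regroup

variable {X : Set S} {r : S → ℕ}
  (hr : ∀ x ∈ X, ∀ y ∈ X, r x ≠ r y → c x = 0 → c y = 1 → (K.Adj x y ↔ r x < r y))

include hr

/-- Between different classes adjacency compares the values of `r`, in a direction determined by the
colors. If `A` has one color and is entirely before or entirely after `B`, the outcome is constant.
-/
theorem homog_of_lt {A B : Set S} (hA : A ⊆ X) (hB : B ⊆ X) (hm : Mono c A)
    (hAB : (∀ x ∈ A, ∀ y ∈ B, r x < r y) ∨ ∀ x ∈ A, ∀ y ∈ B, r y < r x) : Homog c K A B := by
  have hne : ∀ x ∈ A, ∀ y ∈ B, r x ≠ r y := fun x hx y hy =>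
    hAB.elim (fun h => (h x hx y hy).ne) fun h => (h x hx y hy).ne'
  have h0 : ∀ {x y}, x ∈ A → y ∈ B → c x = 0 → c x ≠ c y → (K.Adj x y ↔ r x < r y) := by
    intro x y hx hy hcx hcxy
    have hcy : c y = 1 := TModel.color_eq_one_iff.2 fun h => hcxy (hcx.trans h.symm)
    exact hr x (hA hx) y (hB hy) (hne x hx y hy) hcx hcy
  have h1 : ∀ {x y}, x ∈ A → y ∈ B → c x ≠ 0 → c x ≠ c y → (K.Adj x y ↔ r y < r x) := by
    intro x y hx hy hcx hcxy
    have hcx : c x = 1 := TModel.color_eq_one_iff.2 hcx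
    have hcy : c y = 0 := by
      by_contra h
      exact hcxy (hcx.trans (TModel.color_eq_one_iff.2 h).symm)
    rw [K.adj_comm]
    exact hr y (hB hy) x (hA hx) (hne x hx y hy).symm hcy hcx
  by_cases hz : ∀ x ∈ A, c x = 0
  · rcases hAB with h | h
    · exact .inr fun x hx y hy hc => (h0 hx hy (hz x hx) hc).2 (h x hx y hy)
    · exact .inl fun x hx y hy hc h' => ((h0 hx hy (hz x hx) hc).1 h').asymm (h x hx y hy)
  · push Not at hz
    obtain ⟨z, hzA, hz⟩ := hz
    have hz : ∀ x ∈ A, c x ≠ 0 := fun x hx h => hz ((hm z hzA x hx).trans h)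
    rcases hAB with h | h
    · exact .inl fun x hx y hy hc h' => ((h1 hx hy (hz x hx) hc).1 h').asymm (h x hx y hy)
    · exact .inr fun x hx y hy hc => (h1 hx hy (hz x hx) hc).2 (h x hx y hy)

omit hr in
theorem exists_color_of_not_mono {F : Set S} (h : ¬ Mono c F) (d : Fin 2) : ∃ x ∈ F, c x = d := by
  unfold Mono at h
  push Not at h
  obtain ⟨x, hx, y, hy, hxy⟩ := h
  have : c x = d ∨ c y = d := by
    revert hxy
    generalize c x = i
    generalize c y = j
    revert i j d
    decide
  exact this.elim (fun h => ⟨x, hx, h⟩) fun h => ⟨y, hy, h⟩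

/-- Consecutive classes are merged until they have vertices of both colors. -/
theorem exists_regroup {P : Set S → Prop} (hP : ∀ X Y, P X → Y ⊆ X → P Y)
    (hPr : ∀ i, P {x | x ∈ X ∧ r x = i}) (n : ℕ) : ∃ (q : S → ℕ) (m : ℕ),
      (∀ x ∈ X, r x < n → q x ≤ m) ∧
      (∀ x ∈ X, ∀ y ∈ X, r x < n → r y < n → r x ≤ r y → q x ≤ q y) ∧
      (∀ i < m, ¬ Mono c {x | x ∈ X ∧ r x < n ∧ q x = i} ∧
        HomogExt c K P {x | x ∈ X ∧ r x < n ∧ q x = i}) ∧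
      Mono c {x | x ∈ X ∧ r x < n ∧ q x = m} := by
  induction n with
  | zero => exact ⟨fun _ => 0, 0, fun _ _ h => absurd h (Nat.not_lt_zero _),
      fun _ _ _ _ h => absurd h (Nat.not_lt_zero _), fun _ h => absurd h (Nat.not_lt_zero _),
      fun _ h => absurd h.2.1 (Nat.not_lt_zero _)⟩
  | succ n ih =>
    obtain ⟨q, m, h1, h2, h3, h4⟩ := ih
    -- Groups with index less than `m` are complete. Group `m` has at most one color so far and
    -- receives the class `r x = n`.
    let q' : S → ℕ := fun x => if r x < n then q x else m
    have hq : ∀ x, r x < n → q' x = q x := fun x h => if_pos h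
    have hq' : ∀ x, ¬ r x < n → q' x = m := fun x h => if_neg h
    have h1' : ∀ x ∈ X, r x < n + 1 → q' x ≤ m := by
      intro x hx _
      by_cases h : r x < n
      · exact (hq x h).le.trans (h1 x hx h)
      · exact (hq' x h).le
    have h2' : ∀ x ∈ X, ∀ y ∈ X, r x < n + 1 → r y < n + 1 → r x ≤ r y → q' x ≤ q' y := by
      intro x hx y hy hxn hyn hxy
      by_cases h : r y < n
      · rw [hq x (by omega), hq y h]
        exact h2 x hx y hy (by omega) h hxy
      · exact (h1' x hx hxn).trans (hq' y h).ge
    have h3' : ∀ i < m, {x | x ∈ X ∧ r x < n + 1 ∧ q' x = i} = {x | x ∈ X ∧ r x < n ∧ q x = i} := by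
      intro i hi
      ext x
      by_cases h : r x < n
      · simp [hq x h, h, h.le]
      · simp [hq' x h, h, hi.ne']
    by_cases hm : Mono c {x | x ∈ X ∧ r x < n + 1 ∧ q' x = m}
    · refine ⟨q', m, h1', h2', fun i hi => ?_, hm⟩
      rw [h3' i hi]
      exact h3 i hi
    -- Group `m` now has both colors and is closed. It consists of the former group of one color, in
    -- the role of `A`, and of elements of the class `r x = n`, for which `P` is available. Group `m
    -- + 1` starts empty.
    · refine ⟨q', m + 1, fun x hx h => (h1' x hx h).trans (Nat.le_succ m), h2', fun i hi => ?_, ?_⟩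
      · rcases (Nat.lt_succ_iff.1 hi).lt_or_eq with hi | rfl
        · rw [h3' i hi]
          exact h3 i hi
        refine ⟨hm, {x | x ∈ X ∧ r x < n ∧ q x = i},
          fun x ⟨hx, hn, hi⟩ => ⟨hx, hn.trans (Nat.lt_succ_self n), (hq x hn).trans hi⟩, h4, ?_, ?_⟩
        · refine hP _ _ (hPr n) fun x hx => ⟨hx.1.1, ?_⟩
          by_contra hne
          have := hx.1.2.1
          have h : r x < n := by omega
          exact hx.2 ⟨hx.1.1, h, (hq x h).symm.trans hx.1.2.2⟩
        · refine homog_of_lt hr (fun x hx => hx.1) (fun x hx => hx.1.1) h4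
            (.inl fun x hx y hy => ?_)
          by_contra hlt
          have := hx.2.1
          have h : r y < n := by omega
          exact hy.2 ⟨hy.1.1, h, (hq y h).symm.trans hy.1.2.2⟩
      · intro x hx
        have := h1' x hx.1 hx.2.1
        have := hx.2.2
        omega

/-- A class may lack a color, so classes are merged into groups. A complete group extends a set
satisfying `P` by a set of one color, which costs one level; the last group also absorbs the
unfinished one, which costs another level; the new O-node is the third. -/
theorem hasCleanBicotree_of_ordered [Finite S] (hK : ∀ x y, K.Adj x y → c x ≠ c y)
    {P : Set S → Prop} (hP : ∀ X Y, P X → Y ⊆ X → P Y) {k : ℕ} (hk : 1 ≤ k)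
    (hPk : ∀ X, P X → HasCleanBicotree c K k X) (hPr : ∀ i, P {x | x ∈ X ∧ r x = i}) :
    HasCleanBicotree c K (k + 3) X := by
  obtain ⟨n, hn⟩ : ∃ n, ∀ x, r x < n := by
    obtain ⟨n, hn⟩ := (Set.finite_range r).bddAbove
    exact ⟨n + 1, fun x => Nat.lt_succ_iff.2 (hn ⟨x, rfl⟩)⟩
  obtain ⟨q, m, h1, h2, h3, h4⟩ := exists_regroup hr hP hPr n
  simp only [hn, true_and, true_imp_iff] at h1 h2 h3 h4
  rcases m with _ | m
  -- No group was completed, so `X` has only one color. There are no edges, and a tree of height 2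
  -- suffices.
  · have hm : Mono c X := fun x hx y hy =>
      h4 x ⟨hx, Nat.le_zero.1 (h1 x hx)⟩ y ⟨hy, Nat.le_zero.1 (h1 y hy)⟩
    refine HasCleanBicotree.mono (h := 2) (.of_components hK (.inl ⟨rfl, rfl⟩) fun C hC hconn =>
      .of_subsingleton (fun x hx y hy => ?_) le_rfl) (by omega)
    by_contra hne
    obtain ⟨z, hz, hxz⟩ := hconn.exists_adj hx hy hne
    exact hK x z hxz (hm x (hC hx) z (hC hz))
  have hne : X.Nonempty := by
    by_contra h
    rw [Set.not_nonempty_iff_eq_empty] at h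
    exact (h3 0 (Nat.succ_pos m)).1 fun x hx => by
      rw [h] at hx
      exact hx.1.elim
  -- Group `m + 1` is the unfinished one; the minimum puts it into the last complete group.
  let p : S → Fin (m + 1) := fun x => ⟨min (q x) m, by omega⟩
  have hpr : ∀ x ∈ X, ∀ y ∈ X, p x < p y → r x < r y := by
    intro x hx y hy h
    by_contra hlt
    have := h2 y hy x hx (by omega)
    have h : min (q x) m < min (q y) m := h
    omega
  have hfib : ∀ i : Fin (m + 1), ¬ Mono c {x | x ∈ X ∧ p x = i} ∧
      HasCleanBicotree c K (k + 2) {x | x ∈ X ∧ p x = i} := by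
    intro i
    have hsub : {x | x ∈ X ∧ q x = i} ⊆ {x | x ∈ X ∧ p x = i} := fun x hx =>
      ⟨hx.1, Fin.ext (by have := i.2; have := hx.2; change min (q x) m = i; omega)⟩
    refine ⟨fun h => (h3 i i.2).1 fun x hx y hy => h x (hsub hx) y (hsub hy), ?_⟩
    have hE := (h3 i i.2).2
    refine HomogExt.hasCleanBicotree hK (by omega) (fun X Y hX hY => hX.subset hP hY)
      (fun X hX => hX.hasCleanBicotree hK hk hP hPk)
      ⟨{x | x ∈ X ∧ p x = i ∧ q x = m + 1}, fun x hx => ⟨hx.1, hx.2.1⟩,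
        fun x hx y hy => h4 x ⟨hx.1, hx.2.2⟩ y ⟨hy.1, hy.2.2⟩, hE.subset hP ?_, ?_⟩
    · rintro x ⟨⟨hx, hpx⟩, hx'⟩
      refine ⟨hx, ?_⟩
      have h5 : q x ≠ m + 1 := fun h => hx' ⟨hx, hpx, h⟩
      have h6 := h1 x hx
      have h7 : min (q x) m = i := congrArg Fin.val hpx
      omega
    · refine homog_of_lt hr (fun x hx => hx.1) (fun x hx => hx.1.1)
        (fun x hx y hy => h4 x ⟨hx.1, hx.2.2⟩ y ⟨hy.1, hy.2.2⟩) (.inr fun x hx y hy => ?_)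
      by_contra hlt
      have h5 := h2 x hx.1 y hy.1.1 (by omega)
      have h6 := h1 y hy.1.1
      have h7 := hx.2.2
      exact hy.2 ⟨hy.1.1, hy.1.2, by omega⟩
  choose T' g1 g2 g3 g4 g5 using fun i => (hfib i).2
  let T₀ : ∀ i, TModel {x // x ∈ X ∧ p x = i} := T'
  have hg : (TModel.join T₀ .O c hne).graph = K.comap Subtype.val := by
    refine TModel.join_graph g4 g5 fun x hx y hy hxy => ?_
    have hlt := hpr x hx y hy hxy
    change _ ↔ c x < c y
    by_cases hcx : c x = 0 <;> by_cases hcy : c y = 0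
    · exact iff_of_false (fun h => hK x y h (hcx.trans hcy.symm)) (by simp [hcx, hcy])
    · have hcy := TModel.color_eq_one_iff.2 hcy
      exact iff_of_true ((hr x hx y hy hlt.ne hcx hcy).2 hlt) (by simp [hcx, hcy])
    · have hcx := TModel.color_eq_one_iff.2 hcx
      refine iff_of_false (fun h => ?_) (by simp [hcx, hcy])
      exact hlt.asymm ((hr y hy x hx hlt.ne' hcy hcx).1 h.symm)
    · have hcx := TModel.color_eq_one_iff.2 hcx
      have hcy := TModel.color_eq_one_iff.2 hcy
      exact iff_of_false (fun h => hK x y h (hcx.trans hcy.symm)) (by simp [hcx, hcy])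
  refine ⟨TModel.join T₀ .O c hne, .join g1 (by simp), .join g2 g4 g5 hg (by simp) (by simp) ?_,
    .join g3, fun _ => rfl, hg⟩
  intro _ i _ d
  obtain ⟨x, hx, hd⟩ := exists_color_of_not_mono (hfib i).1 d
  exact ⟨x, hx.1, hx.2, hd⟩

end Regroup

/-- At U- and B-nodes the components of the relevant relation lie above single children, and one
level is added. At an O-node the children induce an ordered partition of `X`, and
`hasCleanBicotree_of_ordered` adds three levels; this is the origin of the factor 3. -/
theorem hasCleanBicotree_of_within [Finite S] {T : TModel S} (hT : T.IsBicotree) (h : ℕ)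
    (X : Set S) (hX : T.Within h X) : HasCleanBicotree T.color T.graph (3 * h) X := by
  have hK : ∀ x y, T.graph.Adj x y → T.color x ≠ T.color y := fun x y => TModel.color_ne_of_adj hT
  induction h generalizing X with
  | zero =>
    obtain ⟨a, -, hd⟩ := hX
    exact absurd (hd a le_rfl) (lt_irrefl _)
  | succ h ih =>
    obtain ⟨a, ha, hd⟩ := hX
    by_cases hmax : IsMax a
    · exact .of_subsingleton (TModel.subsingleton_of_isMax hmax ha) (by omega)
    rcases X.eq_empty_or_nonempty with rfl | hne
    · exact .of_subsingleton Set.subsingleton_empty (by omega)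
    -- The node `a` has a child within the height available, so trees with a single node fit into
    -- height `3 * h`.
    have hh : 1 ≤ h := by
      obtain ⟨b, hb, -⟩ := TModel.exists_child_of_mem_leaves hmax (ha _ hne.some_mem)
      have := hd b hb.le
      have := TModel.depth_of_covBy hb
      omega
    have key : ∀ R : S → S → Prop, (∀ b b' x y, a ⋖ b → a ⋖ b' → b ≠ b' → b ≤ T.leaf x →
        b' ≤ T.leaf y → ¬ R x y) → ∀ C ⊆ X, CutConn (· ∈ C) R →
          HasCleanBicotree T.color T.graph (3 * h) C := by
      intro R hR C hC hconn
      rcases C.eq_empty_or_nonempty with rfl | hC'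
      · exact .of_subsingleton Set.subsingleton_empty (by omega)
      · exact ih C (TModel.within_of_cutConn hmax (fun x hx => ha x (hC hx)) hd hR hC' hconn)
    rcases hT a hmax with ⟨-, hl⟩ | ⟨-, hl⟩ | ⟨hC, hl⟩
    · refine HasCleanBicotree.mono (.of_components hK (.inl ⟨rfl, rfl⟩) (key _ ?_))
        (by omega : 3 * h + 1 ≤ _)
      exact fun b b' x y hb hb' hne hx hy => TModel.not_adj_of_label_U hT hne hb hb' hx hy hl
    · refine HasCleanBicotree.mono (.of_components hK (.inr ⟨rfl, rfl⟩) (key _ ?_))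
        (by omega : 3 * h + 1 ≤ _)
      exact fun b b' x y hb hb' hne hx hy hxy =>
        hxy.2 ((TModel.adj_iff_of_label_B hT hne hb hb' hx hy hl).2 hxy.1)
    · have : Nonempty T.Node := ⟨a⟩
      choose! f hf hfx using fun x (hx : x ∈ X) => TModel.exists_child_of_mem_leaves hmax (ha x hx)
      refine hasCleanBicotree_of_ordered (r := fun x => T.index (f x)) ?_ hK
        (P := T.Within h) (fun X Y hX hY => hX.subset hY) (by omega : 1 ≤ 3 * h) ih fun i => ?_
      · intro x hx y hy hxy hcx hcy
        rw [TModel.index_lt_iff hC (hf x hx) (hf y hy)]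
        exact TModel.adj_iff_of_label_O hT (fun h => hxy (congrArg T.index h)) (hf x hx) (hf y hy)
          (hfx x hx) (hfx y hy) hl hcx hcy
      · by_cases hi : ∃ x ∈ X, T.index (f x) = i
        · obtain ⟨x, hx, rfl⟩ := hi
          refine TModel.within_child hd (hf x hx) fun y hy => ?_
          rw [← TModel.index_inj hC (hf y hy.1) (hf x hx) hy.2]
          exact hfx y hy.1
        -- The class of this index is empty, so any child of `a` can be used.
        · obtain ⟨x, hx⟩ := hne
          exact TModel.within_child hd (hf x hx) fun y hy => (hi ⟨y, hy⟩).elim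

end Bicotree

/-! ### The main theorem -/

/-- Renaming of the ground. -/
def TModel.relabel {S S' : Type} (T : TModel S) (e : S' ≃ S) : TModel S' where
  __ := T
  leaf s := T.leaf (e s)
  leaf_injective := T.leaf_injective.comp e.injective
  leaf_range := (e.surjective.range_comp T.leaf).trans T.leaf_range
  color s := T.color (e s)

section Relabel

variable {S S' : Type} {T : TModel S} (e : S' ≃ S)

theorem TModel.relabel_graph : (T.relabel e).graph = T.graph.comap e := by
  ext s t
  exact and_congr e.injective.ne_iff.symm Iff.rfl

theorem TModel.IsCotree.relabel (hT : T.IsCotree) : (T.relabel e).IsCotree :=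
  ⟨hT.1, fun s => hT.2.1 (e s), hT.2.2⟩

theorem TModel.ChildrenAreComponents.relabel {K : SimpleGraph S} {K' : SimpleGraph S'}
    (hK : ∀ s t, K'.Adj s t ↔ K.Adj (e s) (e t)) {u : T.Node} (h : T.ChildrenAreComponents K u) :
    (T.relabel e).ChildrenAreComponents K' u := by
  let f : K'.induce ((T.relabel e).leaves u) ≃g K.induce (T.leaves u) :=
    { toEquiv := e.subtypeEquiv fun _ => Iff.rfl
      map_rel_iff' := fun {s t} => (hK s t).symm }
  intro s t
  rw [← f.reachable_iff]
  exact h (f s) (f t)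

theorem TModel.CleanBicotree.relabel (hT : T.CleanBicotree) : (T.relabel e).CleanBicotree := by
  have hg : ∀ s t, (T.relabel e).graph.Adj s t ↔ T.graph.Adj (e s) (e t) := fun s t => by
    rw [relabel_graph]
    rfl
  refine fun u hu => ⟨fun h => ((hT u hu).1 h).relabel e hg,
    fun h => ((hT u hu).2.1 h).relabel e fun s t => and_congr Iff.rfl (not_congr (hg s t)),
    fun h v hv c => ?_⟩
  obtain ⟨s, hs, hc⟩ := (hT u hu).2.2 h v hv c
  refine ⟨e.symm s, ?_, ?_⟩
  · change v ≤ T.leaf (e (e.symm s))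
    rwa [e.apply_symm_apply]
  · change T.color (e (e.symm s)) = c
    rwa [e.apply_symm_apply]

theorem TModel.HeightLE.within {h : ℕ} (hT : T.HeightLE h) (a : T.Node) :
    T.Within h Set.univ := by
  obtain ⟨b, -, hb⟩ := exists_isBot_le a
  refine ⟨b, fun x _ => hb _, fun y _ => (hT.depth_lt y).trans_le (Nat.le_add_left _ _)⟩

/-- The construction on subsets yields a tree with ground `Set.univ`, hence the relabeling. A tree
without nodes has no subtree to start from, but is clean already. -/
theorem exists_cleanCotree [Finite S] {h : ℕ} (hT : T.IsCotree) (hh : T.HeightLE h) :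
    ∃ T' : TModel S, T'.IsCotree ∧ T'.CleanCotree ∧ T'.HeightLE h ∧ T'.graph = T.graph := by
  by_cases hne : Nonempty T.Node
  · obtain ⟨T', h1, h2, h3, h4, -⟩ := hasCleanCotree_of_within hT h _ (hh.within hne.some)
    refine ⟨T'.relabel (Equiv.Set.univ S).symm, h1.relabel _, h2, h3, ?_⟩
    rw [TModel.relabel_graph, h4]
    rfl
  · rw [not_nonempty_iff] at hne
    exact ⟨T, hT, ⟨fun u => isEmptyElim u, fun u => isEmptyElim u⟩, hh, rfl⟩

theorem exists_cleanBicotree [Finite S] {h : ℕ} (hT : T.IsBicotree) (hh : T.HeightLE h) :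
    ∃ T' : TModel S, T'.IsBicotree ∧ T'.CleanBicotree ∧ T'.HeightLE (3 * h) ∧
      T'.color = T.color ∧ T'.graph = T.graph := by
  by_cases hne : Nonempty T.Node
  · obtain ⟨T', h1, h2, h3, h4, h5⟩ := hasCleanBicotree_of_within hT h _ (hh.within hne.some)
    refine ⟨T'.relabel (Equiv.Set.univ S).symm, h1, h2.relabel _, h3, funext fun s => h4 _, ?_⟩
    rw [TModel.relabel_graph, h5]
    rfl
  · rw [not_nonempty_iff] at hne
    exact ⟨T, hT, fun u => isEmptyElim u, fun u => isEmptyElim u, rfl, rfl⟩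

end Relabel

theorem HasSplit.hasCleanSplit {V : Type} [Finite V] {G : SimpleGraph V} {n h H : ℕ}
    (hG : HasSplit G n h) (hH : 3 * h ≤ H) : HasCleanSplit G n H := by
  obtain ⟨part, hp⟩ := hG
  refine ⟨part, fun a => ?_⟩
  obtain ⟨T, hT, hh, hg⟩ := hp a
  rcases a with i | p
  · obtain ⟨T', h1, h2, h3, h4⟩ := exists_cleanCotree hT hh
    exact ⟨T', h1, h2, fun x => (h3 x).trans (by omega), h4.trans hg⟩
  · obtain ⟨T', h1, h2, h3, h4, h5⟩ := exists_cleanBicotree hT.1 hh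
    exact ⟨T', ⟨h1, fun v => h4 ▸ hT.2 v⟩, h2, fun x => (h3 x).trans hH, h5.trans hg⟩

/-- The parts of two vertices determine the single piece in which their adjacency is decided, so the
pieces can be chosen independently. For distinct parts this piece is indexed by the increasing pair.
-/
theorem HasCleanSplit.exists_amalgam {V : Type} {G : SimpleGraph V} {n H : ℕ}
    (hG : HasCleanSplit G n H) :
    ∃ D : Amalgam n V, D.Clean ∧ D.HeightLE H ∧ D.graph = G := by
  obtain ⟨part, hp⟩ := hG
  choose T h1 h2 h3 h4 using hp
  let D : Amalgam n V := ⟨part, T, h1⟩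
  refine ⟨D, h2, h3, ?_⟩
  have hr : ∀ s t, (hst : part s < part t) → (D.graph.Adj s t ↔ G.Adj s t) := by
    intro s t hst
    have := Amalgam.graph_adj_iff_inr (D := D) (p := ⟨(part s, part t), hst⟩) ⟨s, .inl rfl⟩
      ⟨t, .inr rfl⟩ hst.ne
    rw [this, show (D.tree (.inr ⟨(part s, part t), hst⟩)).graph = _ from h4 _]
    exact and_iff_left hst.ne
  ext s t
  rcases lt_trichotomy (part s) (part t) with hst | hst | hst
  · exact hr s t hst
  · have := Amalgam.graph_adj_iff_inl (D := D) (i := part t) ⟨s, hst⟩ ⟨t, rfl⟩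
    rw [this, show (D.tree (.inl (part t))).graph = _ from h4 _]
    exact Iff.rfl
  · rw [D.graph.adj_comm, G.adj_comm]
    exact hr t s hst

theorem mainTheorem7 (n H : ℕ) :
    ∃ Sparse : Transduction FirstOrder.Language.graph (amalgLang n),
      ∀ C : Set FinGraph,
        ((∃ h, 3 * h ≤ H ∧ ∀ G ∈ C, HasSplit G.graph n h) ∨
          ∀ G ∈ C, HasCleanSplit G.graph n H) →
        -- a modelization of `C` in amalgams of height at most `H`
        IsModelizationIn C (amalgamsOfHeightLE n H) (AmalgRel.ground : AmalgRel n 1)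
          (SBuild n H) Sparse ∧
        -- clean amalgam models are accessible
        (∀ G ∈ C, ∀ (V : Type) [Finite V] (D : Amalgam n V), D.Clean → D.HeightLE H →
          ∀ e : ModelIso (SBuild n H) G D.str, Accessible Sparse e) ∧
        -- taking generated submodels is a model restriction
        (∀ G ∈ C, ∀ (V : Type) [Finite V] (D : Amalgam n V), D.HeightLE H →
          ModelIso (SBuild n H) G D.str →
          ∀ X : Set V, ∃ ι : (D.restrict X).str ↪[amalgLang n] D.str,
            (⇑ι = D.restrictIncl X) ∧
            IsModelRestriction (SBuild n H) (M := D.str) (Sum.inl '' X) ι) := by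
  obtain ⟨T, hT, hmem⟩ := exists_sparse n H
  refine ⟨T, fun C hC => ⟨⟨SBuild_simpleGraph n H, SBuild_domain n H, fun G hG => ?_,
    fun G _ M o h _ => hmem G M o h⟩, fun G _ V _ D => hT G V D, fun G _ V _ D hD _ X => ?_⟩⟩
  -- The assumption on the class serves to exhibit a clean amalgam that models `G`; it is then
  -- accessible like every clean model.
  · have hs : HasCleanSplit G.graph n H := by
      rcases hC with ⟨h, hH, hC⟩ | hC
      · exact (hC G hG).hasCleanSplit hH
      · exact hC G hG
    obtain ⟨D, hc, hh, hg⟩ := hs.exists_amalgam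
    obtain ⟨e⟩ : Nonempty (ModelIso (SBuild n H) G D.str) := by
      have := Amalgam.exists_modelIso hh
      rwa [hg] at this
    exact ⟨D.str, e, hT G G.V D hc hh e⟩
  · obtain ⟨ι, hι⟩ := D.exists_restrictEmbedding X
    exact ⟨ι, hι, D.isModelRestriction hD X ι hι⟩
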